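/- Let $n \ge 0$ be an integer and let $O_q(M(n))$ be the associative unital $\mathbb{Q}(q)$-algebra generated by $Z_{ij}$ ($1 \le i,j \le n$) subject to the relations $$Z_{ij}Z_{ik}=q^2Z_{ik}Z_{ij}\ (j<k),\qquad Z_{ij}Z_{kj}=q^2Z_{kj}Z_{ij}\ (i<k),$$ $$Z_{ij}Z_{st}=Z_{st}Z_{ij}\ (i>s,\ j<t),\qquad Z_{ij}Z_{st}=Z_{st}Z_{ij}+(q^2-q^{-2})Z_{it}Z_{sj}\ (i<s,\ j<t).$$ Let $\overline{\phantom{x}}$ be the ring anti-automorphism of $O_q(M(n))$ with $\overline{Z_{ij}}=Z_{ij}$ and $\overline{q}=q^{-1}$. For $A=(a_{ij})\in M_n(\mathbb{Z}_{\ge 0})$ let $Z^A=\prod_{i,j}Z_{ij}^{a_{ij}}$, with the factors in the lexicographic order of $(i,j)$, and $$Z(A)=q^{-\sum_i\sum_{j>k}a_{ij}a_{ik}-\sum_i\sum_{j>k}a_{ji}a_{ki}}\,Z^A .$$ Let $L^*$ be the $\mathbb{Z}[q]$-span of all $Z(A)$. Matrices are compared in the lexicographic order $<$ of their entries, the positions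 $(i,j)$ being themselves ordered lexicographically. There is a unique family $(b(A))_{A\in M_n(\mathbb{Z}_{\ge 0})}$ that is a $\mathbb{Z}[q]$-basis of $L^*$ and satisfies, for all $A$, $\overline{b(A)}=b(A)$ and $b(A)=Z(A)+\sum_{B<A}h_B(A)Z(B)$ (a finite sum) with $h_B(A)\in q\mathbb{Z}[q]$, where $B$ runs over matrices with the same row sums and the same column sums as $A$. Put $B^*=\{b(A)\mid A \in M_n(\mathbb{Z}_{\ge 0})\}$. For $I=\{i_1<\dots<i_m\}\subseteq\{1,\dots,n\}$ let $$\det\nolimits_q(I,I)=\sum_{\sigma\in S_m}(-q^2)^{l(\sigma)}Z_{i_1i_{\sigma(1)}}\cdots Z_{i_mi_{\sigma(m)}},$$ where $l(\sigma)$ is the number of inversions of $\sigma$; put $\det_q=\det_q(\{1,\dots,n\},\{1,\dots,n\})$ and $\det_{q,i}=\det_q(\{i,\dots,n\},\{i,\dots,n\})$. Proposition 3.6. The basis $B^*$ is invariant under (left and right) multiplication by $\det_q$. More precisely, $$b(A)\det\nolimits_q=b(A+I_n)\qquad\text{for all }A\in M_n(\mathbb{Z}_{\ge 0}),$$ where $I_n$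 is the identity matrix. Consequently, if $A=\mathrm{diag}(a_1,\dots,a_n)$ with $a_1\le a_2\le\dots\le a_n$, then, with $a_0=0$, $$b(A)=\prod_{i=1}^n\det\nolimits_{q,i}^{\,a_i-a_{i-1}} .$$ For an arbitrary diagonal matrix $A=\mathrm{diag}(a_1,\dots,a_n)$ and any permutation $\tau$ of $\{1,\dots,n\}$ with $a_{\tau(1)}\le\dots\le a_{\tau(n)}$, with $I_i=\{\tau(i),\dots,\tau(n)\}$ and $a_{\tau(0)}:=0$, $$b(A)=\prod_{i=1}^n\det\nolimits_q(I_i,I_i)^{\,a_{\tau(i)}-a_{\tau(i-1)}} .$$ In both formulas the factors are multiplied in the order $i=1,\dots,n$. -/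

import Mathlib

namespace QuantumMatrix

noncomputable section

/-- The ground field `ℚ(q)`. -/
abbrev K : Type := RatFunc ℚ

/-- The indeterminate `q` of `ℚ(q)`. -/
def q : K := RatFunc.X

theorem eval₂_inv_injective (F : Type) [Field F] :
    Function.Injective
      (Polynomial.eval₂RingHom (RatFunc.C : F →+* RatFunc F) (RatFunc.X : RatFunc F)⁻¹) := by
  have h : Transcendental F (RatFunc.X : RatFunc F)⁻¹ := fun h =>
    RatFunc.transcendental_X (IsAlgebraic.inv_iff.mp h)
  exact transcendental_iff_injective.mp h

/-- The bar involution of `ℚ(q)`, a ring homomorphism with `q ↦ q⁻¹`. -/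
def barK : K →+* K :=
  RatFunc.liftRingHom (Polynomial.eval₂RingHom RatFunc.C (q⁻¹ : K))
    (nonZeroDivisors_le_comap_nonZeroDivisors_of_injective _ (eval₂_inv_injective ℚ))

theorem barK_q : barK q = q⁻¹ := by
  have h : (q : K) = algebraMap (Polynomial ℚ) K Polynomial.X := RatFunc.algebraMap_X.symm
  have h2 : barK (algebraMap (Polynomial ℚ) K Polynomial.X) = q⁻¹ := by
    unfold barK
    rw [RatFunc.liftRingHom_algebraMap]
    simp
  rw [h, h2, h]

theorem q_ne_zero : q ≠ 0 := RatFunc.X_ne_zero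

/-- The subring `ℤ[q]` of `ℚ(q)`. -/
def Zq : Subring K := Subring.closure {q}

/-- The generators of the free algebra on `n²` letters. -/
abbrev gen {n : ℕ} (i j : Fin n) : FreeAlgebra K (Fin n × Fin n) := FreeAlgebra.ι K (i, j)

/-- The defining relations of the algebra of quantum `n × n` matrices. -/
inductive Rel (n : ℕ) :
    FreeAlgebra K (Fin n × Fin n) → FreeAlgebra K (Fin n × Fin n) → Prop
  | row (i j k : Fin n) (h : j < k) :
      Rel n (gen i j * gen i k) (q ^ 2 • (gen i k * gen i j))
  | col (i k j : Fin n) (h : i < k) :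
      Rel n (gen i j * gen k j) (q ^ 2 • (gen k j * gen i j))
  | anti (i j s t : Fin n) (h : s < i) (h' : j < t) :
      Rel n (gen i j * gen s t) (gen s t * gen i j)
  | diag (i j s t : Fin n) (h : i < s) (h' : j < t) :
      Rel n (gen i j * gen s t)
        (gen s t * gen i j + (q ^ 2 - (q⁻¹) ^ 2) • (gen i t * gen s j))

/-- The coordinate algebra `O_q(M(n))` of quantum `n × n` matrices. -/
abbrev O (n : ℕ) : Type := RingQuot (Rel n)

/-- The generators `Z_{ij}` of `O_q(M(n))`. -/
def Z {n : ℕ} (i j : Fin n) : O n := RingQuot.mkAlgHom K (Rel n) (gen i j)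

theorem Z_row {n : ℕ} (i j k : Fin n) (h : j < k) :
    Z i j * Z i k = q ^ 2 • (Z i k * Z i j) := by
  simpa [Z] using RingQuot.mkAlgHom_rel K (Rel.row i j k h)

theorem Z_col {n : ℕ} (i k j : Fin n) (h : i < k) :
    Z i j * Z k j = q ^ 2 • (Z k j * Z i j) := by
  simpa [Z] using RingQuot.mkAlgHom_rel K (Rel.col i k j h)

theorem Z_anti {n : ℕ} (i j s t : Fin n) (h : s < i) (h' : j < t) :
    Z i j * Z s t = Z s t * Z i j := by
  simpa [Z] using RingQuot.mkAlgHom_rel K (Rel.anti i j s t h h')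

theorem Z_diag {n : ℕ} (i j s t : Fin n) (h : i < s) (h' : j < t) :
    Z i j * Z s t = Z s t * Z i j + (q ^ 2 - (q⁻¹) ^ 2) • (Z i t * Z s j) := by
  have := RingQuot.mkAlgHom_rel K (Rel.diag i j s t h h')
  simpa only [Z, map_mul, map_add, map_smul] using this

/-- The scalar embedding `ℚ(q) → O_q(M(n))ᵒᵖ` twisted by the bar involution. -/
def twist (n : ℕ) : K →+* (O n)ᵐᵒᵖ := (algebraMap K (O n)ᵐᵒᵖ).comp barK

theorem twist_commutes {n : ℕ} (c : K) (x : (O n)ᵐᵒᵖ) : twist n c * x = x * twist n c :=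
  Algebra.commutes (barK c) x

/-- The bar-semilinear anti-homomorphism on the free algebra fixing the generators. -/
def freeBar (n : ℕ) : FreeAlgebra K (Fin n × Fin n) →+* (O n)ᵐᵒᵖ :=
  letI : Algebra K (O n)ᵐᵒᵖ := (twist n).toAlgebra' twist_commutes
  (FreeAlgebra.lift K (fun p : Fin n × Fin n => MulOpposite.op (Z p.1 p.2))).toRingHom

theorem freeBar_gen {n : ℕ} (i j : Fin n) : freeBar n (gen i j) = MulOpposite.op (Z i j) := by
  let _ : Algebra K (O n)ᵐᵒᵖ := (twist n).toAlgebra' twist_commutes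
  exact FreeAlgebra.lift_ι_apply (R := K)
    (fun p : Fin n × Fin n => MulOpposite.op (Z p.1 p.2)) (i, j)

theorem freeBar_smul {n : ℕ} (c : K) (x : FreeAlgebra K (Fin n × Fin n)) :
    freeBar n (c • x) = MulOpposite.op (barK c • (freeBar n x).unop) := by
  have h : freeBar n (algebraMap K _ c) = twist n c := by
    let _ : Algebra K (O n)ᵐᵒᵖ := (twist n).toAlgebra' twist_commutes
    exact (FreeAlgebra.lift K
      (fun p : Fin n × Fin n => MulOpposite.op (Z p.1 p.2))).commutes c
  rw [Algebra.smul_def, map_mul, h, twist, RingHom.comp_apply, ← Algebra.smul_def]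
  rfl

theorem freeBar_rel {n : ℕ} ⦃x y : FreeAlgebra K (Fin n × Fin n)⦄ (h : Rel n x y) :
    freeBar n x = freeBar n y := by
  have hq := q_ne_zero
  cases h with
  | row i j k h =>
    rw [freeBar_smul, map_mul, map_mul, freeBar_gen, freeBar_gen]
    apply MulOpposite.unop_injective
    simp only [MulOpposite.unop_mul, MulOpposite.unop_op, map_pow, barK_q]
    rw [Z_row i j k h, smul_smul, ← mul_pow, inv_mul_cancel₀ hq, one_pow, one_smul]
  | col i k j h =>
    rw [freeBar_smul, map_mul, map_mul, freeBar_gen, freeBar_gen]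
    apply MulOpposite.unop_injective
    simp only [MulOpposite.unop_mul, MulOpposite.unop_op, map_pow, barK_q]
    rw [Z_col i k j h, smul_smul, ← mul_pow, inv_mul_cancel₀ hq, one_pow, one_smul]
  | anti i j s t h h' =>
    rw [map_mul, map_mul, freeBar_gen, freeBar_gen]
    apply MulOpposite.unop_injective
    simp only [MulOpposite.unop_mul, MulOpposite.unop_op]
    exact (Z_anti i j s t h h').symm
  | diag i j s t h h' =>
    rw [map_add, freeBar_smul, map_mul, map_mul, map_mul, freeBar_gen, freeBar_gen,
      freeBar_gen, freeBar_gen]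
    apply MulOpposite.unop_injective
    simp only [MulOpposite.unop_mul, MulOpposite.unop_op, MulOpposite.unop_add, map_pow,
      map_sub, map_inv₀, barK_q, inv_inv]
    rw [Z_diag i j s t h h', Z_anti s j i t h h', add_assoc, ← add_smul]
    simp

/-- The bar map as a ring homomorphism from `O_q(M(n))` to its opposite ring. -/
def barHom (n : ℕ) : O n →+* (O n)ᵐᵒᵖ := RingQuot.lift ⟨freeBar n, freeBar_rel⟩

/-- The bar anti-automorphism of `O_q(M(n))`: `Z_{ij} ↦ Z_{ij}`, `q ↦ q⁻¹`. -/
def bar {n : ℕ} (x : O n) : O n := (barHom n x).unop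

theorem barHom_mk {n : ℕ} (x : FreeAlgebra K (Fin n × Fin n)) :
    barHom n (RingQuot.mkAlgHom K (Rel n) x) = freeBar n x := by
  have h := RingQuot.lift_mkRingHom_apply (freeBar n) (freeBar_rel (n := n)) x
  rw [← RingQuot.mkAlgHom_coe K (Rel n)] at h
  exact h

theorem bar_Z {n : ℕ} (i j : Fin n) : bar (Z i j) = Z i j := by
  rw [bar, Z, barHom_mk, freeBar_gen]
  rfl

theorem bar_mul {n : ℕ} (x y : O n) : bar (x * y) = bar y * bar x := by
  simp [bar]

theorem bar_add {n : ℕ} (x y : O n) : bar (x + y) = bar x + bar y := by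
  simp [bar]

theorem bar_smul {n : ℕ} (c : K) (x : O n) : bar (c • x) = barK c • bar x := by
  obtain ⟨x, rfl⟩ := RingQuot.mkAlgHom_surjective K (Rel n) x
  rw [bar, bar, ← map_smul, barHom_mk, barHom_mk, freeBar_smul]
  rfl

/-- The index set of the basis: `n × n` matrices with entries in `{0, 1, 2, …}`. -/
abbrev Mat (n : ℕ) : Type := Matrix (Fin n) (Fin n) ℕ

/-- Row sums. -/
def ro {n : ℕ} (A : Mat n) : Fin n → ℕ := fun i => ∑ j, A i j

/-- Column sums. -/
def co {n : ℕ} (A : Mat n) : Fin n → ℕ := fun j => ∑ i, A i j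

/-- The strict lexicographic order `B < A` on matrices: the entries are compared in the
lexicographic order of the index pairs. -/
def LexLT {n : ℕ} (B A : Mat n) : Prop :=
  ∃ i j, B i j < A i j ∧ ∀ k l, (k < i ∨ (k = i ∧ l < j)) → B k l = A k l

/-- The monomial `Z^A = ∏ Z_{ij}^{a_{ij}}`, factors in the lexicographic order of `(i, j)`. -/
def monomial {n : ℕ} (A : Mat n) : O n :=
  (List.ofFn fun i => (List.ofFn fun j => Z i j ^ A i j).prod).prod

/-- The exponent `∑_i ∑_{j>k} a_{ij} a_{ik} + ∑_i ∑_{j>k} a_{ji} a_{ki}`. -/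
def normExp {n : ℕ} (A : Mat n) : ℕ :=
  (∑ i, ∑ k, ∑ j ∈ Finset.Ioi k, A i j * A i k) +
    ∑ i, ∑ k, ∑ j ∈ Finset.Ioi k, A j i * A k i

/-- The normalized monomial `Z(A) = D(A) Z^A`. -/
def ZN {n : ℕ} (A : Mat n) : O n := (q⁻¹) ^ normExp A • monomial A

/-- The `ℤ[q]`-lattice `L^*` spanned by the `Z(A)`. -/
def lattice (n : ℕ) : Submodule Zq (O n) := Submodule.span Zq (Set.range (ZN (n := n)))

/-- The family `A ↦ b(A)` is a `ℤ[q]`-basis of `L^*`, consists of bar-invariant elements,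
and is unitriangular with respect to the `Z(A)` with off-diagonal coefficients in `q ℤ[q]`. -/
structure IsDualCanonicalBasis {n : ℕ} (b : Mat n → O n) : Prop where
  linearIndependent : LinearIndependent Zq b
  span_eq : Submodule.span Zq (Set.range b) = lattice n
  bar_eq : ∀ A, bar (b A) = b A
  triangular : ∀ A, ∃ h : Mat n →₀ K,
    (∀ B ∈ h.support, LexLT B A ∧ ro B = ro A ∧ co B = co A ∧ ∃ p ∈ Zq, h B = q * p) ∧
    b A = ZN A + h.sum fun B c => c • ZN B

/-- The length (number of inversions) of a permutation. -/
def len {m : ℕ} (σ : Equiv.Perm (Fin m)) : ℕ :=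
  (Finset.univ.filter fun p : Fin m × Fin m => p.1 < p.2 ∧ σ p.2 < σ p.1).card

/-- The quantum determinant
`det_q = ∑_σ (-q²)^{l(σ)} Z_{1σ(1)} ⋯ Z_{nσ(n)}`. -/
def detq (n : ℕ) : O n :=
  ∑ σ : Equiv.Perm (Fin n), (-q ^ 2) ^ len σ • (List.ofFn fun k => Z k (σ k)).prod

/-- The principal quantum minor `det_q(I, I)`: the quantum determinant of the subalgebra
generated by the `Z_{st}` with `s, t ∈ I`, the elements of `I` being listed increasingly. -/
def principalMinor {n : ℕ} (I : Finset (Fin n)) : O n :=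
  ∑ σ : Equiv.Perm (Fin I.card), (-q ^ 2) ^ len σ •
    (List.ofFn fun k => Z (I.orderEmbOfFin rfl k) (I.orderEmbOfFin rfl (σ k))).prod

/-- The corner quantum determinant `det_{q,i}` of the subalgebra generated by the `Z_{st}`
with `s, t ≥ i`. -/
def cornerDet {n : ℕ} (i : Fin n) : O n := principalMinor (Finset.Ici i)

/-- The increment `a_i - a_{i-1}` of a sequence `a_1, …, a_n`, where `a_0 = 0`. It is used
for nondecreasing sequences, where the subtraction does not truncate. -/
def step {n : ℕ} (a : Fin n → ℕ) (i : Fin n) : ℕ :=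
  a i - if (i : ℕ) = 0 then 0 else a ⟨(i : ℕ) - 1, lt_of_le_of_lt (Nat.sub_le _ _) i.isLt⟩

end

end QuantumMatrix

namespace QuantumMatrix

set_option linter.unusedSimpArgs false

noncomputable section

section

open Polynomial

/-! ### Scalars -/

/-! Everything rests on one rigidity principle, `eq_zero_of_mem_qLattice`: an element of `q L^*`
that is fixed or negated by the bar map is zero. Indeed bar is unitriangular on the `Z(A)`, so the
coefficient `c ∈ q ℤ[q]` at the largest matrix in the support satisfies `barK c = ± c`, which forces
`c = 0`. Reading off coefficients requires the `Z(A)` to be linearly independent over `ℚ(q)`; this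
is proved by building the algebra as an iterated Ore extension, one letter at a time.
Unitriangularity of bar comes from straightening words: reversing a suitably normalized word amounts
to applying bar, and reordering letters only creates terms with smaller content and equal margins.
The Kazhdan–Lusztig argument then gives existence of the basis, and rigidity gives uniqueness in a
strong form (`eq_dualCanonical`): a bar-invariant element congruent to `Z(A)` modulo `q L^*` is
`b(A)`, with no triangularity assumed.

Two facts about the determinant are therefore enough: it is bar-invariant, and `Z(A) det_q ≡ Z(A +
1) ≡ det_q Z(A)` modulo `q L^*`. Bar-invariance (`bar_minor`) is the equality of two Laplace
expansions along the last row, with its entries on the right or on the left. The first congruence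
(`MinorTower.rowsZN_mul_sub_mem`) is an induction on the number of rows: the last row monomial is
moved past the minor on the first rows, the minor is expanded along its last row, and the smaller
minors are absorbed inductively. The second follows by the anti-automorphism reversing rows and
columns.

Now `b(A) det_q` and `det_q b(A)` are both congruent to `Z(A + 1)` and are exchanged by bar. Their
difference lies in `q L^*` and is negated by bar, so it vanishes; the common value is then
bar-invariant and equals `b(A + 1)`. Centrality of the determinant is thus not needed beforehand.

For diagonal matrices, the inclusion of a principal subalgebra commutes with bar and maps each
`Z(A)` to a `Z(A')`, so it maps dual canonical basis elements to such elements. Left multiplication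
by `det_q(I, I)` hence adds 1 on `I` to a diagonal supported in `I`, and the product formula follows
by building the diagonal from the last factor to the first. -/

theorem q_mem_Zq : q ∈ Zq := Subring.subset_closure rfl

theorem aeval_q_mem_Zq (f : ℤ[X]) : aeval q f ∈ Zq := by
  induction f using Polynomial.induction_on' with
  | add f g hf hg => rw [map_add]; exact add_mem hf hg
  | monomial n a =>
    rw [aeval_monomial]
    exact mul_mem (by simp) (pow_mem q_mem_Zq n)

theorem mem_Zq_iff {x : K} : x ∈ Zq ↔ ∃ f : ℤ[X], aeval q f = x := by
  constructor
  · intro hx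
    induction hx using Subring.closure_induction with
    | mem x hx => exact ⟨X, by rw [aeval_X]; exact hx.symm⟩
    | zero => exact ⟨0, by simp⟩
    | one => exact ⟨1, by simp⟩
    | add x y _ _ hx hy =>
      obtain ⟨f, rfl⟩ := hx; obtain ⟨g, rfl⟩ := hy; exact ⟨f + g, by simp⟩
    | neg x _ hx => obtain ⟨f, rfl⟩ := hx; exact ⟨-f, by simp⟩
    | mul x y _ _ hx hy =>
      obtain ⟨f, rfl⟩ := hx; obtain ⟨g, rfl⟩ := hy; exact ⟨f * g, by simp⟩
  · rintro ⟨f, rfl⟩; exact aeval_q_mem_Zq f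

theorem aeval_q_injective : Function.Injective (aeval q : ℤ[X] →ₐ[ℤ] K) := by
  have h : ((aeval q : ℤ[X] →ₐ[ℤ] K) : ℤ[X] →+* K) =
      (algebraMap ℚ[X] K).comp (mapRingHom (Int.castRingHom ℚ)) := by
    apply Polynomial.ringHom_ext
    · intro a; simp
    · simp only [RingHom.coe_coe, aeval_X, RingHom.comp_apply, coe_mapRingHom, map_X]
      exact RatFunc.algebraMap_X.symm
  have h2 : Function.Injective ((algebraMap ℚ[X] K).comp (mapRingHom (Int.castRingHom ℚ))) :=
    (RatFunc.algebraMap_injective ℚ).comp (map_injective _ Int.cast_injective)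
  rw [← h] at h2
  exact h2

theorem barK_aeval (g : ℤ[X]) : barK (aeval q g) = aeval q⁻¹ g := by
  rw [aeval_def, aeval_def, hom_eval₂, barK_q]
  congr 1
  exact RingHom.ext_int _ _

/-- A polynomial in `q` equal to a polynomial in `q⁻¹` is constant. Clearing denominators gives `X ^
deg g * f = reverse g`, whose right side has degree at most `deg g`. -/
theorem eq_C_of_aeval_eq_barK {f g : ℤ[X]} (h : aeval q f = barK (aeval q g)) :
    f = C (f.coeff 0) := by
  by_cases hf : f = 0
  · simp [hf]
  have hq := q_ne_zero
  have h1 : aeval q (reverse g) = q ^ g.natDegree * aeval q⁻¹ g := by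
    let : Invertible (q⁻¹ : K) := invertibleOfNonzero (inv_ne_zero hq)
    have h2 := eval₂_reverse_mul_pow (algebraMap ℤ K) (q⁻¹ : K) g
    rw [invOf_eq_inv, inv_inv] at h2
    rw [aeval_def, aeval_def, ← h2, mul_comm (eval₂ _ _ _), ← mul_assoc, ← mul_pow,
      mul_inv_cancel₀ hq, one_pow, one_mul]
  have h2 : X ^ g.natDegree * f = reverse g := by
    apply aeval_q_injective
    rw [h1, map_mul, h, barK_aeval, map_pow, aeval_X]
  have h3 := congrArg natDegree h2
  rw [natDegree_X_pow_mul g.natDegree hf] at h3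
  have h4 := reverse_natDegree_le g
  exact eq_C_of_natDegree_eq_zero (by omega)

theorem barK_barK (x : K) : barK (barK x) = x := by
  have h : barK.comp barK = RingHom.id K := by
    apply IsLocalization.ringHom_ext (nonZeroDivisors ℚ[X])
    apply Polynomial.ringHom_ext
    · intro a
      simp only [RingHom.comp_apply, RingHom.id_apply]
      have hc : ∀ c : ℚ, barK (algebraMap ℚ[X] K (C c)) = algebraMap ℚ[X] K (C c) := by
        intro c
        rw [← Polynomial.algebraMap_eq, ← IsScalarTower.algebraMap_apply]
        exact map_ratCast barK c
      rw [hc, hc]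
    · simp only [RingHom.comp_apply, RingHom.id_apply]
      have h : algebraMap ℚ[X] K X = q := RatFunc.algebraMap_X
      rw [h, barK_q, map_inv₀, barK_q, inv_inv]
  exact congrArg (fun f : K →+* K => f x) h

/-- The ideal `q ℤ[q]` of `ℤ[q]`, as an additive subgroup of `ℚ(q)`. -/
def qZq : AddSubgroup K where
  carrier := {c | ∃ p ∈ Zq, c = q * p}
  zero_mem' := ⟨0, zero_mem _, by simp⟩
  add_mem' := by
    rintro _ _ ⟨a, ha, rfl⟩ ⟨b, hb, rfl⟩
    exact ⟨a + b, add_mem ha hb, by ring⟩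
  neg_mem' := by
    rintro _ ⟨a, ha, rfl⟩
    exact ⟨-a, neg_mem ha, by ring⟩

theorem Zq_mul_mem_qZq {a c : K} (ha : a ∈ Zq) (hc : c ∈ qZq) : a * c ∈ qZq := by
  obtain ⟨p, hp, rfl⟩ := hc
  exact ⟨a * p, mul_mem ha hp, by ring⟩

theorem mem_Zq_of_mem_qZq {c : K} (hc : c ∈ qZq) : c ∈ Zq := by
  obtain ⟨p, hp, rfl⟩ := hc
  exact mul_mem q_mem_Zq hp

theorem mem_qZq_iff_aeval {c : K} : c ∈ qZq ↔ ∃ f : ℤ[X], aeval q (X * f) = c := by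
  constructor
  · rintro ⟨p, hp, rfl⟩
    obtain ⟨f, rfl⟩ := mem_Zq_iff.mp hp
    exact ⟨f, by simp⟩
  · rintro ⟨f, rfl⟩
    exact ⟨aeval q f, aeval_q_mem_Zq f, by simp⟩

theorem eq_zero_of_barK_eq {c : K} (hc : c ∈ qZq) (h : barK c = c) : c = 0 := by
  obtain ⟨f, rfl⟩ := mem_qZq_iff_aeval.mp hc
  have := eq_C_of_aeval_eq_barK h.symm
  rw [this]; simp

theorem eq_zero_of_barK_eq_neg {c : K} (hc : c ∈ qZq) (h : barK c = -c) : c = 0 := by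
  obtain ⟨f, rfl⟩ := mem_qZq_iff_aeval.mp hc
  have := eq_C_of_aeval_eq_barK (f := -(X * f)) (g := X * f) (by rw [h, map_neg])
  have h2 : X * f = 0 := by
    rw [← neg_eq_zero, this]; simp
  rw [h2]; simp

/-- The ring `ℤ[q, q⁻¹]`. -/
def Zqq : Subring K := Subring.closure {q, q⁻¹}

theorem q_mem_Zqq : q ∈ Zqq := Subring.subset_closure (by simp)

theorem q_inv_mem_Zqq : q⁻¹ ∈ Zqq := Subring.subset_closure (by simp)

theorem q_zpow_mem_Zqq (e : ℤ) : q ^ e ∈ Zqq := by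
  obtain ⟨n, rfl | rfl⟩ := e.eq_nat_or_neg
  · rw [zpow_natCast]; exact pow_mem q_mem_Zqq n
  · rw [zpow_neg, zpow_natCast, ← inv_pow]; exact pow_mem q_inv_mem_Zqq n

theorem Zq_le_Zqq : Zq ≤ Zqq := Subring.closure_mono (by simp)

theorem exists_zpow_mul_aeval {c : K} (hc : c ∈ Zqq) :
    ∃ (N : ℕ) (f : ℤ[X]), c = q⁻¹ ^ N * aeval q f := by
  have hq := q_ne_zero
  induction hc using Subring.closure_induction with
  | mem x hx =>
    rcases hx with rfl | rfl
    · exact ⟨0, X, by simp⟩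
    · exact ⟨1, 1, by simp⟩
  | zero => exact ⟨0, 0, by simp⟩
  | one => exact ⟨0, 1, by simp⟩
  | add x y _ _ hx hy =>
    obtain ⟨N, f, rfl⟩ := hx; obtain ⟨M, g, rfl⟩ := hy
    refine ⟨N + M, X ^ M * f + X ^ N * g, ?_⟩
    simp only [map_add, map_mul, map_pow, aeval_X, inv_pow, pow_add]
    field_simp
  | neg x _ hx => obtain ⟨N, f, rfl⟩ := hx; exact ⟨N, -f, by simp⟩
  | mul x y _ _ hx hy =>
    obtain ⟨N, f, rfl⟩ := hx; obtain ⟨M, g, rfl⟩ := hy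
    exact ⟨N + M, f * g, by rw [map_mul]; ring⟩

theorem exists_aeval_add_barK {c : K} (hc : c ∈ Zqq) :
    ∃ f g : ℤ[X], c = aeval q f + barK (aeval q g) := by
  have hq := q_ne_zero
  obtain ⟨N, f, rfl⟩ := exists_zpow_mul_aeval hc
  induction f using Polynomial.induction_on' with
  | add f g hf hg =>
    have aux : ∀ f : ℤ[X], q⁻¹ ^ N * aeval q f ∈ Zqq := fun f =>
      mul_mem (pow_mem q_inv_mem_Zqq _) (Zq_le_Zqq (aeval_q_mem_Zq f))
    obtain ⟨f1, g1, h1⟩ := hf (aux f)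
    obtain ⟨f2, g2, h2⟩ := hg (aux g)
    refine ⟨f1 + f2, g1 + g2, ?_⟩
    rw [map_add, mul_add, h1, h2]
    simp only [map_add]; ring
  | monomial n a =>
    rcases le_total N n with h | h
    · obtain ⟨k, rfl⟩ := Nat.exists_eq_add_of_le h
      refine ⟨Polynomial.monomial k a, 0, ?_⟩
      simp only [aeval_monomial, inv_pow, pow_add, map_zero, add_zero]
      field_simp
    · obtain ⟨k, rfl⟩ := Nat.exists_eq_add_of_le h
      refine ⟨0, Polynomial.monomial k a, ?_⟩
      rw [barK_aeval]
      simp only [aeval_monomial, inv_pow, pow_add, map_zero, zero_add]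
      field_simp

/-- A bar-antisymmetric Laurent polynomial is its positive part minus the bar of that part; `p` is
the positive part. -/
theorem exists_sub_barK {c : K} (hc : c ∈ Zqq) (h : barK c = -c) :
    ∃ p ∈ qZq, c = p - barK p := by
  obtain ⟨f, g, rfl⟩ := exists_aeval_add_barK hc
  rw [map_add, barK_barK] at h
  have h1 : aeval q (f + g) = barK (aeval q (-(f + g))) := by
    simp only [map_add, map_neg]
    linear_combination h
  have h2 := eq_C_of_aeval_eq_barK h1
  set a := (f + g).coeff 0
  rw [h2, ← C_neg] at h1
  simp only [aeval_C] at h1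
  -- Bar fixes integers, so antisymmetry of the constant term reads `a = -a`.
  have h3 : a = 0 := by
    have h4 : barK (algebraMap ℤ K (-a)) = algebraMap ℤ K (-a) := by
      simp
    rw [h4] at h1
    have h5 : a = -a := by
      simp only [eq_intCast] at h1
      exact_mod_cast h1
    omega
  have h4 : g = -f := by
    rw [h3, C_0] at h2
    linear_combination h2
  refine ⟨aeval q (X * f.divX), mem_qZq_iff_aeval.mpr ⟨_, rfl⟩, ?_⟩
  rw [h4]
  have h5 : aeval q f = aeval q (X * f.divX) + algebraMap ℤ K (f.coeff 0) := by
    conv_lhs => rw [← X_mul_divX_add f]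
    rw [map_add, aeval_C]
  rw [map_neg, map_neg, h5, map_add]
  simp [sub_eq_add_neg]

end

/-! ### The PBW monomials are linearly independent -/

instance : Algebra ℕ K := Semiring.toNatAlgebra

instance : Algebra ℤ K := Ring.toIntAlgebra K

/-- The position of `(i, j)` in the lexicographic order. -/
def code {n : ℕ} (i j : Fin n) : ℕ := n * i + j

theorem code_lt_of_fst_lt {n : ℕ} {i s : Fin n} (h : i < s) (j t : Fin n) :
    code i j < code s t := by
  have h1 : (i : ℕ) + 1 ≤ s := h
  have h2 := Nat.mul_le_mul_left n h1
  have h3 := j.isLt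
  unfold code
  rw [mul_add] at h2
  omega

theorem code_lt_of_snd_lt {n : ℕ} (s : Fin n) {j t : Fin n} (h : j < t) :
    code s j < code s t := by
  have h1 : (j : ℕ) < t := h
  unfold code
  omega

theorem code_lt_iff {n : ℕ} {i j s t : Fin n} :
    code i j < code s t ↔ i < s ∨ (i = s ∧ j < t) := by
  constructor
  · intro h
    rcases lt_trichotomy i s with h1 | rfl | h1
    · exact Or.inl h1
    · refine Or.inr ⟨rfl, ?_⟩
      rcases lt_trichotomy j t with h2 | rfl | h2
      · exact h2
      · exact absurd h (lt_irrefl _)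
      · exact absurd (code_lt_of_snd_lt i h2) (not_lt.mpr h.le)
    · exact absurd (code_lt_of_fst_lt h1 t j) (not_lt.mpr h.le)
  · rintro (h | ⟨rfl, h⟩)
    · exact code_lt_of_fst_lt h j t
    · exact code_lt_of_snd_lt i h

/-- The family `z` satisfies the relations of quantum matrices between entries whose position
in the lexicographic order is less than `p`. -/
structure SatBelow {n : ℕ} (p : ℕ) {B : Type*} [Semiring B] [Algebra K B] (z : Fin n → Fin n → B) :
    Prop where
  row (i j k : Fin n) (h : j < k) (h2 : code i k < p) :
    z i j * z i k = q ^ 2 • (z i k * z i j)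
  col (i k j : Fin n) (h : i < k) (h2 : code k j < p) :
    z i j * z k j = q ^ 2 • (z k j * z i j)
  anti (i j s t : Fin n) (h : s < i) (h' : j < t) (h2 : code i j < p) :
    z i j * z s t = z s t * z i j
  diag (i j s t : Fin n) (h : i < s) (h' : j < t) (h2 : code s t < p) :
    z i j * z s t = z s t * z i j + (q ^ 2 - (q⁻¹) ^ 2) • (z i t * z s j)

theorem mul_mul_of_eq {B : Type*} [Ring B] {a b c : B} (h : a * b = c) (x : B) :
    a * (b * x) = c * x := by
  rw [← mul_assoc, h]

/-! ### The skew derivation attached to one letter -/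

section Derivation

variable {n : ℕ} {p : ℕ} {B : Type*} [Ring B] [Algebra K B] (z : Fin n → Fin n → B) (s t : Fin n)

/-- The eigenvalue of the diagonal automorphism attached to `(s, t)` on `Z_{ij}`. -/
def twistCoeff (i j : Fin n) : K :=
  (if i = s then (q⁻¹) ^ 2 else 1) * (if j = t then (q⁻¹) ^ 2 else 1)

/-- The values on generators of the skew derivation attached to `(s, t)`. -/
def skewDer (i j : Fin n) : B :=
  if i < s ∧ j < t then -((q ^ 2 - (q⁻¹) ^ 2) • (z i t * z s j)) else 0

variable {z s t}

/-- Together with the three companions for the other relations, this says that the values on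
generators extend to a skew derivation `d(xy) = σ(x) d(y) + d(x) y`: the rule gives the same result
on both sides of each relation. The letters produced by `d` precede `(s, t)`, so the relations below
`p` suffice for rewriting. -/
theorem skewDer_row (hz : SatBelow p z) (hp : code s t = p) (i j k : Fin n) (h : j < k)
    (h2 : code i k < p) :
    (twistCoeff s t i j • z i j) * skewDer z s t i k + skewDer z s t i j * z i k =
      q ^ 2 • ((twistCoeff s t i k • z i k) * skewDer z s t i j + skewDer z s t i k * z i j) := by
  have hq := q_ne_zero
  subst hp
  unfold skewDer twistCoeff
  rcases lt_or_ge i s with hi | hi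
  swap
  · simp [not_lt.mpr hi]
  have hit : ∀ j, code i j < code s t := fun j => code_lt_of_fst_lt hi j t
  rcases lt_trichotomy k t with hk | rfl | hk
  · have hj : j < t := h.trans hk
    have r1 := hz.row i j t hj (hit t)
    have r2 := hz.row i k t hk (hit t)
    have r3 := hz.anti s j i k hi h (code_lt_of_snd_lt s hj)
    have r4 := hz.diag i j s k hi h (code_lt_of_snd_lt s hk)
    simp only [hi, hk, hj, hi.ne, hj.ne, hk.ne, and_self, and_false, false_and, if_true, if_false,
      lt_irrefl, mul_one, one_smul, one_mul, mul_zero, zero_mul, zero_add, add_zero, smul_zero,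
      neg_zero, mul_neg, neg_mul, mul_smul_comm, smul_mul_assoc, mul_assoc, smul_neg,
      r1, r2, r3, r4,
      mul_mul_of_eq r1, mul_mul_of_eq r2, mul_mul_of_eq r3, mul_mul_of_eq r4,
      mul_add, add_mul, smul_add]
    match_scalars <;> field_simp
    ring
  · have r1 := hz.anti s j i k hi h (code_lt_of_snd_lt s h)
    simp only [hi, h, hi.ne, h.ne, and_self, and_false, false_and, if_true, if_false,
      lt_irrefl, mul_one, one_smul, one_mul, mul_zero, zero_mul, zero_add, add_zero, smul_zero,
      neg_zero, mul_neg, neg_mul, mul_smul_comm, smul_mul_assoc, mul_assoc, smul_neg,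
      r1,
      mul_mul_of_eq r1,
      mul_add, add_mul, smul_add]
    match_scalars; field_simp
  · rcases lt_trichotomy j t with hj | rfl | hj
    · have r1 := hz.anti s j i k hi h (code_lt_of_snd_lt s hj)
      have r2 := hz.row i t k hk (hit _)
      simp only [hi, hj, hi.ne, hj.ne, hk.ne', hk.not_gt, and_self, and_false, false_and, if_true, if_false,
        lt_irrefl, mul_one, one_smul, one_mul, mul_zero, zero_mul, zero_add, add_zero, smul_zero,
        neg_zero, mul_neg, neg_mul, mul_smul_comm, smul_mul_assoc, mul_assoc, smul_neg,
        r1, r2,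
        mul_mul_of_eq r1, mul_mul_of_eq r2,
        mul_add, add_mul, smul_add]
      match_scalars; field_simp
    · simp [hk.not_gt]
    · simp [hk.not_gt, hj.not_gt]

theorem skewDer_col (hz : SatBelow p z) (hp : code s t = p) (i k j : Fin n) (h : i < k)
    (h2 : code k j < p) :
    (twistCoeff s t i j • z i j) * skewDer z s t k j + skewDer z s t i j * z k j =
      q ^ 2 • ((twistCoeff s t k j • z k j) * skewDer z s t i j + skewDer z s t k j * z i j) := by
  have hq := q_ne_zero
  subst hp
  unfold skewDer twistCoeff
  rcases lt_or_ge j t with hj | hj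
  swap
  · simp [not_lt.mpr hj]
  rcases code_lt_iff.mp h2 with hk | ⟨rfl, -⟩
  · have hi : i < s := h.trans hk
    have hs := code_lt_of_snd_lt s hj
    have r1 := hz.col i s j hi hs
    have r2 := hz.col k s j hk hs
    have r3 := hz.anti k j i t h hj (code_lt_of_fst_lt hk _ _)
    have r4 := hz.diag i j k t h hj (code_lt_of_fst_lt hk _ _)
    simp only [hi, hk, hj, hi.ne, hj.ne, hk.ne, and_self, and_false, false_and, if_true, if_false,
      lt_irrefl, mul_one, one_smul, one_mul, mul_zero, zero_mul, zero_add, add_zero, smul_zero,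
      neg_zero, mul_neg, neg_mul, mul_smul_comm, smul_mul_assoc, mul_assoc, smul_neg,
      r1, r2, r3, r4,
      mul_mul_of_eq r1, mul_mul_of_eq r2, mul_mul_of_eq r3, mul_mul_of_eq r4,
      mul_add, add_mul, smul_add]
    match_scalars <;> field_simp
    ring
  · have r1 := hz.anti k j i t h hj h2
    simp only [h, hj, h.ne, hj.ne, and_self, and_false, false_and, if_true, if_false,
      lt_irrefl, mul_one, one_smul, one_mul, mul_zero, zero_mul, zero_add, add_zero, smul_zero,
      neg_zero, mul_neg, neg_mul, mul_smul_comm, smul_mul_assoc, mul_assoc, smul_neg,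
      r1,
      mul_mul_of_eq r1,
      mul_add, add_mul, smul_add]
    match_scalars; field_simp

theorem skewDer_anti (hz : SatBelow p z) (hp : code s t = p) (a b c d : Fin n) (h : c < a)
    (h' : b < d) (h2 : code a b < p) :
    (twistCoeff s t a b • z a b) * skewDer z s t c d + skewDer z s t a b * z c d =
      (twistCoeff s t c d • z c d) * skewDer z s t a b + skewDer z s t c d * z a b := by
  have hq := q_ne_zero
  subst hp
  unfold skewDer twistCoeff
  rcases lt_or_ge b t with hb | hb
  swap
  · simp [not_lt.mpr hb, not_lt.mpr (hb.trans h'.le)]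
  have hs := code_lt_of_snd_lt s hb
  rcases code_lt_iff.mp h2 with ha | ⟨rfl, -⟩
  · have hc : c < s := h.trans ha
    have hat : ∀ j, code a j < code s t := fun j => code_lt_of_fst_lt ha j t
    rcases lt_trichotomy d t with hd | rfl | hd
    · have r1 := hz.anti a b c t h hb (hat _)
      have r2 := hz.diag a b s d ha h' (code_lt_of_snd_lt s hd)
      have r3 := hz.anti s b c d hc h' hs
      have r4 := hz.diag c d a t h hd (hat _)
      simp only [ha, hb, hc, hd, ha.ne, hb.ne, hc.ne, hd.ne, and_self, and_false, false_and, if_true, if_false,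
        lt_irrefl, mul_one, one_smul, one_mul, mul_zero, zero_mul, zero_add, add_zero, smul_zero,
        neg_zero, mul_neg, neg_mul, mul_smul_comm, smul_mul_assoc, mul_assoc, smul_neg,
        r1, r2, r3, r4,
        mul_mul_of_eq r1, mul_mul_of_eq r2, mul_mul_of_eq r3, mul_mul_of_eq r4,
        mul_add, add_mul, smul_add]
      match_scalars <;> field_simp
    · have r1 := hz.anti s b c d hc hb hs
      have r2 := hz.col c a d h (hat _)
      simp only [ha, hb, hc, ha.ne, hb.ne, hc.ne, and_self, and_false, false_and, if_true, if_false,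
        lt_irrefl, mul_one, one_smul, one_mul, mul_zero, zero_mul, zero_add, add_zero, smul_zero,
        neg_zero, mul_neg, neg_mul, mul_smul_comm, smul_mul_assoc, mul_assoc, smul_neg,
        r1, r2,
        mul_mul_of_eq r1, mul_mul_of_eq r2,
        mul_add, add_mul, smul_add]
      match_scalars; field_simp
    · have r1 := hz.anti s b c d hc h' hs
      have r2 := (hz.anti a t c d h hd (hat _)).symm
      simp only [ha, hb, hc, hd.not_gt, hd.ne', ha.ne, hb.ne, hc.ne, and_self, and_false, false_and, if_true, if_false,
        lt_irrefl, mul_one, one_smul, one_mul, mul_zero, zero_mul, zero_add, add_zero, smul_zero,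
        neg_zero, mul_neg, neg_mul, mul_smul_comm, smul_mul_assoc, mul_assoc, smul_neg,
        r1, r2,
        mul_mul_of_eq r1, mul_mul_of_eq r2,
        mul_add, add_mul, smul_add]
  · rcases lt_or_ge d t with hd | hd
    · have r1 := hz.anti a b c t h hb h2
      have r2 := hz.row a b d h' (code_lt_of_snd_lt a hd)
      simp only [h, hb, hd, h.ne, hb.ne, hd.ne, and_self, and_false, false_and, if_true, if_false,
        lt_irrefl, mul_one, one_smul, one_mul, mul_zero, zero_mul, zero_add, add_zero, smul_zero,
        neg_zero, mul_neg, neg_mul, mul_smul_comm, smul_mul_assoc, mul_assoc, smul_neg,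
        r1, r2,
        mul_mul_of_eq r1, mul_mul_of_eq r2,
        mul_add, add_mul, smul_add]
      match_scalars; field_simp
    · simp [not_lt.mpr hd]

theorem skewDer_diag (hz : SatBelow p z) (hp : code s t = p) (a b c d : Fin n) (h : a < c)
    (h' : b < d) (h2 : code c d < p) :
    (twistCoeff s t a b • z a b) * skewDer z s t c d + skewDer z s t a b * z c d =
      (twistCoeff s t c d • z c d) * skewDer z s t a b + skewDer z s t c d * z a b +
        (q ^ 2 - (q⁻¹) ^ 2) • ((twistCoeff s t a d • z a d) * skewDer z s t c b +
          skewDer z s t a d * z c b) := by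
  have hq := q_ne_zero
  subst hp
  unfold skewDer twistCoeff
  rcases lt_or_ge b t with hb | hb
  swap
  · simp [not_lt.mpr hb, not_lt.mpr (hb.trans h'.le)]
  have hs := code_lt_of_snd_lt s hb
  rcases code_lt_iff.mp h2 with hc | ⟨rfl, hd⟩
  · have ha : a < s := h.trans hc
    have hct : ∀ j, code c j < code s t := fun j => code_lt_of_fst_lt hc j t
    rcases lt_trichotomy d t with hd | rfl | hd
    · have hsd := code_lt_of_snd_lt s hd
      have r1 := hz.diag a b c t h hb (hct _)
      have r2 := hz.diag a b s d ha h' hsd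
      have r3 := hz.anti s b c d hc h' hs
      have r4 := hz.anti c d a t h hd (hct _)
      have r5 := hz.diag c b s d hc h' hsd
      have r6 := hz.diag a d c t h hd (hct _)
      simp only [ha, hb, hc, hd, ha.ne, hb.ne, hc.ne, hd.ne, and_self, and_false, false_and, if_true, if_false,
        lt_irrefl, mul_one, one_smul, one_mul, mul_zero, zero_mul, zero_add, add_zero, smul_zero,
        neg_zero, mul_neg, neg_mul, mul_smul_comm, smul_mul_assoc, mul_assoc, smul_neg,
        r1, r2, r3, r4, r5, r6,
        mul_mul_of_eq r1, mul_mul_of_eq r2, mul_mul_of_eq r3, mul_mul_of_eq r4, mul_mul_of_eq r5, mul_mul_of_eq r6,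
        mul_add, add_mul, smul_add]
      match_scalars <;> field_simp
      ring
    · have r1 := hz.anti s b c d hc hb hs
      have r2 := hz.col a c d h (hct _)
      simp only [ha, hb, hc, ha.ne, hb.ne, hc.ne, and_self, and_false, false_and, if_true, if_false,
        lt_irrefl, mul_one, one_smul, one_mul, mul_zero, zero_mul, zero_add, add_zero, smul_zero,
        neg_zero, mul_neg, neg_mul, mul_smul_comm, smul_mul_assoc, mul_assoc, smul_neg,
        r1, r2,
        mul_mul_of_eq r1, mul_mul_of_eq r2,
        mul_add, add_mul, smul_add]
      match_scalars; field_simp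
      ring
    · have r1 := hz.anti s b c d hc h' hs
      have r2 := hz.diag a t c d h hd (hct _)
      simp only [ha, hb, hc, hd.not_gt, hd.ne', ha.ne, hb.ne, hc.ne, and_self, and_false, false_and, if_true, if_false,
        lt_irrefl, mul_one, one_smul, one_mul, mul_zero, zero_mul, zero_add, add_zero, smul_zero,
        neg_zero, mul_neg, neg_mul, mul_smul_comm, smul_mul_assoc, mul_assoc, smul_neg,
        r1, r2,
        mul_mul_of_eq r1, mul_mul_of_eq r2,
        mul_add, add_mul, smul_add]
      match_scalars <;> field_simp
  · have r1 := hz.anti c d a t h hd (code_lt_of_snd_lt c hd)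
    have r2 := hz.row c b d h' (code_lt_of_snd_lt c hd)
    simp only [h, hb, hd, h.ne, hb.ne, hd.ne, and_self, and_false, false_and, if_true, if_false,
      lt_irrefl, mul_one, one_smul, one_mul, mul_zero, zero_mul, zero_add, add_zero, smul_zero,
      neg_zero, mul_neg, neg_mul, mul_smul_comm, smul_mul_assoc, mul_assoc, smul_neg,
      r1, r2,
      mul_mul_of_eq r1, mul_mul_of_eq r2,
      mul_add, add_mul, smul_add]
    match_scalars; field_simp
    ring

end Derivation

/-- The relations of quantum matrices between generators whose position is less than `p`. -/
inductive RelBelow (n p : ℕ) :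
    FreeAlgebra K (Fin n × Fin n) → FreeAlgebra K (Fin n × Fin n) → Prop
  | row (i j k : Fin n) (h : j < k) (h2 : code i k < p) :
      RelBelow n p (gen i j * gen i k) (q ^ 2 • (gen i k * gen i j))
  | col (i k j : Fin n) (h : i < k) (h2 : code k j < p) :
      RelBelow n p (gen i j * gen k j) (q ^ 2 • (gen k j * gen i j))
  | anti (i j s t : Fin n) (h : s < i) (h' : j < t) (h2 : code i j < p) :
      RelBelow n p (gen i j * gen s t) (gen s t * gen i j)
  | diag (i j s t : Fin n) (h : i < s) (h' : j < t) (h2 : code s t < p) :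
      RelBelow n p (gen i j * gen s t)
        (gen s t * gen i j + (q ^ 2 - (q⁻¹) ^ 2) • (gen i t * gen s j))

/-- The algebra on the letters `Z_{ij}` in which only the relations between the first `p` letters
are imposed. -/
abbrev OBelow (n p : ℕ) : Type := RingQuot (RelBelow n p)

/-! ### Ore extension by one letter -/

namespace OBelow

/-- The generators of `OBelow n p`. -/
def z (n p : ℕ) (i j : Fin n) : OBelow n p := RingQuot.mkAlgHom K (RelBelow n p) (gen i j)

theorem satBelow (n p : ℕ) : SatBelow p (z n p) where
  row i j k h h2 := by simpa [z] using RingQuot.mkAlgHom_rel K (RelBelow.row i j k h h2)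
  col i k j h h2 := by simpa [z] using RingQuot.mkAlgHom_rel K (RelBelow.col i k j h h2)
  anti i j s t h h' h2 := by
    simpa [z] using RingQuot.mkAlgHom_rel K (RelBelow.anti i j s t h h' h2)
  diag i j s t h h' h2 := by
    have := RingQuot.mkAlgHom_rel K (RelBelow.diag i j s t h h' h2)
    simpa only [z, map_mul, map_add, map_smul] using this

variable {n p : ℕ} {B : Type} [Semiring B] [Algebra K B]

/-- The universal property of `OBelow n p`. -/
def lift {w : Fin n → Fin n → B} (hw : SatBelow p w) : OBelow n p →ₐ[K] B :=
  RingQuot.liftAlgHom K ⟨FreeAlgebra.lift K fun u => w u.1 u.2, by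
    intro x y h
    cases h with
    | row i j k h h2 => simpa using hw.row i j k h h2
    | col i k j h h2 => simpa using hw.col i k j h h2
    | anti i j s t h h' h2 => simpa using hw.anti i j s t h h' h2
    | diag i j s t h h' h2 =>
      simpa only [map_mul, map_add, map_smul, FreeAlgebra.lift_ι_apply] using
        hw.diag i j s t h h' h2⟩

theorem lift_z {w : Fin n → Fin n → B} (hw : SatBelow p w) (i j : Fin n) :
    lift hw (z n p i j) = w i j := by
  unfold lift z
  rw [RingQuot.liftAlgHom_mkAlgHom_apply, FreeAlgebra.lift_ι_apply]

theorem induction {C : OBelow n p → Prop} (h0 : ∀ r, C (algebraMap K _ r))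
    (h1 : ∀ i j, C (z n p i j)) (hm : ∀ a b, C a → C b → C (a * b))
    (ha : ∀ a b, C a → C b → C (a + b)) (x : OBelow n p) : C x := by
  obtain ⟨x, rfl⟩ := RingQuot.mkAlgHom_surjective K (RelBelow n p) x
  induction x using FreeAlgebra.induction with
  | grade0 r => rw [AlgHom.commutes]; exact h0 r
  | grade1 u => exact h1 u.1 u.2
  | mul a b h h' => rw [map_mul]; exact hm _ _ h h'
  | add a b h h' => rw [map_add]; exact ha _ _ h h'

/-- A pair of an endomorphism `σ` and a `σ`-derivation `d` is the same as an algebra homomorphism to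
upper triangular matrices with rows `(σ, d)` and `(0, id)`. Checking the relations for these
matrices gives both maps on the quotient at once. -/
theorem satBelow_triangular {s t : Fin n} (hp : code s t = p) :
    SatBelow p fun i j => (!![twistCoeff s t i j • z n p i j, skewDer (z n p) s t i j; 0, z n p i j] :
      Matrix (Fin 2) (Fin 2) (OBelow n p)) where
  row i j k h h2 := by
    have h3 := skewDer_row (satBelow n p) hp i j k h h2
    have h4 := (satBelow n p).row i j k h h2
    ext a b
    fin_cases a <;> fin_cases b
    · simp [Matrix.mul_apply, smul_smul, h4]
      congr 1
      ring
    · simpa [Matrix.mul_apply] using h3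
    · simp [Matrix.mul_apply]
    · simpa [Matrix.mul_apply] using h4
  col i k j h h2 := by
    have h3 := skewDer_col (satBelow n p) hp i k j h h2
    have h4 := (satBelow n p).col i k j h h2
    ext a b
    fin_cases a <;> fin_cases b
    · simp [Matrix.mul_apply, smul_smul, h4]
      congr 1
      ring
    · simpa [Matrix.mul_apply] using h3
    · simp [Matrix.mul_apply]
    · simpa [Matrix.mul_apply] using h4
  anti i j k l h h' h2 := by
    have h3 := skewDer_anti (satBelow n p) hp i j k l h h' h2
    have h4 := (satBelow n p).anti i j k l h h' h2
    ext a b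
    fin_cases a <;> fin_cases b
    · simp [Matrix.mul_apply, smul_smul, h4]
      congr 1
      ring
    · simpa [Matrix.mul_apply] using h3
    · simp [Matrix.mul_apply]
    · simpa [Matrix.mul_apply] using h4
  diag i j k l h h' h2 := by
    have h3 := skewDer_diag (satBelow n p) hp i j k l h h' h2
    have h4 := (satBelow n p).diag i j k l h h' h2
    ext a b
    fin_cases a <;> fin_cases b
    · have h5 : twistCoeff s t i j * twistCoeff s t k l =
          twistCoeff s t i l * twistCoeff s t k j := by
        unfold twistCoeff; ring
      simp only [Matrix.mul_apply, Fin.sum_univ_two, Matrix.add_apply, Matrix.smul_apply]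
      simp [smul_smul, h4, ← h5, mul_comm]
      rw [mul_assoc]
    · simpa [Matrix.mul_apply] using h3
    · simp [Matrix.mul_apply]
    · simpa [Matrix.mul_apply] using h4

/-- The algebra homomorphism `b ↦ (σ(b), d(b); 0, b)`. -/
def triangular {s t : Fin n} (hp : code s t = p) :
    OBelow n p →ₐ[K] Matrix (Fin 2) (Fin 2) (OBelow n p) := lift (satBelow_triangular hp)

theorem triangular_apply {s t : Fin n} (hp : code s t = p) (x : OBelow n p) :
    triangular hp x 1 0 = 0 ∧ triangular hp x 1 1 = x := by
  induction x using induction with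
  | h0 r => simp [Matrix.algebraMap_matrix_apply]
  | h1 i j => simp [triangular, lift_z]
  | hm a b ha hb => simp [Matrix.mul_apply, ha, hb]
  | ha a b ha hb => simp [ha, hb]

/-- The automorphism `σ` attached to the letter at position `p`. -/
def sigma {s t : Fin n} (hp : code s t = p) : OBelow n p →ₗ[K] OBelow n p :=
  (Matrix.entryLinearMap K (OBelow n p) 0 0) ∘ₗ (triangular hp).toLinearMap

/-- The `σ`-derivation `d` attached to the letter at position `p`. -/
def der {s t : Fin n} (hp : code s t = p) : OBelow n p →ₗ[K] OBelow n p :=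
  (Matrix.entryLinearMap K (OBelow n p) 0 1) ∘ₗ (triangular hp).toLinearMap

section
variable {s t : Fin n} (hp : code s t = p)

theorem sigma_mul (x y : OBelow n p) : sigma hp (x * y) = sigma hp x * sigma hp y := by
  simp [sigma, Matrix.mul_apply, triangular_apply]

theorem der_mul (x y : OBelow n p) :
    der hp (x * y) = sigma hp x * der hp y + der hp x * y := by
  simp [sigma, der, Matrix.mul_apply, triangular_apply]

theorem sigma_one : sigma hp 1 = 1 := by
  simp [sigma]

theorem der_one : der hp 1 = 0 := by
  simp [der]

theorem sigma_z (i j : Fin n) : sigma hp (z n p i j) = twistCoeff s t i j • z n p i j := by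
  simp [sigma, triangular, lift_z]

theorem der_z (i j : Fin n) : der hp (z n p i j) = skewDer (z n p) s t i j := by
  simp [der, triangular, lift_z]

/-- Left multiplication by the letter at position `p` on polynomials in this letter. -/
def mulLetter : (ℕ →₀ OBelow n p) →ₗ[K] (ℕ →₀ OBelow n p) :=
  Finsupp.lmapDomain (OBelow n p) K Nat.succ ∘ₗ Finsupp.mapRange.linearMap (sigma hp) +
    Finsupp.mapRange.linearMap (der hp)

theorem mulLetter_single (k : ℕ) (c : OBelow n p) :
    mulLetter hp (Finsupp.single k c) =
      Finsupp.single (k + 1) (sigma hp c) + Finsupp.single k (der hp c) := by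
  simp [mulLetter, Finsupp.mapDomain_single]

/-- Left multiplication by `b` on polynomials. -/
def mulCoeff : OBelow n p →ₐ[K] Module.End K (ℕ →₀ OBelow n p) :=
  Algebra.lsmul K K (ℕ →₀ OBelow n p)

theorem mulCoeff_single (b : OBelow n p) (k : ℕ) (c : OBelow n p) :
    mulCoeff b (Finsupp.single k c) = Finsupp.single k (b * c) := by
  simp [mulCoeff]

theorem mulLetter_mul_mulCoeff (b : OBelow n p) :
    (mulLetter hp * mulCoeff b : Module.End K (ℕ →₀ OBelow n p)) =
      mulCoeff (sigma hp b) * mulLetter hp + mulCoeff (der hp b) := by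
  apply Finsupp.lhom_ext
  intro k c
  simp only [Module.End.mul_apply, LinearMap.add_apply, mulCoeff_single, mulLetter_single,
    sigma_mul, der_mul, map_add, Finsupp.single_add]
  abel

end

end OBelow

theorem code_inj {n : ℕ} {i j s t : Fin n} (h : code i j = code s t) : i = s ∧ j = t := by
  rcases lt_trichotomy i s with h1 | rfl | h1
  · exact absurd h (code_lt_of_fst_lt h1 j t).ne
  · rcases lt_trichotomy j t with h2 | rfl | h2
    · exact absurd h (code_lt_of_snd_lt i h2).ne
    · exact ⟨rfl, rfl⟩
    · exact absurd h (code_lt_of_snd_lt i h2).ne'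
  · exact absurd h (code_lt_of_fst_lt h1 t j).ne'

namespace OBelow

variable {n p : ℕ} {s t : Fin n} (hp : code s t = p)

/-- The operators by which the letters act on polynomials in the letter at position `p`. -/
def letterOp (i j : Fin n) : Module.End K (ℕ →₀ OBelow n p) :=
  if code i j = p then mulLetter hp else mulCoeff (z n p i j)

theorem letterOp_self : letterOp hp s t = mulLetter hp := if_pos hp

theorem letterOp_of_ne {i j : Fin n} (h : code i j ≠ p) :
    letterOp hp i j = mulCoeff (z n p i j) := if_neg h

/-- A relation between letters below `p` already holds for the coefficients. A relation involving
the letter `x` at position `p` is the Ore rule `x b = σ(b) x + d(b)`, with the values of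
`twistCoeff` and `skewDer` chosen for this purpose. -/
theorem satBelow_letterOp : SatBelow (p + 1) (letterOp hp) where
  row i j k h h2 := by
    have hj := code_lt_of_snd_lt i h
    rcases (Nat.lt_succ_iff_lt_or_eq.mp h2) with h3 | h3
    · rw [letterOp_of_ne hp h3.ne, letterOp_of_ne hp (hj.trans h3).ne, ← map_mul, ← map_mul,
        ← map_smul, (satBelow n p).row i j k h h3]
    · obtain ⟨rfl, rfl⟩ := code_inj (h3.trans hp.symm)
      rw [letterOp_self, letterOp_of_ne hp (by omega), mulLetter_mul_mulCoeff, sigma_z, der_z]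
      have hq := q_ne_zero
      simp [twistCoeff, skewDer, h.ne, smul_smul, hq]
  col i k j h h2 := by
    have hj := code_lt_of_fst_lt h j j
    rcases (Nat.lt_succ_iff_lt_or_eq.mp h2) with h3 | h3
    · rw [letterOp_of_ne hp h3.ne, letterOp_of_ne hp (hj.trans h3).ne, ← map_mul, ← map_mul,
        ← map_smul, (satBelow n p).col i k j h h3]
    · obtain ⟨rfl, rfl⟩ := code_inj (h3.trans hp.symm)
      rw [letterOp_self, letterOp_of_ne hp (by omega), mulLetter_mul_mulCoeff, sigma_z, der_z]
      have hq := q_ne_zero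
      simp [twistCoeff, skewDer, h.ne, smul_smul, hq]
  anti i j k l h h' h2 := by
    have hj := code_lt_of_fst_lt h l j
    rcases (Nat.lt_succ_iff_lt_or_eq.mp h2) with h3 | h3
    · rw [letterOp_of_ne hp h3.ne, letterOp_of_ne hp (hj.trans h3).ne, ← map_mul, ← map_mul,
        (satBelow n p).anti i j k l h h' h3]
    · obtain ⟨rfl, rfl⟩ := code_inj (h3.trans hp.symm)
      rw [letterOp_self, letterOp_of_ne hp (i := k) (by omega), mulLetter_mul_mulCoeff, sigma_z,
        der_z]
      simp [twistCoeff, skewDer, h.ne, h'.ne', h'.not_gt]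
  diag i j k l h h' h2 := by
    have hj := code_lt_of_fst_lt h j l
    have hl := code_lt_of_fst_lt h l l
    have hm := code_lt_of_snd_lt k h'
    rcases (Nat.lt_succ_iff_lt_or_eq.mp h2) with h3 | h3
    · rw [letterOp_of_ne hp h3.ne, letterOp_of_ne hp (hj.trans h3).ne,
        letterOp_of_ne hp (hl.trans h3).ne, letterOp_of_ne hp (hm.trans h3).ne, ← map_mul,
        ← map_mul, ← map_mul, ← map_smul, ← map_add, (satBelow n p).diag i j k l h h' h3]
    · obtain ⟨rfl, rfl⟩ := code_inj (h3.trans hp.symm)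
      rw [letterOp_self, letterOp_of_ne hp (i := i) (j := j) (by omega),
        letterOp_of_ne hp (i := i) (j := l) (by omega),
        letterOp_of_ne hp (i := k) (j := j) (by omega), mulLetter_mul_mulCoeff, sigma_z, der_z]
      simp only [twistCoeff, skewDer, h.ne, h'.ne, h, h', and_self, if_true, if_false, mul_one,
        one_smul]
      rw [← map_mul, ← map_smul, add_assoc, ← map_add, neg_add_cancel, map_zero, add_zero]

/-- The action of `OBelow n (p + 1)` on polynomials over `OBelow n p`. -/
def polyRep : OBelow n (p + 1) →ₐ[K] Module.End K (ℕ →₀ OBelow n p) :=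
  lift (satBelow_letterOp hp)

theorem mulLetter_pow_single (k : ℕ) :
    (mulLetter hp ^ k) (Finsupp.single 0 1) = Finsupp.single k 1 := by
  induction k with
  | zero => simp
  | succ k ih =>
    rw [pow_succ', Module.End.mul_apply, ih, mulLetter_single, sigma_one, der_one]
    simp

end OBelow

/-! ### Independence of ordered monomials, one letter at a time -/

/-- The ordered monomials in the first `p` members of a sequence. -/
def seqMonomial {B : Type*} [Monoid B] (y : ℕ → B) : (p : ℕ) → (Fin p → ℕ) → B
  | 0, _ => 1
  | p + 1, a => seqMonomial y p (Fin.init a) * y p ^ a (Fin.last p)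

theorem seqMonomial_eq_prod {B : Type*} [Monoid B] (y : ℕ → B) (p : ℕ) (a : Fin p → ℕ) :
    seqMonomial y p a = (List.ofFn fun c : Fin p => y c ^ a c).prod := by
  induction p with
  | zero => rfl
  | succ p ih =>
    rw [seqMonomial, ih, List.ofFn_succ', List.concat_eq_append, List.prod_append]
    simp [Fin.init]

theorem map_seqMonomial {B C : Type*} [Monoid B] [Monoid C] {F : Type*}
    [FunLike F B C] [MonoidHomClass F B C] (f : F) (y : ℕ → B) (p : ℕ)
    (a : Fin p → ℕ) : f (seqMonomial y p a) = seqMonomial (f ∘ y) p a := by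
  induction p with
  | zero => simp [seqMonomial]
  | succ p ih => simp [seqMonomial, ih]

theorem seqMonomial_congr {B : Type*} [Monoid B] {y y' : ℕ → B} (p : ℕ)
    (h : ∀ c < p, y c = y' c) (a : Fin p → ℕ) : seqMonomial y p a = seqMonomial y' p a := by
  induction p with
  | zero => rfl
  | succ p ih =>
    rw [seqMonomial, seqMonomial, ih fun c hc => h c (hc.trans p.lt_succ_self), h p p.lt_succ_self]

/-- A family indexed by positions, listed in the lexicographic order. -/
def listed {n : ℕ} {B : Type*} [Zero B] (w : Fin n → Fin n → B) (c : ℕ) : B :=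
  if h : c < n * n then w (Fin.divNat ⟨c, h⟩) (Fin.modNat ⟨c, h⟩) else 0

theorem code_divNat_modNat {n c : ℕ} (h : c < n * n) :
    code (Fin.divNat ⟨c, h⟩ : Fin n) (Fin.modNat ⟨c, h⟩ : Fin n) = c := by
  simp [code, Fin.divNat, Fin.modNat, Nat.div_add_mod]

/-- Applied to the constant polynomial 1, an ordered monomial in `p + 1` letters acts as its initial
part times the corresponding power of the new variable. Independence over the coefficients in each
degree lifts back along this evaluation. -/
theorem linearIndependent_seqMonomial {n p : ℕ} (hpn : p ≤ n * n) :
    LinearIndependent K (seqMonomial (listed (OBelow.z n p)) p) := by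
  induction p with
  | zero =>
    -- Only the empty monomial occurs, and 1 is nonzero because sending all letters to 0 gives a map
    -- onto `K`.
    have : Nontrivial (OBelow n 0) := by
      let f : OBelow n 0 →ₐ[K] K := OBelow.lift (w := fun _ _ => (0 : K))
        ⟨by simp, by simp, by simp, by simp⟩
      exact f.toRingHom.domain_nontrivial
    exact LinearIndependent.of_subsingleton (i := Fin.elim0) one_ne_zero
  | succ p ih =>
    have hp := code_divNat_modNat (n := n) (c := p) hpn
    set s : Fin n := Fin.divNat ⟨p, hpn⟩ with hs
    set t : Fin n := Fin.modNat ⟨p, hpn⟩ with ht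
    let ev : OBelow n (p + 1) →ₗ[K] (ℕ →₀ OBelow n p) :=
      LinearMap.applyₗ (Finsupp.single 0 1) ∘ₗ (OBelow.polyRep hp).toLinearMap
    apply LinearIndependent.of_comp ev
    have h1 := Finsupp.linearIndependent_single
      (f := fun _ : ℕ => seqMonomial (listed (OBelow.z n p)) p) fun _ => ih (by omega)
    have h2 : Function.Injective
        fun a : Fin (p + 1) → ℕ => (⟨a (Fin.last p), Fin.init a⟩ : Σ _ : ℕ, Fin p → ℕ) := by
      intro a b hab
      simp only [Sigma.mk.injEq, heq_eq_eq] at hab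
      rw [← Fin.snoc_init_self a, ← Fin.snoc_init_self b, hab.1, hab.2]
    convert h1.comp _ h2 using 1
    ext1 a
    have h3 : OBelow.polyRep hp (seqMonomial (listed (OBelow.z n (p + 1))) p (Fin.init a)) =
        OBelow.mulCoeff (seqMonomial (listed (OBelow.z n p)) p (Fin.init a)) := by
      have e1 := map_seqMonomial (OBelow.polyRep hp)
        (listed (OBelow.z n (p + 1))) p (Fin.init a)
      have e2 := map_seqMonomial
        (OBelow.mulCoeff : OBelow n p →ₐ[K] Module.End K (ℕ →₀ OBelow n p))
        (listed (OBelow.z n p)) p (Fin.init a)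
      refine e1.trans (Eq.trans ?_ e2.symm)
      apply seqMonomial_congr
      intro c hc
      have hcn : c < n * n := by omega
      simp only [Function.comp_apply, listed, dif_pos hcn]
      refine (OBelow.lift_z _ _ _).trans ?_
      rw [OBelow.letterOp_of_ne]
      rw [code_divNat_modNat]; omega
    have h4 : OBelow.polyRep hp (listed (OBelow.z n (p + 1)) p) = OBelow.mulLetter hp := by
      have hcn : p < n * n := by omega
      simp only [listed, dif_pos hcn]
      exact (OBelow.lift_z _ _ _).trans (OBelow.letterOp_self hp)
    simp only [Function.comp_apply, ev, LinearMap.comp_apply, seqMonomial]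
    change (OBelow.polyRep hp (_ * _)) (Finsupp.single 0 1) = _
    rw [map_mul, map_pow, h3, h4, Module.End.mul_apply, OBelow.mulLetter_pow_single,
      OBelow.mulCoeff_single, mul_one]

/-- The canonical homomorphism from `O_q(M(n))` to `OBelow n p`, for `p` large. -/
def toOBelow (n : ℕ) : O n →ₐ[K] OBelow n (n * n) :=
  RingQuot.liftAlgHom K ⟨RingQuot.mkAlgHom K (RelBelow n (n * n)), by
    have hc : ∀ i j : Fin n, code i j < n * n := by
      intro i j
      have h1 := Nat.mul_le_mul_left n (show (i : ℕ) + 1 ≤ n from i.isLt)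
      have h2 := j.isLt
      unfold code
      rw [mul_add] at h1
      omega
    intro x y h
    cases h with
    | row i j k h => exact RingQuot.mkAlgHom_rel K (RelBelow.row i j k h (hc _ _))
    | col i k j h => exact RingQuot.mkAlgHom_rel K (RelBelow.col i k j h (hc _ _))
    | anti i j s t h h' => exact RingQuot.mkAlgHom_rel K (RelBelow.anti i j s t h h' (hc _ _))
    | diag i j s t h h' => exact RingQuot.mkAlgHom_rel K (RelBelow.diag i j s t h h' (hc _ _))⟩

theorem toOBelow_Z {n : ℕ} (i j : Fin n) : toOBelow n (Z i j) = OBelow.z n (n * n) i j := by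
  unfold toOBelow Z OBelow.z
  rw [RingQuot.liftAlgHom_mkAlgHom_apply]

theorem monomial_eq_seqMonomial {n : ℕ} (A : Mat n) :
    monomial A = seqMonomial (listed (Z (n := n))) (n * n)
      (fun c => A (Fin.divNat c) (Fin.modNat c)) := by
  rw [seqMonomial_eq_prod, List.ofFn_mul, List.prod_flatten, List.map_ofFn]
  unfold monomial
  congr 2
  funext i
  simp only [Function.comp_apply]
  congr 2
  funext j
  have h : (i : ℕ) * n + j < n * n := by
    have h1 := Nat.mul_le_mul_left n (show (i : ℕ) + 1 ≤ n from i.isLt)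
    have h2 := j.isLt
    rw [mul_add] at h1
    nlinarith
  have hn : 0 < n := i.pos
  have e1 : (Fin.divNat ⟨(i : ℕ) * n + j, h⟩ : Fin n) = i := by
    ext; simp [Fin.divNat, mul_comm, Nat.mul_add_div hn]
  have e2 : (Fin.modNat ⟨(i : ℕ) * n + j, h⟩ : Fin n) = j := by
    ext; simp [Fin.modNat, Nat.mod_eq_of_lt]
  simp only [listed, dif_pos h, e1, e2]

/-- The ordered monomials are linearly independent. -/
theorem linearIndependent_monomial (n : ℕ) : LinearIndependent K (monomial (n := n)) := by
  apply LinearIndependent.of_comp (toOBelow n).toLinearMap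
  have h1 := linearIndependent_seqMonomial (n := n) le_rfl
  have h2 : Function.Injective
      fun (A : Mat n) (c : Fin (n * n)) => A (Fin.divNat c) (Fin.modNat c) := by
    intro A B h
    ext i j
    have := congrFun h (finProdFinEquiv (i, j))
    have h3 := finProdFinEquiv.symm_apply_apply (i, j)
    simp only [finProdFinEquiv_symm_apply, Prod.mk.injEq] at h3
    simpa only [h3] using this
  suffices h3 : ⇑(toOBelow n).toLinearMap ∘ monomial = seqMonomial (listed (OBelow.z n (n * n)))
      (n * n) ∘ fun (A : Mat n) (c : Fin (n * n)) => A (Fin.divNat c) (Fin.modNat c) by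
    rw [h3]; exact h1.comp _ h2
  ext1 A
  change toOBelow n (monomial A) = _
  rw [monomial_eq_seqMonomial]
  refine (map_seqMonomial (toOBelow n) _ _ _).trans ?_
  apply seqMonomial_congr
  intro c hc
  simp only [Function.comp_apply, listed, dif_pos hc]
  exact toOBelow_Z _ _

theorem linearIndependent_ZN (n : ℕ) : LinearIndependent K (ZN (n := n)) := by
  have h := (linearIndependent_monomial n).units_smul
    fun A => Units.mk0 ((q⁻¹) ^ normExp A) (pow_ne_zero _ (inv_ne_zero q_ne_zero))
  exact h

theorem O_smul_sub {n : ℕ} (a : K) (x y : O n) : a • (x - y) = a • x - a • y := smul_sub a x y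

theorem O_sub_smul {n : ℕ} (a b : K) (x : O n) : (a - b) • x = a • x - b • x := sub_smul a b x

theorem O_neg_smul {n : ℕ} (a : K) (x : O n) : (-a) • x = -(a • x) := neg_smul a x

/-! ### The lexicographic order on matrices -/

/-- A matrix as an element of a linearly ordered type. -/
def lexKey {n : ℕ} (A : Mat n) : Lex (Fin n ×ₗ Fin n → ℕ) :=
  toLex fun u => A (ofLex u).1 (ofLex u).2

theorem lexLT_iff {n : ℕ} {A B : Mat n} : LexLT B A ↔ lexKey B < lexKey A := by
  constructor
  · rintro ⟨i, j, h1, h2⟩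
    refine ⟨toLex (i, j), ?_, h1⟩
    intro u hu
    refine h2 _ _ ?_
    rcases Prod.Lex.lt_iff.mp hu with h | h
    · exact Or.inl h
    · exact Or.inr h
  · rintro ⟨u, h1, h2⟩
    refine ⟨(ofLex u).1, (ofLex u).2, h2, ?_⟩
    intro k l h
    exact h1 (toLex (k, l)) (Prod.Lex.lt_iff.mpr h)

theorem lexKey_injective {n : ℕ} : Function.Injective (lexKey (n := n)) := by
  intro A B h
  ext i j
  exact congrFun (toLex_inj.mp h) (toLex (i, j))

theorem LexLT.trans {n : ℕ} {A B C : Mat n} (h : LexLT A B) (h' : LexLT B C) : LexLT A C := by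
  rw [lexLT_iff] at *
  exact lt_trans h h'

theorem LexLT.irrefl {n : ℕ} (A : Mat n) : ¬ LexLT A A := by
  rw [lexLT_iff]
  exact lt_irrefl _

theorem wellFounded_lexLT (n : ℕ) : WellFounded (LexLT (n := n)) := by
  have : Finite (Fin n ×ₗ Fin n) := inferInstanceAs (Finite (Fin n × Fin n))
  have h : WellFounded fun a b : Lex (Fin n ×ₗ Fin n → ℕ) => a < b := wellFounded_lt
  have h2 := InvImage.wf (lexKey (n := n)) h
  convert h2 using 1
  ext A B
  exact lexLT_iff

theorem LexLT.add_right {n : ℕ} {A B : Mat n} (h : LexLT B A) (C : Mat n) :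
    LexLT (B + C) (A + C) := by
  obtain ⟨i, j, h1, h2⟩ := h
  exact ⟨i, j, by simpa using h1, fun k l h => by simp [h2 k l h]⟩

/-- `B` precedes `A` and has the same row and column sums. -/
def Below {n : ℕ} (B A : Mat n) : Prop := LexLT B A ∧ ro B = ro A ∧ co B = co A

theorem Below.trans {n : ℕ} {A B C : Mat n} (h : Below A B) (h' : Below B C) : Below A C :=
  ⟨h.1.trans h'.1, h.2.1.trans h'.2.1, h.2.2.trans h'.2.2⟩

theorem ro_add {n : ℕ} (A B : Mat n) : ro (A + B) = ro A + ro B := by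
  funext i
  simp [ro, Finset.sum_add_distrib]

theorem co_add {n : ℕ} (A B : Mat n) : co (A + B) = co A + co B := by
  funext i
  simp [co, Finset.sum_add_distrib]

theorem Below.add_right {n : ℕ} {A B : Mat n} (h : Below B A) (C : Mat n) :
    Below (B + C) (A + C) :=
  ⟨h.1.add_right C, by rw [ro_add, ro_add, h.2.1], by rw [co_add, co_add, h.2.2]⟩

/-! ### Words in the generators -/

/-- The exponent of `q` attached to an ordered pair of letters. -/
def kappa {n : ℕ} (u v : Fin n × Fin n) : ℤ :=
  if u.1 = v.1 ∨ u.2 = v.2 then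
    (if code u.1 u.2 < code v.1 v.2 then 1 else 0) - (if code v.1 v.2 < code u.1 u.2 then 1 else 0)
  else 0

theorem kappa_swap {n : ℕ} (u v : Fin n × Fin n) : kappa v u = -kappa u v := by
  unfold kappa
  simp only [eq_comm (a := v.1), eq_comm (a := v.2)]
  split_ifs <;> simp

/-- The sum of `kappa u v` for `u` in the first and `v` in the second list. -/
def crossExp {n : ℕ} (l l' : List (Fin n × Fin n)) : ℤ :=
  (l.map fun u => (l'.map fun v => kappa u v).sum).sum

/-- The exponent of `q` by which a word is normalized. -/
def wordExp {n : ℕ} : List (Fin n × Fin n) → ℤ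
  | [] => 0
  | u :: l => (l.map fun v => kappa u v).sum + wordExp l

/-- The product of the letters of a word. -/
def wordProd {n : ℕ} (l : List (Fin n × Fin n)) : O n := (l.map fun u => Z u.1 u.2).prod

/-- The normalized product of the letters of a word. -/
def wordNorm {n : ℕ} (l : List (Fin n × Fin n)) : O n := q ^ (-wordExp l) • wordProd l

theorem wordExp_append {n : ℕ} (l l' : List (Fin n × Fin n)) :
    wordExp (l ++ l') = wordExp l + wordExp l' + crossExp l l' := by
  induction l with
  | nil => simp [wordExp, crossExp]
  | cons u l ih =>
    simp only [List.cons_append, wordExp, ih, crossExp, List.map_append, List.sum_append,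
      List.map_cons, List.sum_cons]
    ring

theorem wordProd_append {n : ℕ} (l l' : List (Fin n × Fin n)) :
    wordProd (l ++ l') = wordProd l * wordProd l' := by
  simp [wordProd]

theorem crossExp_perm_left {n : ℕ} {l₁ l₂ : List (Fin n × Fin n)} (h : l₁.Perm l₂)
    (l : List (Fin n × Fin n)) : crossExp l₁ l = crossExp l₂ l :=
  (h.map _).sum_eq

theorem crossExp_perm_right {n : ℕ} {l₁ l₂ : List (Fin n × Fin n)} (h : l₁.Perm l₂)
    (l : List (Fin n × Fin n)) : crossExp l l₁ = crossExp l l₂ := by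
  unfold crossExp
  congr 1
  apply List.map_congr_left
  intro u _
  exact (h.map _).sum_eq

theorem crossExp_swap {n : ℕ} (l l' : List (Fin n × Fin n)) : crossExp l' l = -crossExp l l' := by
  have h1 : ∀ (u : Fin n × Fin n) (l' : List (Fin n × Fin n)),
      (l'.map fun v => kappa v u).sum = -(l'.map fun v => kappa u v).sum := by
    intro u l'
    induction l' with
    | nil => simp
    | cons v l' ih =>
      simp only [List.map_cons, List.sum_cons, ih, kappa_swap u v]
      ring
  induction l with
  | nil => simp [crossExp]
  | cons u l ih =>
    have h : crossExp l' (u :: l) = -(l'.map fun v => kappa u v).sum + crossExp l' l := by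
      unfold crossExp
      simp only [List.map_cons, List.sum_cons]
      rw [List.sum_map_add, h1]
    rw [h, ih]
    simp only [crossExp, List.map_cons, List.sum_cons]
    ring

theorem wordExp_reverse {n : ℕ} (l : List (Fin n × Fin n)) : wordExp l.reverse = -wordExp l := by
  induction l with
  | nil => simp [wordExp]
  | cons u l ih =>
    rw [List.reverse_cons, wordExp_append, ih, crossExp_perm_left (List.reverse_perm l),
      crossExp_swap [u] l]
    simp [wordExp, crossExp]

theorem bar_wordProd {n : ℕ} (l : List (Fin n × Fin n)) :
    bar (wordProd l) = wordProd l.reverse := by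
  induction l with
  | nil => simp [wordProd, bar]
  | cons u l ih =>
    rw [List.reverse_cons, wordProd_append, ← ih, show u :: l = [u] ++ l from rfl,
      wordProd_append, bar_mul]
    simp [wordProd, bar_Z]

/-- Since `kappa` is antisymmetric, reversing a word negates its exponent, exactly as `q ↦ q⁻¹`
does. -/
theorem bar_wordNorm {n : ℕ} (l : List (Fin n × Fin n)) :
    bar (wordNorm l) = wordNorm l.reverse := by
  unfold wordNorm
  rw [bar_smul, bar_wordProd, wordExp_reverse, map_zpow₀, barK_q, inv_zpow', neg_neg]

/-- The matrix counting the letters of a word. -/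
def content {n : ℕ} (l : List (Fin n × Fin n)) : Mat n := fun i j => l.count (i, j)

theorem content_append {n : ℕ} (l l' : List (Fin n × Fin n)) :
    content (l ++ l') = content l + content l' := by
  ext i j
  simp [content]

theorem content_perm {n : ℕ} {l l' : List (Fin n × Fin n)} (h : l.Perm l') :
    content l = content l' := by
  ext i j
  exact h.count_eq _

theorem below_content {n : ℕ} {i j s t : Fin n} (h : i < s) (h' : j < t) :
    Below (content [(i, t), (s, j)]) (content [(i, j), (s, t)]) := by
  refine ⟨⟨i, j, ?_, ?_⟩, ?_, ?_⟩
  · simp [content, List.count_cons, h.ne', h'.ne']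
  · rintro k l (hk | ⟨rfl, hl⟩)
    · have h2 := hk.trans h
      simp [content, List.count_cons, hk.ne', h2.ne']
    · have h2 := hl.trans h'
      simp [content, List.count_cons, h.ne', hl.ne', h2.ne']
  · funext k
    simp only [ro, content, List.count_cons, List.count_nil, Finset.sum_add_distrib]
    by_cases h1 : i = k <;> by_cases h2 : s = k <;> simp [h1, h2]
  · funext k
    simp only [co, content, List.count_cons, List.count_nil, Finset.sum_add_distrib]
    by_cases h1 : j = k <;> by_cases h2 : t = k <;> simp [h1, h2]

/-- The `ℤ[q, q⁻¹]`-span of the normalized monomials below `A`. -/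
def spanBelow {n : ℕ} (A : Mat n) : Submodule Zqq (O n) :=
  Submodule.span Zqq {x | ∃ B, Below B A ∧ x = ZN B}

theorem ZN_mem_spanBelow {n : ℕ} {A B : Mat n} (h : Below B A) : ZN B ∈ spanBelow A :=
  Submodule.subset_span ⟨B, h, rfl⟩

theorem spanBelow_mono {n : ℕ} {A B : Mat n} (h : Below B A) : spanBelow B ≤ spanBelow A :=
  Submodule.span_mono fun _ ⟨C, hC, hx⟩ => ⟨C, hC.trans h, hx⟩

theorem smul_mem_spanBelow {n : ℕ} {A : Mat n} {c : K} (hc : c ∈ Zqq) {x : O n}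
    (hx : x ∈ spanBelow A) : c • x ∈ spanBelow A :=
  (spanBelow A).smul_mem ⟨c, hc⟩ hx

/-- The normalization is symmetric: letters sharing a row or column `q²`-commute, and splitting `q²`
evenly between the two orders makes them equal. Only the diagonal relation leaves a remainder, in
which `(i,j), (s,t)` is replaced by the smaller pair `(i,t), (s,j)`. -/
theorem swap_letters {n : ℕ} (u v : Fin n × Fin n) :
    ∃ c ∈ Zqq, ∃ u' v' : Fin n × Fin n,
      q ^ (-kappa u v) • (Z u.1 u.2 * Z v.1 v.2) = q ^ (-kappa v u) • (Z v.1 v.2 * Z u.1 u.2) +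
        c • (Z u'.1 u'.2 * Z v'.1 v'.2) ∧ (c = 0 ∨ Below (content [u', v']) (content [u, v])) := by
  have hq := q_ne_zero
  have hd : q ^ 2 - (q⁻¹) ^ 2 ∈ Zqq :=
    sub_mem (pow_mem q_mem_Zqq 2) (pow_mem q_inv_mem_Zqq 2)
  obtain ⟨i, j⟩ := u
  obtain ⟨s, t⟩ := v
  simp only
  have hzero : ∀ x y : O n, x = y → ∃ c ∈ Zqq, ∃ u' v' : Fin n × Fin n,
      x = y + c • (Z u'.1 u'.2 * Z v'.1 v'.2) ∧
        (c = 0 ∨ Below (content [u', v']) (content [(i, j), (s, t)])) := by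
    rintro x y rfl
    exact ⟨0, zero_mem _, (i, j), (i, j), by simp, Or.inl rfl⟩
  rcases lt_trichotomy i s with h | rfl | h
  · have hc := code_lt_of_fst_lt h j t
    rcases lt_trichotomy j t with h' | rfl | h'
    · refine ⟨q ^ 2 - (q⁻¹) ^ 2, hd, (i, t), (s, j), ?_, Or.inr (below_content h h')⟩
      simp only [kappa, h.ne, h'.ne, h.ne', h'.ne', or_self, if_false, neg_zero, zpow_zero, one_smul]
      exact Z_diag i j s t h h'
    · apply hzero
      simp only [kappa, or_true, if_true, hc, hc.not_gt, if_false]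
      rw [Z_col i s j h, smul_smul]
      congr 1
      norm_num
      field_simp
    · apply hzero
      simp only [kappa, h.ne, h'.ne, h.ne', h'.ne', or_self, if_false, neg_zero, zpow_zero, one_smul]
      exact (Z_anti s t i j h h').symm
  · apply hzero
    rcases lt_trichotomy j t with h' | rfl | h'
    · have hc := code_lt_of_snd_lt i h'
      simp only [kappa, true_or, if_true, hc, hc.not_gt, if_false]
      rw [Z_row i j t h', smul_smul]
      congr 1
      norm_num
      field_simp
    · rfl
    · have hc := code_lt_of_snd_lt i h'
      simp only [kappa, true_or, if_true, hc, hc.not_gt, if_false]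
      rw [Z_row i t j h', smul_smul]
      congr 1
      norm_num
      field_simp
  · have hc := code_lt_of_fst_lt h t j
    rcases lt_trichotomy j t with h' | rfl | h'
    · apply hzero
      simp only [kappa, h.ne, h'.ne, h.ne', h'.ne', or_self, if_false, neg_zero, zpow_zero, one_smul]
      exact Z_anti i j s t h h'
    · apply hzero
      simp only [kappa, or_true, if_true, hc, hc.not_gt, if_false]
      rw [Z_col s i j h, smul_smul]
      congr 1
      norm_num
      field_simp
    · refine ⟨-(q ^ 2 - (q⁻¹) ^ 2), neg_mem hd, (s, j), (i, t), ?_, Or.inr ?_⟩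
      · simp only [kappa, h.ne, h'.ne, h.ne', h'.ne', or_self, if_false, neg_zero, zpow_zero,
          one_smul]
        rw [Z_diag s t i j h h', O_neg_smul, add_neg_cancel_right]
      · rw [content_perm (List.Perm.swap (s, t) (i, j) [])]
        exact below_content h h'

theorem wordNorm_append_cons_cons {n : ℕ} (l l' : List (Fin n × Fin n)) (u v : Fin n × Fin n) :
    wordNorm (l ++ u :: v :: l') = q ^ (-(wordExp l + wordExp l' + crossExp l l' +
        crossExp l [u, v] + crossExp [u, v] l')) •
      (wordProd l * (q ^ (-kappa u v) • (Z u.1 u.2 * Z v.1 v.2)) * wordProd l') := by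
  have hq := q_ne_zero
  have e : l ++ u :: v :: l' = l ++ ([u, v] ++ l') := by simp
  have h : crossExp l ([u, v] ++ l') = crossExp l [u, v] + crossExp l l' := by
    rw [crossExp_swap _ l, crossExp_swap [u, v] l, crossExp_swap l' l]
    simp [crossExp]
    ring
  unfold wordNorm
  rw [e, wordProd_append, wordProd_append, wordExp_append, wordExp_append, h, mul_smul_comm,
    smul_mul_assoc, smul_smul, ← zpow_add₀ hq, mul_assoc]
  congr 1
  · congr 1
    simp [wordExp]
    ring
  · simp [wordProd]

/-- The normalizing factors from the surrounding letters depend only on the unordered pair, hence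
cancel. The remainder is a Laurent multiple of a word whose content is below `A`, where the
hypothesis applies. -/
theorem wordNorm_swap {n : ℕ} {A : Mat n}
    (ih : ∀ w : List (Fin n × Fin n), Below (content w) A → wordNorm w ∈ spanBelow A)
    (l l' : List (Fin n × Fin n)) (u v : Fin n × Fin n) (hA : content (l ++ u :: v :: l') = A) :
    wordNorm (l ++ u :: v :: l') - wordNorm (l ++ v :: u :: l') ∈ spanBelow A := by
  have hq := q_ne_zero
  obtain ⟨c, hc, u', v', h, h2⟩ := swap_letters u v
  have hp : [u, v].Perm [v, u] := List.Perm.swap _ _ _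
  rw [wordNorm_append_cons_cons, wordNorm_append_cons_cons l l' v u, crossExp_perm_left hp,
    crossExp_perm_right hp, ← O_smul_sub, ← sub_mul, ← mul_sub, h, add_sub_cancel_left]
  rcases h2 with rfl | h2
  · simp
  have h3 := wordNorm_append_cons_cons l l' u' v'
  set e := -(wordExp l + wordExp l' + crossExp l l' + crossExp l [v, u] + crossExp [v, u] l')
  set e' := -(wordExp l + wordExp l' + crossExp l l' + crossExp l [u', v'] + crossExp [u', v'] l')
  have h4 : q ^ e • (wordProd l * (c • (Z u'.1 u'.2 * Z v'.1 v'.2)) * wordProd l') =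
      (q ^ e * q ^ (-e') * c * q ^ kappa u' v') • wordNorm (l ++ u' :: v' :: l') := by
    rw [h3]
    simp only [mul_smul_comm, smul_mul_assoc, smul_smul]
    congr 1
    simp only [zpow_neg]
    field_simp
  rw [h4]
  refine smul_mem_spanBelow ?_ (ih _ ?_)
  · exact mul_mem (mul_mem (mul_mem (q_zpow_mem_Zqq _) (q_zpow_mem_Zqq _)) hc) (q_zpow_mem_Zqq _)
  · rw [← hA, show l ++ u' :: v' :: l' = l ++ ([u', v'] ++ l') by simp,
      show l ++ u :: v :: l' = l ++ ([u, v] ++ l') by simp, content_append, content_append,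
      content_append, content_append, add_left_comm, add_left_comm (content l)]
    exact h2.add_right _

theorem wordNorm_perm {n : ℕ} {A : Mat n}
    (ih : ∀ w : List (Fin n × Fin n), Below (content w) A → wordNorm w ∈ spanBelow A)
    {w w' : List (Fin n × Fin n)} (h : w.Perm w') (l l' : List (Fin n × Fin n))
    (hA : content (l ++ w ++ l') = A) :
    wordNorm (l ++ w ++ l') - wordNorm (l ++ w' ++ l') ∈ spanBelow A := by
  induction h generalizing l l' with
  | nil => simp
  | cons x _ ih' =>
    have := ih' (l ++ [x]) l' (by simpa using hA)
    simpa using this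
  | swap x y w =>
    have := wordNorm_swap ih l (w ++ l') y x (by simpa using hA)
    simpa using this
  | trans h₁ _ ih₁ ih₂ =>
    have h1 := ih₁ l l' hA
    have h2 := ih₂ l l' (by
      rw [← hA]
      exact content_perm (((h₁.symm.append_left l).append_right l')))
    have := add_mem h1 h2
    simpa using this

/-! ### Sorted words -/

/-- The second elementary symmetric function of a family of natural numbers. -/
def esymmTwo {m : ℕ} (f : Fin m → ℕ) : ℕ := ∑ k, ∑ j ∈ Finset.Ioi k, f j * f k

/-- Power sums replace sums over ordered pairs, which turns the later exponent comparisons into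
integer algebra. -/
theorem two_mul_esymmTwo {m : ℕ} (f : Fin m → ℕ) :
    2 * (esymmTwo f : ℤ) = (∑ i, (f i : ℤ)) ^ 2 - ∑ i, (f i : ℤ) ^ 2 := by
  have h1 : (esymmTwo f : ℤ) = ∑ k, ∑ j, if k < j then (f j : ℤ) * f k else 0 := by
    simp only [esymmTwo, ← Finset.sum_filter]
    push_cast
    refine Finset.sum_congr rfl fun k _ => Finset.sum_congr ?_ fun _ _ => rfl
    ext j; simp
  have h2 : (esymmTwo f : ℤ) = ∑ k, ∑ j, if j < k then (f j : ℤ) * f k else 0 := by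
    rw [h1, Finset.sum_comm]
    refine Finset.sum_congr rfl fun k _ => Finset.sum_congr rfl fun j _ => ?_
    rw [mul_comm]
  have h3 : ∑ i, (f i : ℤ) ^ 2 = ∑ k, ∑ j, if j = k then (f j : ℤ) * f k else 0 := by
    simp [sq]
  rw [two_mul]
  nth_rewrite 1 [h1]
  rw [h2, h3, sq, Finset.sum_mul_sum, eq_sub_iff_add_eq, ← Finset.sum_add_distrib,
    ← Finset.sum_add_distrib]
  refine Finset.sum_congr rfl fun k _ => ?_
  rw [← Finset.sum_add_distrib, ← Finset.sum_add_distrib]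
  refine Finset.sum_congr rfl fun j _ => ?_
  rcases lt_trichotomy j k with h | rfl | h
  · simp [h, h.not_gt, h.ne, mul_comm]
  · simp
  · simp [h, h.not_gt, h.ne', mul_comm]

theorem normExp_eq {n : ℕ} (A : Mat n) :
    normExp A = ∑ i, esymmTwo (A i) + ∑ j, esymmTwo fun i => A i j := rfl

theorem two_mul_normExp {n : ℕ} (A : Mat n) :
    2 * (normExp A : ℤ) = ∑ i, (ro A i : ℤ) ^ 2 + ∑ j, (co A j : ℤ) ^ 2 -
      2 * ∑ i, ∑ j, (A i j : ℤ) ^ 2 := by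
  rw [normExp_eq]
  push_cast
  rw [mul_add, Finset.mul_sum, Finset.mul_sum]
  simp only [two_mul_esymmTwo, Finset.sum_sub_distrib]
  rw [Finset.sum_comm (f := fun x i => (A i x : ℤ) ^ 2)]
  simp only [ro, co]
  push_cast
  ring

/-- The letters are listed in the lexicographic order. -/
def WordSorted {n : ℕ} (w : List (Fin n × Fin n)) : Prop :=
  w.Pairwise fun u v => code u.1 u.2 ≤ code v.1 v.2

/-- Equal letters share both row and column but must contribute 0; this accounts for the correction
by 2. -/
theorem abs_kappa {n : ℕ} (u v : Fin n × Fin n) :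
    |kappa u v| = (if u.1 = v.1 then 1 else 0) + (if u.2 = v.2 then 1 else 0) -
      2 * if u = v then 1 else 0 := by
  obtain ⟨i, j⟩ := u
  obtain ⟨s, t⟩ := v
  rcases lt_trichotomy i s with h | rfl | h
  · have hc := code_lt_of_fst_lt h j t
    rcases eq_or_ne j t with rfl | hj
    · simp [kappa, hc, hc.not_gt, h.ne]
    · simp [kappa, hj, h.ne]
  · rcases lt_trichotomy j t with h | rfl | h
    · have hc := code_lt_of_snd_lt i h
      simp [kappa, hc, hc.not_gt, h.ne]
    · simp [kappa]
    · have hc := code_lt_of_snd_lt i h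
      simp [kappa, hc, hc.not_gt, h.ne']
  · have hc := code_lt_of_fst_lt h t j
    rcases eq_or_ne j t with rfl | hj
    · simp [kappa, hc, hc.not_gt, h.ne']
    · simp [kappa, hj, h.ne']

theorem kappa_nonneg {n : ℕ} {u v : Fin n × Fin n} (h : code u.1 u.2 ≤ code v.1 v.2) :
    0 ≤ kappa u v := by
  unfold kappa
  rw [if_neg h.not_gt]
  split_ifs <;> simp

theorem list_sum_map_eq_sum_content {n : ℕ} (l : List (Fin n × Fin n))
    (f : Fin n × Fin n → ℤ) : (l.map f).sum = ∑ u, (content l u.1 u.2 : ℤ) * f u := by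
  induction l with
  | nil => simp [content]
  | cons v l ih =>
    have h : ∀ u : Fin n × Fin n, (content (v :: l) u.1 u.2 : ℤ) * f u =
        (if v = u then f u else 0) + (content l u.1 u.2 : ℤ) * f u := by
      intro u
      simp only [content, Prod.mk.eta, List.count_cons, beq_iff_eq]
      split_ifs <;> push_cast <;> ring
    simp [h, Finset.sum_add_distrib, ih]

/-- In a sorted word every earlier letter has nonnegative `kappa` against every later one. The sum
over all ordered pairs of absolute values counts each such pair twice and depends only on the
content. -/
theorem two_mul_wordExp {n : ℕ} {w : List (Fin n × Fin n)} (hw : WordSorted w) :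
    2 * wordExp w = (w.map fun u => (w.map fun v => |kappa u v|).sum).sum := by
  induction w with
  | nil => simp [wordExp]
  | cons u l ih =>
    rw [WordSorted, List.pairwise_cons] at hw
    have h0 : kappa u u = 0 := by simp [kappa]
    have h1 : (l.map fun v => |kappa u v|) = l.map fun v => kappa u v :=
      List.map_congr_left fun v hv => abs_of_nonneg (kappa_nonneg (hw.1 v hv))
    have h2 : (l.map fun v => |kappa v u|) = l.map fun v => kappa u v :=
      List.map_congr_left fun v hv => by
        rw [kappa_swap u v, abs_neg, abs_of_nonneg (kappa_nonneg (hw.1 v hv))]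
    simp only [List.map_cons, List.sum_cons, wordExp, mul_add, ih hw.2, h0, h1, abs_zero]
    rw [List.sum_map_add, h2]
    ring

theorem wordExp_eq_normExp {n : ℕ} {w : List (Fin n × Fin n)} (hw : WordSorted w) :
    wordExp w = normExp (content w) := by
  have h : 2 * wordExp w = 2 * (normExp (content w) : ℤ) := by
    rw [two_mul_wordExp hw, two_mul_normExp]
    simp only [list_sum_map_eq_sum_content, abs_kappa, mul_add, mul_sub, Finset.sum_add_distrib,
      Finset.sum_sub_distrib]
    have e1 : ∑ u : Fin n × Fin n, (content w u.1 u.2 : ℤ) * ∑ v : Fin n × Fin n,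
        (content w v.1 v.2 : ℤ) * (if u.1 = v.1 then 1 else 0) =
        ∑ i, (ro (content w) i : ℤ) ^ 2 := by
      simp only [Fintype.sum_prod_type, ro, sq]
      push_cast
      refine Finset.sum_congr rfl fun i _ => ?_
      rw [Finset.sum_mul]
      refine Finset.sum_congr rfl fun j _ => ?_
      rw [Finset.sum_comm]
      simp
    have e2 : ∑ u : Fin n × Fin n, (content w u.1 u.2 : ℤ) * ∑ v : Fin n × Fin n,
        (content w v.1 v.2 : ℤ) * (if u.2 = v.2 then 1 else 0) =
        ∑ i, (co (content w) i : ℤ) ^ 2 := by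
      simp only [Fintype.sum_prod_type_right, co, sq]
      push_cast
      refine Finset.sum_congr rfl fun i _ => ?_
      rw [Finset.sum_mul]
      refine Finset.sum_congr rfl fun j _ => ?_
      rw [Finset.sum_comm]
      simp
    have e3 : ∑ u : Fin n × Fin n, (content w u.1 u.2 : ℤ) * ∑ v : Fin n × Fin n,
        (content w v.1 v.2 : ℤ) * (2 * if u = v then 1 else 0) =
        2 * ∑ i, ∑ j, (content w i j : ℤ) ^ 2 := by
      simp only [mul_ite, mul_one, mul_zero, Finset.sum_ite_eq, Finset.mem_univ, if_true]
      rw [Fintype.sum_prod_type, Finset.mul_sum]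
      refine Finset.sum_congr rfl fun i _ => ?_
      rw [Finset.mul_sum]
      refine Finset.sum_congr rfl fun j _ => ?_
      ring
    rw [e1, e2, e3]
  omega

/-- The sorted word with content `A`. -/
def sortedWord {n : ℕ} (A : Mat n) : List (Fin n × Fin n) :=
  (List.ofFn fun i => (List.ofFn fun j => List.replicate (A i j) (i, j)).flatten).flatten

theorem wordProd_sortedWord {n : ℕ} (A : Mat n) : wordProd (sortedWord A) = monomial A := by
  simp only [wordProd, sortedWord, monomial, List.map_flatten, List.prod_flatten, List.map_ofFn]
  congr 2
  funext i
  simp only [Function.comp_apply, List.map_flatten, List.prod_flatten, List.map_ofFn]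
  congr 2
  funext j
  simp

theorem content_sortedWord {n : ℕ} (A : Mat n) : content (sortedWord A) = A := by
  ext i j
  simp only [content, sortedWord, List.count_flatten, List.map_ofFn, List.sum_ofFn,
    Function.comp_apply, List.count_replicate]
  rw [Finset.sum_eq_single i, Finset.sum_eq_single j]
  · simp
  · intro b _ hb; simp [hb]
  · simp
  · intro b _ hb; simp [hb]
  · simp

theorem wordSorted_sortedWord {n : ℕ} (A : Mat n) : WordSorted (sortedWord A) := by
  unfold WordSorted sortedWord
  rw [List.pairwise_flatten]
  constructor
  · intro l hl
    obtain ⟨i, rfl⟩ := List.mem_ofFn.mp hl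
    rw [List.pairwise_flatten]
    constructor
    · intro l hl
      obtain ⟨j, rfl⟩ := List.mem_ofFn.mp hl
      exact List.pairwise_replicate.mpr (Or.inr le_rfl)
    · rw [List.pairwise_ofFn]
      intro j k hjk u hu v hv
      rw [List.eq_of_mem_replicate hu, List.eq_of_mem_replicate hv]
      exact (code_lt_of_snd_lt i hjk).le
  · rw [List.pairwise_ofFn]
    intro i s his u hu v hv
    obtain ⟨l, hl, hu⟩ := List.mem_flatten.mp hu
    obtain ⟨j, rfl⟩ := List.mem_ofFn.mp hl
    obtain ⟨l', hl', hv⟩ := List.mem_flatten.mp hv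
    obtain ⟨k, rfl⟩ := List.mem_ofFn.mp hl'
    rw [List.eq_of_mem_replicate hu, List.eq_of_mem_replicate hv]
    exact (code_lt_of_fst_lt his j k).le

theorem wordNorm_sortedWord {n : ℕ} (A : Mat n) : wordNorm (sortedWord A) = ZN A := by
  unfold wordNorm ZN
  rw [wordProd_sortedWord, wordExp_eq_normExp (wordSorted_sortedWord A), content_sortedWord,
    zpow_neg, zpow_natCast, inv_pow]

theorem perm_of_content_eq {n : ℕ} {w w' : List (Fin n × Fin n)} (h : content w = content w') :
    w.Perm w' :=
  List.perm_iff_count.mpr fun u => congrFun (congrFun h u.1) u.2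

theorem WordSorted.eq_of_perm {n : ℕ} {w w' : List (Fin n × Fin n)} (hw : WordSorted w)
    (hw' : WordSorted w') (h : w.Perm w') : w = w' := by
  refine h.eq_of_pairwise ?_ hw hw'
  intro u v _ _ h1 h2
  have := code_inj (le_antisymm h1 h2)
  exact Prod.ext this.1 this.2

theorem wordNorm_of_sorted {n : ℕ} {w : List (Fin n × Fin n)} (hw : WordSorted w) :
    wordNorm w = ZN (content w) := by
  rw [← wordNorm_sortedWord, ← hw.eq_of_perm (wordSorted_sortedWord (content w))
    (perm_of_content_eq (content_sortedWord _).symm)]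

/-! ### Straightening -/

/-- Induction on the content: sorting a word changes it only by words of smaller content, which are
already straightened. -/
theorem wordNorm_sub_ZN_mem {n : ℕ} (A : Mat n) :
    ∀ w : List (Fin n × Fin n), content w = A → wordNorm w - ZN A ∈ spanBelow A := by
  induction A using (wellFounded_lexLT n).induction with
  | _ A ih =>
    intro w hw
    have h1 : ∀ w : List (Fin n × Fin n), Below (content w) A → wordNorm w ∈ spanBelow A := by
      intro w hw
      have h2 := spanBelow_mono hw (ih _ hw.1 w rfl)
      simpa using add_mem h2 (ZN_mem_spanBelow hw)
    have h2 := wordNorm_perm h1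
      (perm_of_content_eq (hw.trans (content_sortedWord A).symm)) [] [] (by simpa using hw)
    simpa [wordNorm_sortedWord] using h2

theorem bar_ZN_sub_mem {n : ℕ} (A : Mat n) : bar (ZN A) - ZN A ∈ spanBelow A := by
  rw [← wordNorm_sortedWord, bar_wordNorm, wordNorm_sortedWord]
  apply wordNorm_sub_ZN_mem
  rw [content_perm (List.reverse_perm _), content_sortedWord]

theorem bar_bar_ZN {n : ℕ} (A : Mat n) : bar (bar (ZN A)) = ZN A := by
  rw [← wordNorm_sortedWord, bar_wordNorm, bar_wordNorm, List.reverse_reverse]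

/-! ### Existence and uniqueness of the dual canonical basis -/

/-- The bar map as an additive homomorphism. -/
def barAdd (n : ℕ) : O n →+ O n where
  toFun := bar
  map_zero' := by simp [bar]
  map_add' := bar_add

theorem bar_sum {n : ℕ} {ι : Type*} (s : Finset ι) (f : ι → O n) :
    bar (∑ i ∈ s, f i) = ∑ i ∈ s, bar (f i) := map_sum (barAdd n) f s

theorem bar_sub {n : ℕ} (x y : O n) : bar (x - y) = bar x - bar y := map_sub (barAdd n) x y

theorem bar_zero (n : ℕ) : bar (0 : O n) = 0 := map_zero (barAdd n)

/-- The `ℤ[q]`-span of the `q Z(B)` with `B` in a set of matrices. -/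
def qLattice {n : ℕ} (S : Set (Mat n)) : Submodule Zq (O n) :=
  Submodule.span Zq ((fun B => q • ZN B) '' S)

theorem qLattice_mono {n : ℕ} {S T : Set (Mat n)} (h : S ⊆ T) : qLattice S ≤ qLattice T :=
  Submodule.span_mono (Set.image_mono h)

theorem smul_ZN_mem_qLattice {n : ℕ} {S : Set (Mat n)} {B : Mat n} (hB : B ∈ S) {c : K}
    (hc : c ∈ qZq) : c • ZN B ∈ qLattice S := by
  obtain ⟨p, hp, rfl⟩ := hc
  rw [mul_comm, mul_smul]
  exact (qLattice S).smul_mem ⟨p, hp⟩ (Submodule.subset_span ⟨B, hB, rfl⟩)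

theorem smul_mem_qLattice {n : ℕ} {S : Set (Mat n)} {c : K} (hc : c ∈ Zq) {x : O n}
    (hx : x ∈ qLattice S) : c • x ∈ qLattice S :=
  (qLattice S).smul_mem ⟨c, hc⟩ hx

theorem exists_finsupp_of_mem_qLattice {n : ℕ} {S : Set (Mat n)} {x : O n}
    (hx : x ∈ qLattice S) :
    ∃ h : Mat n →₀ K, (∀ B ∈ h.support, B ∈ S) ∧ (∀ B, h B ∈ qZq) ∧
      x = h.sum fun B c => c • ZN B := by
  induction hx using Submodule.span_induction with
  | mem x hx =>
    obtain ⟨B, hB, rfl⟩ := hx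
    refine ⟨Finsupp.single B q, ?_, ?_, ?_⟩
    · intro C hC
      rw [Finset.mem_singleton.mp (Finsupp.support_single_subset hC)]
      exact hB
    · intro C
      rw [Finsupp.single_apply]
      split_ifs
      · exact ⟨1, one_mem _, by simp⟩
      · exact zero_mem _
    · rw [Finsupp.sum_single_index (by simp)]
  | zero => exact ⟨0, by simp, fun _ => zero_mem _, by simp⟩
  | add x y _ _ hx hy =>
    obtain ⟨h, h1, h2, rfl⟩ := hx
    obtain ⟨h', h1', h2', rfl⟩ := hy
    refine ⟨h + h', ?_, fun B => add_mem (h2 B) (h2' B), ?_⟩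
    · intro B hB
      rcases Finset.mem_union.mp (Finsupp.support_add hB) with h | h
      · exact h1 B h
      · exact h1' B h
    · rw [Finsupp.sum_add_index' (by simp) (fun _ _ _ => add_smul _ _ _)]
  | smul a x _ hx =>
    obtain ⟨h, h1, h2, rfl⟩ := hx
    refine ⟨(a : K) • h, ?_, fun B => Zq_mul_mem_qZq a.2 (h2 B), ?_⟩
    · intro B hB
      exact h1 B (Finsupp.support_smul hB)
    · rw [Finsupp.sum_smul_index (by simp), Finsupp.sum, Finsupp.sum, Finset.smul_sum]
      refine Finset.sum_congr rfl fun B _ => ?_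
      rw [mul_smul]
      rfl

/-- The `ℚ(q)`-span of the `Z(C)` with `C < B`. -/
def spanLT {n : ℕ} (B : Mat n) : Submodule K (O n) := Submodule.span K (ZN '' {C | LexLT C B})

theorem ZN_mem_spanLT {n : ℕ} {C B : Mat n} (h : LexLT C B) : ZN C ∈ spanLT B :=
  Submodule.subset_span ⟨C, h, rfl⟩

theorem spanLT_mono {n : ℕ} {C B : Mat n} (h : LexLT C B) : spanLT C ≤ spanLT B :=
  Submodule.span_mono (Set.image_mono fun _ h' => LexLT.trans h' h)

theorem ZN_notMem_spanLT {n : ℕ} (B : Mat n) : ZN B ∉ spanLT B :=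
  (linearIndependent_ZN n).notMem_span_image (LexLT.irrefl B)

theorem eq_zero_of_smul_ZN_mem {n : ℕ} {B : Mat n} {c : K} (h : c • ZN B ∈ spanLT B) : c = 0 := by
  by_contra hc
  exact ZN_notMem_spanLT B (((spanLT B).smul_mem_iff hc).mp h)

theorem qLattice_le_spanLT {n : ℕ} {B : Mat n} {x : O n} (hx : x ∈ qLattice {C | LexLT C B}) :
    x ∈ spanLT B := by
  obtain ⟨h, h1, -, rfl⟩ := exists_finsupp_of_mem_qLattice hx
  exact sum_mem fun C hC => (spanLT B).smul_mem _ (ZN_mem_spanLT (h1 C hC))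

theorem spanBelow_le_spanLT {n : ℕ} {B : Mat n} {x : O n} (hx : x ∈ spanBelow B) :
    x ∈ spanLT B := by
  induction hx using Submodule.span_induction with
  | mem x hx => obtain ⟨C, hC, rfl⟩ := hx; exact ZN_mem_spanLT hC.1
  | zero => exact zero_mem _
  | add x y _ _ hx hy => exact add_mem hx hy
  | smul a x _ hx => exact (spanLT B).smul_mem (a : K) hx

/-- Leading-term extraction for a unitriangular family. The map `c` on coefficients is the identity
for an element itself and `barK` for its image under bar. -/
theorem sum_sub_mem_spanLT {n : ℕ} (b : Mat n → O n) (h : Mat n →₀ K)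
    (hb : ∀ B ∈ h.support, b B - ZN B ∈ spanLT B) {B₀ : Mat n} (h₀ : B₀ ∈ h.support)
    (hmax : ∀ B ∈ h.support, B = B₀ ∨ LexLT B B₀) (c : K → K) :
    (h.sum fun B a => c a • b B) - c (h B₀) • ZN B₀ ∈ spanLT B₀ := by
  rw [Finsupp.sum, ← Finset.add_sum_erase _ _ h₀, add_sub_right_comm, ← O_smul_sub]
  refine add_mem ((spanLT B₀).smul_mem _ (hb _ h₀)) (sum_mem fun B hB => ?_)
  obtain ⟨hne, hB⟩ := Finset.mem_erase.mp hB
  have hlt := (hmax B hB).resolve_left hne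
  have := add_mem (spanLT_mono hlt (hb B hB)) (ZN_mem_spanLT hlt)
  rw [sub_add_cancel] at this
  exact (spanLT B₀).smul_mem _ this

theorem exists_lexLT_max {n : ℕ} {s : Finset (Mat n)} (hs : s.Nonempty) :
    ∃ B₀ ∈ s, ∀ B ∈ s, B = B₀ ∨ LexLT B B₀ := by
  obtain ⟨B₀, h₀, hmax⟩ := s.exists_max_image lexKey hs
  refine ⟨B₀, h₀, fun B hB => ?_⟩
  rcases (hmax B hB).eq_or_lt with h | h
  · exact Or.inl (lexKey_injective h)
  · exact Or.inr (lexLT_iff.mpr h)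

theorem finsupp_eq_zero_of_triangular {n : ℕ} (b : Mat n → O n) (h : Mat n →₀ K)
    (hb : ∀ B ∈ h.support, b B - ZN B ∈ spanLT B) (h0 : (h.sum fun B a => a • b B) = 0) :
    h = 0 := by
  by_contra hne
  obtain ⟨B₀, h₀, hmax⟩ := exists_lexLT_max (Finsupp.support_nonempty_iff.mpr hne)
  have h1 := sum_sub_mem_spanLT b h hb h₀ hmax id
  simp only [id_eq] at h1
  rw [h0, zero_sub, neg_mem_iff] at h1
  exact Finsupp.mem_support_iff.mp h₀ (eq_zero_of_smul_ZN_mem h1)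

/-- Comparing leading coefficients of `x` and `bar x` yields `barK c = ± c` with `c ∈ q ℤ[q]`,
impossible unless `c = 0`. -/
theorem eq_zero_of_mem_qLattice {n : ℕ} {S : Set (Mat n)} {x : O n} (hx : x ∈ qLattice S)
    (hbar : bar x = x ∨ bar x = -x) : x = 0 := by
  obtain ⟨h, -, h2, rfl⟩ := exists_finsupp_of_mem_qLattice hx
  by_contra hne
  have hne : h ≠ 0 := fun h => hne (by simp [h])
  obtain ⟨B₀, h₀, hmax⟩ := exists_lexLT_max (Finsupp.support_nonempty_iff.mpr hne)
  have h3 := sum_sub_mem_spanLT (fun B => ZN B) h (by simp) h₀ hmax id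
  have h4 := sum_sub_mem_spanLT (fun B => bar (ZN B)) h
    (fun B _ => spanBelow_le_spanLT (bar_ZN_sub_mem B)) h₀ hmax barK
  have h5 : bar (h.sum fun B c => c • ZN B) = h.sum fun B c => barK c • bar (ZN B) := by
    rw [Finsupp.sum, bar_sum]
    exact Finset.sum_congr rfl fun B _ => bar_smul _ _
  simp only [id_eq] at h3
  rw [← h5] at h4
  have h6 : h B₀ = 0 := by
    rcases hbar with hbar | hbar
    · rw [hbar] at h4
      have h7 := sub_mem h3 h4
      rw [sub_sub_sub_cancel_left, ← O_sub_smul] at h7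
      exact eq_zero_of_barK_eq (h2 _) (sub_eq_zero.mp (eq_zero_of_smul_ZN_mem h7))
    · rw [hbar] at h4
      have h7 := neg_mem (add_mem h3 h4)
      have h8 : ∀ x y z : O n, -(x - y + (-x - z)) = y + z := by intro x y z; abel
      rw [h8, ← add_smul] at h7
      refine eq_zero_of_barK_eq_neg (h2 _) ?_
      have := eq_zero_of_smul_ZN_mem h7
      linear_combination this
  exact Finsupp.mem_support_iff.mp h₀ h6

theorem exists_finsupp_of_mem_span {n : ℕ} {b : Mat n → O n} {S : Set (Mat n)} {x : O n}
    (hx : x ∈ Submodule.span Zqq (b '' S)) :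
    ∃ h : Mat n →₀ K, (∀ B ∈ h.support, B ∈ S) ∧ (∀ B, h B ∈ Zqq) ∧
      x = h.sum fun B c => c • b B := by
  induction hx using Submodule.span_induction with
  | mem x hx =>
    obtain ⟨B, hB, rfl⟩ := hx
    refine ⟨Finsupp.single B 1, ?_, ?_, ?_⟩
    · intro C hC
      rw [Finset.mem_singleton.mp (Finsupp.support_single_subset hC)]
      exact hB
    · intro C
      rw [Finsupp.single_apply]
      split_ifs
      · exact one_mem _
      · exact zero_mem _
    · rw [Finsupp.sum_single_index (by simp), one_smul]
  | zero => exact ⟨0, by simp, fun _ => zero_mem _, by simp⟩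
  | add x y _ _ hx hy =>
    obtain ⟨h, h1, h2, rfl⟩ := hx
    obtain ⟨h', h1', h2', rfl⟩ := hy
    refine ⟨h + h', ?_, fun B => add_mem (h2 B) (h2' B), ?_⟩
    · intro B hB
      rcases Finset.mem_union.mp (Finsupp.support_add hB) with h | h
      · exact h1 B h
      · exact h1' B h
    · rw [Finsupp.sum_add_index' (by simp) (fun _ _ _ => add_smul _ _ _)]
  | smul a x _ hx =>
    obtain ⟨h, h1, h2, rfl⟩ := hx
    refine ⟨(a : K) • h, ?_, fun B => mul_mem a.2 (h2 B), ?_⟩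
    · intro B hB
      exact h1 B (Finsupp.support_smul hB)
    · rw [Finsupp.sum_smul_index (by simp), Finsupp.sum, Finsupp.sum, Finset.smul_sum]
      refine Finset.sum_congr rfl fun B _ => ?_
      rw [mul_smul]
      rfl

/-- Kazhdan–Lusztig induction: `bar (ZN A) - ZN A` is expanded in the bar-invariant elements already
constructed below `A`. It is negated by bar, so its coefficients are antisymmetric and can be split
as `p - barK p`. -/
theorem exists_bar_invariant {n : ℕ} (A : Mat n) :
    ∃ x : O n, bar x = x ∧ x - ZN A ∈ qLattice {B | Below B A} := by
  induction A using (wellFounded_lexLT n).induction with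
  | _ A ih =>
    choose! b hb1 hb2 using ih
    have hspan : ∀ B, Below B A → ZN B ∈ Submodule.span Zqq (b '' {B | Below B A}) := by
      intro B
      induction B using (wellFounded_lexLT n).induction with
      | _ B ihB =>
        intro hB
        obtain ⟨h, h1, h2, h3⟩ := exists_finsupp_of_mem_qLattice (hb2 B hB.1)
        have h4 : ZN B = b B - h.sum fun C c => c • ZN C := by rw [← h3]; abel
        rw [h4]
        refine sub_mem (Submodule.subset_span ⟨B, hB, rfl⟩) (sum_mem fun C hC => ?_)
        exact Submodule.smul_mem _ (⟨h C, Zq_le_Zqq (mem_Zq_of_mem_qZq (h2 C))⟩ : Zqq)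
          (ihB C (h1 C hC).1 ((h1 C hC).trans hB))
    have hy : bar (ZN A) - ZN A ∈ Submodule.span Zqq (b '' {B | Below B A}) := by
      refine Submodule.span_le.mpr ?_ (bar_ZN_sub_mem A)
      rintro _ ⟨B, hB, rfl⟩
      exact hspan B hB
    obtain ⟨r, r1, r2, r3⟩ := exists_finsupp_of_mem_span hy
    have hbar : bar (bar (ZN A) - ZN A) = r.sum fun B c => barK c • b B := by
      rw [r3, Finsupp.sum, bar_sum]
      exact Finset.sum_congr rfl fun B hB => by rw [bar_smul, hb1 B (r1 B hB).1]
    -- The family `b` is unitriangular, hence independent; bar is an involution on `ZN A`, so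
    -- applying it to the expansion and adding gives zero.
    have hneg : ∀ B, barK (r B) = -r B := by
      let h : Mat n →₀ K := r.mapRange (fun c => barK c + c) (by simp)
      have hsupp : ∀ B ∈ h.support, B ∈ r.support := by
        intro B hB
        rw [Finsupp.mem_support_iff] at hB ⊢
        intro h0
        apply hB
        simp [h, h0]
      have h0 : h = 0 := by
        apply finsupp_eq_zero_of_triangular b h
        · intro B hB
          have hB := r1 B (hsupp B hB)
          exact qLattice_le_spanLT (qLattice_mono (fun C hC => hC.1) (hb2 B hB.1))
        · rw [Finsupp.sum_mapRange_index (by simp)]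
          simp only [add_smul]
          rw [Finsupp.sum_add, ← hbar, ← r3, bar_sub, bar_bar_ZN]
          abel
      intro B
      have := DFunLike.congr_fun h0 B
      simp only [h, Finsupp.mapRange_apply, Finsupp.coe_zero, Pi.zero_apply] at this
      linear_combination this
    choose p hp1 hp2 using fun B => exists_sub_barK (r2 B) (hneg B)
    -- Bar sends `p` to `barK p`, and the defect `p - barK p` of `ZN A` restores the difference.
    refine ⟨ZN A + ∑ B ∈ r.support, p B • b B, ?_, ?_⟩
    · rw [bar_add, bar_sum]
      have h1 : bar (ZN A) = ZN A + ∑ B ∈ r.support, (p B - barK (p B)) • b B := by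
        rw [← sub_eq_iff_eq_add', r3, Finsupp.sum]
        exact Finset.sum_congr rfl fun B _ => by rw [← hp2]
      rw [h1, add_assoc, ← Finset.sum_add_distrib]
      congr 1
      refine Finset.sum_congr rfl fun B hB => ?_
      rw [bar_smul, hb1 B (r1 B hB).1, ← add_smul, sub_add_cancel]
    · rw [add_sub_cancel_left]
      refine sum_mem fun B hB => ?_
      have hB := r1 B hB
      have h1 : p B • b B = p B • ZN B + p B • (b B - ZN B) := by
        rw [← smul_add, add_sub_cancel]
      rw [h1]
      refine add_mem (smul_ZN_mem_qLattice hB (hp1 B)) (smul_mem_qLattice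
        (mem_Zq_of_mem_qZq (hp1 B)) (qLattice_mono (fun C hC => hC.trans hB) (hb2 B hB.1)))

/-- The dual canonical basis. -/
def dualCanonical {n : ℕ} (A : Mat n) : O n := (exists_bar_invariant A).choose

theorem bar_dualCanonical {n : ℕ} (A : Mat n) : bar (dualCanonical A) = dualCanonical A :=
  (exists_bar_invariant A).choose_spec.1

theorem dualCanonical_sub_mem_below {n : ℕ} (A : Mat n) :
    dualCanonical A - ZN A ∈ qLattice {B | Below B A} :=
  (exists_bar_invariant A).choose_spec.2

theorem dualCanonical_sub_mem {n : ℕ} (A : Mat n) :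
    dualCanonical A - ZN A ∈ qLattice Set.univ :=
  qLattice_mono (Set.subset_univ _) (dualCanonical_sub_mem_below A)

/-- A bar-invariant element congruent to `Z(A)` is the element of the dual canonical basis
attached to `A`. -/
theorem eq_dualCanonical {n : ℕ} {A : Mat n} {x : O n} (h1 : bar x = x)
    (h2 : x - ZN A ∈ qLattice Set.univ) : x = dualCanonical A := by
  rw [← sub_eq_zero]
  apply eq_zero_of_mem_qLattice (S := Set.univ)
  · have := sub_mem h2 (dualCanonical_sub_mem A)
    rwa [sub_sub_sub_cancel_right] at this
  · left
    rw [bar_sub, h1, bar_dualCanonical]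

theorem isDualCanonicalBasis_dualCanonical (n : ℕ) :
    IsDualCanonicalBasis (dualCanonical (n := n)) where
  linearIndependent := by
    have h : LinearIndependent K (dualCanonical (n := n)) := by
      rw [linearIndependent_iff]
      intro h h0
      apply finsupp_eq_zero_of_triangular dualCanonical h _ h0
      intro B _
      exact qLattice_le_spanLT (qLattice_mono (fun C hC => hC.1) (dualCanonical_sub_mem_below B))
    refine h.restrict_scalars ?_
    intro a b hab
    simpa [Subring.smul_def] using hab
  span_eq := by
    have hZN : ∀ B : Mat n, ZN B ∈ lattice n := fun B => Submodule.subset_span ⟨B, rfl⟩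
    apply le_antisymm
    · rw [Submodule.span_le]
      rintro _ ⟨A, rfl⟩
      have h1 : qLattice Set.univ ≤ lattice n := by
        unfold qLattice
        rw [Submodule.span_le]
        rintro _ ⟨B, -, rfl⟩
        exact (lattice n).smul_mem ⟨q, q_mem_Zq⟩ (hZN B)
      have := add_mem (h1 (dualCanonical_sub_mem A)) (hZN A)
      rwa [sub_add_cancel] at this
    · unfold lattice
      rw [Submodule.span_le]
      rintro _ ⟨A, rfl⟩
      induction A using (wellFounded_lexLT n).induction with
      | _ A ih =>
        have h1 : qLattice {B | Below B A} ≤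
            Submodule.span Zq (Set.range (dualCanonical (n := n))) := by
          unfold qLattice
          rw [Submodule.span_le]
          rintro _ ⟨B, hB, rfl⟩
          exact Submodule.smul_mem _ (⟨q, q_mem_Zq⟩ : Zq) (ih B hB.1)
        have h2 : dualCanonical A ∈ Submodule.span Zq (Set.range (dualCanonical (n := n))) :=
          Submodule.subset_span ⟨A, rfl⟩
        have := sub_mem h2 (h1 (dualCanonical_sub_mem_below A))
        rwa [sub_sub_cancel] at this
  bar_eq := bar_dualCanonical
  triangular A := by
    obtain ⟨h, h1, h2, h3⟩ := exists_finsupp_of_mem_qLattice (dualCanonical_sub_mem_below A)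
    refine ⟨h, fun B hB => ⟨(h1 B hB).1, (h1 B hB).2.1, (h1 B hB).2.2, h2 B⟩, ?_⟩
    rw [← h3, add_sub_cancel]

theorem IsDualCanonicalBasis.eq_dualCanonical {n : ℕ} {b : Mat n → O n}
    (hb : IsDualCanonicalBasis b) : b = dualCanonical := by
  funext A
  apply QuantumMatrix.eq_dualCanonical (hb.bar_eq A)
  obtain ⟨h, h1, h2⟩ := hb.triangular A
  rw [h2, add_sub_cancel_left]
  exact sum_mem fun B hB => smul_ZN_mem_qLattice (Set.mem_univ B) (h1 B hB).2.2.2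

/-! ### Expansions of quantum minors -/

section Abstract

variable {ι : Type*} [LinearOrder ι]

/-- The number of elements of `J` greater than `j`. -/
def above (J : Finset ι) (j : ι) : ℕ := (J.filter fun l => j < l).card

/-- The number of elements of `J` strictly between `p` and `s`. -/
def between (J : Finset ι) (p s : ι) : ℕ := (J.filter fun l => p < l ∧ l < s).card

theorem card_filter_erase {J : Finset ι} {j : ι} (hj : j ∈ J) (P : ι → Prop) [DecidablePred P] :
    (J.filter P).card = ((J.erase j).filter P).card + if P j then 1 else 0 := by
  rw [← Finset.insert_erase hj, Finset.filter_insert, Finset.erase_insert (Finset.notMem_erase j J)]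
  split_ifs with h
  · rw [Finset.card_insert_of_notMem]
    simp
  · rfl

theorem above_erase {J : Finset ι} {j : ι} (hj : j ∈ J) (p : ι) :
    above J p = above (J.erase j) p + if p < j then 1 else 0 :=
  card_filter_erase hj _

theorem between_erase {J : Finset ι} {j : ι} (hj : j ∈ J) (p s : ι) :
    between J p s = between (J.erase j) p s + if p < j ∧ j < s then 1 else 0 :=
  card_filter_erase hj _

theorem above_insert {J : Finset ι} {s : ι} (hs : s ∉ J) (p : ι) :
    above (insert s J) p = above J p + if p < s then 1 else 0 := by
  have h := above_erase (Finset.mem_insert_self s J) p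
  rwa [Finset.erase_insert hs] at h

theorem above_eq_of_notMem {J : Finset ι} {p s : ι} (h : p < s) (hs : s ∉ J) :
    above J p = between J p s + above J s := by
  unfold above between
  rw [← Finset.card_union_of_disjoint]
  · congr 1
    ext l
    simp only [Finset.mem_filter, Finset.mem_union]
    constructor
    · rintro ⟨h1, h2⟩
      rcases lt_trichotomy l s with h3 | rfl | h3
      · exact Or.inl ⟨h1, h2, h3⟩
      · exact absurd h1 hs
      · exact Or.inr ⟨h1, h3⟩
    · rintro (⟨h1, h2, -⟩ | ⟨h1, h2⟩)
      · exact ⟨h1, h2⟩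
      · exact ⟨h1, h.trans h2⟩
  · rw [Finset.disjoint_left]
    intro l h1 h2
    simp only [Finset.mem_filter] at h1 h2
    exact lt_asymm h1.2.2 h2.2

theorem above_eq_of_mem {J : Finset ι} {p s : ι} (h : p < s) (hs : s ∈ J) :
    above J p = between J p s + above J s + 1 := by
  have h1 := above_erase hs p
  have h2 := above_erase hs s
  have h3 := between_erase hs p s
  have h4 := above_eq_of_notMem h (Finset.notMem_erase s J)
  simp [h] at h1 h2 h3
  omega

variable {B : Type*} [Ring B] [Algebra K B]

/-- Laplace expansion: `f` gives the minors on the rows above, `x` is the last row. -/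
def expand (f : Finset ι → B) (x : ι → B) (J : Finset ι) : B :=
  ∑ j ∈ J, (-q ^ 2) ^ above J j • (f (J.erase j) * x j)

/-- The exchange relations between the entries of a row `y` and of a row `x` above it, up to a
common scalar. -/
structure RowExchange (c : K) (x y : ι → B) : Prop where
  lt (s j : ι) (h : s < j) : y s * x j = c • (x j * y s)
  same (s : ι) : y s * x s = (c * (q⁻¹) ^ 2) • (x s * y s)
  gt (s j : ι) (h : j < s) :
    y s * x j = c • (x j * y s - (q ^ 2 - (q⁻¹) ^ 2) • (x s * y j))

/-- The exchange relations between the entries of a row `y` and minors `f J` on columns `J`. -/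
structure MinorExchange (c : K) (f : Finset ι → B) (y : ι → B) : Prop where
  mem (J : Finset ι) (s : ι) (h : s ∈ J) : y s * f J = (c * (q⁻¹) ^ 2) • (f J * y s)
  notMem (J : Finset ι) (s : ι) (h : s ∉ J) :
    y s * f J = c • (f J * y s - (q ^ 2 - (q⁻¹) ^ 2) • ∑ p ∈ J with p < s,
      (-q ^ 2) ^ between J p s • (f (insert s (J.erase p)) * y p))

variable {c : K} {f : Finset ι → B} {x y : ι → B}

/-- Moving `y s` first past the minor and then past the entry `x j` creates corrections for `j < s`
(from the entry) and for `j = s` (from the minor). These two kinds cancel. -/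
theorem MinorExchange.expand_mem (hf : MinorExchange 1 f y) (hx : RowExchange c x y)
    (J : Finset ι) (s : ι) (hs : s ∈ J) :
    y s * expand f x J = (c * (q⁻¹) ^ 2) • (expand f x J * y s) := by
  have hq := q_ne_zero
  set δ : K := q ^ 2 - (q⁻¹) ^ 2 with hδ
  have hterm : ∀ j ∈ J, y s * ((-q ^ 2) ^ above J j • (f (J.erase j) * x j)) =
      (c * (q⁻¹) ^ 2) • (((-q ^ 2) ^ above J j • (f (J.erase j) * x j)) * y s) +
      (if j < s then
        -((c * (q⁻¹) ^ 2 * δ * (-q ^ 2) ^ above J j) • (f (J.erase j) * (x s * y j))) else 0) +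
      (if j = s then ∑ p ∈ J with p < s, -((c * δ * (-q ^ 2) ^ (above J s + between J p s)) •
        (f (J.erase p) * (x s * y p))) else 0) := by
    intro j hj
    rw [mul_smul_comm, ← mul_assoc]
    rcases lt_trichotomy j s with h | rfl | h
    · have hs' : s ∈ J.erase j := Finset.mem_erase.mpr ⟨h.ne', hs⟩
      rw [if_pos h, if_neg h.ne, hf.mem _ _ hs', smul_mul_assoc, mul_assoc, hx.gt s j h]
      simp only [mul_smul_comm, smul_mul_assoc, mul_sub, mul_assoc]
      module
    · rw [if_neg (lt_irrefl j), if_pos rfl, hf.notMem _ _ (Finset.notMem_erase j J)]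
      have hsum : (∑ p ∈ J.erase j with p < j, (-q ^ 2) ^ between (J.erase j) p j •
          (f (insert j ((J.erase j).erase p)) * y p)) * x j =
          ∑ p ∈ J with p < j, (c * (-q ^ 2) ^ between J p j) •
            (f (J.erase p) * (x j * y p)) := by
        rw [Finset.sum_mul]
        have e : (J.erase j).filter (· < j) = J.filter (· < j) := by
          ext p
          simp only [Finset.mem_filter, Finset.mem_erase]
          constructor
          · rintro ⟨⟨-, h1⟩, h2⟩; exact ⟨h1, h2⟩
          · rintro ⟨h1, h2⟩; exact ⟨⟨h2.ne, h1⟩, h2⟩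
        rw [e]
        refine Finset.sum_congr rfl fun p hp => ?_
        obtain ⟨hp1, hp2⟩ := Finset.mem_filter.mp hp
        have e2 : insert j ((J.erase j).erase p) = J.erase p := by
          rw [Finset.erase_right_comm, Finset.insert_erase]
          exact Finset.mem_erase.mpr ⟨hp2.ne', hj⟩
        have e3 : between J p j = between (J.erase j) p j := by
          simpa using between_erase hj p j
        rw [e2, e3, smul_mul_assoc, mul_assoc, hx.lt p j hp2, mul_smul_comm, smul_smul, mul_comm c]
      rw [smul_mul_assoc, sub_mul, smul_mul_assoc, hsum, mul_assoc, hx.same, Finset.smul_sum,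
        one_smul, smul_sub, Finset.smul_sum, add_zero, sub_eq_add_neg, ← Finset.sum_neg_distrib]
      congr 1
      · simp only [mul_smul_comm, smul_mul_assoc, smul_smul, mul_assoc]
        congr 1; ring
      · refine Finset.sum_congr rfl fun p _ => ?_
        rw [smul_smul, smul_smul]
        congr 2
        rw [pow_add]; ring
    · have hs' : s ∈ J.erase j := Finset.mem_erase.mpr ⟨h.ne, hs⟩
      rw [if_neg h.not_gt, if_neg h.ne', hf.mem _ _ hs', smul_mul_assoc, mul_assoc, hx.lt s j h]
      simp only [mul_smul_comm, smul_mul_assoc, mul_assoc]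
      module
  unfold expand
  rw [Finset.mul_sum, Finset.sum_congr rfl hterm, Finset.sum_add_distrib, Finset.sum_add_distrib,
    Finset.sum_ite_eq' J s, if_pos hs, ← Finset.sum_filter, Finset.sum_mul, Finset.smul_sum,
    add_assoc, ← Finset.sum_add_distrib]
  -- For each `p < s` in `J` the product `f (J.erase p) * (x s * y p)` occurs twice. The exponents
  -- of `-q²` differ by one because `s` itself lies above `p`, which compensates the factor `(q⁻¹)²`
  -- and flips the sign.
  refine add_eq_left.mpr (Finset.sum_eq_zero fun p hp => ?_)
  obtain ⟨hp1, hp2⟩ := Finset.mem_filter.mp hp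
  rw [← neg_add, ← add_smul, above_eq_of_mem hp2 hs]
  have : c * q⁻¹ ^ 2 * δ * (-q ^ 2) ^ (between J p s + above J s + 1) +
      c * δ * (-q ^ 2) ^ (above J s + between J p s) = 0 := by
    rw [pow_add, pow_add, pow_add, pow_one]
    field_simp
    ring
  rw [this, zero_smul, neg_zero]

/-- Both sides are expanded into the products `f (J.erase p) * (x s * y p)` and `F p j * (x j * y
p)`, and coefficients are compared. On the left, `δ` comes from one correction and `δ²` from
correcting both the minor and the entry. -/
theorem MinorExchange.expand_notMem (hf : MinorExchange 1 f y) (hx : RowExchange c x y)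
    (J : Finset ι) (s : ι) (hs : s ∉ J) :
    y s * expand f x J = c • (expand f x J * y s - (q ^ 2 - (q⁻¹) ^ 2) • ∑ p ∈ J with p < s,
      (-q ^ 2) ^ between J p s • (expand f x (insert s (J.erase p)) * y p)) := by
  have hq := q_ne_zero
  set δ : K := q ^ 2 - (q⁻¹) ^ 2 with hδ
  set F : ι → ι → B := fun p j => f (insert s ((J.erase p).erase j)) with hF
  have hFs : ∀ p j, F p j = F j p := fun p j => by
    simp only [hF, Finset.erase_right_comm]
  -- the left hand side
  have hterm : ∀ j ∈ J, y s * ((-q ^ 2) ^ above J j • (f (J.erase j) * x j)) =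
      c • (((-q ^ 2) ^ above J j • (f (J.erase j) * x j)) * y s) +
      (if j < s then
        -((c * δ * (-q ^ 2) ^ above J j) • (f (J.erase j) * (x s * y j))) else 0) +
      (∑ p ∈ J.erase j with p < s,
        (-((c * δ * (-q ^ 2) ^ (above J j + between (J.erase j) p s)) •
          (F p j * (x j * y p))))) +
      ∑ p ∈ J.erase j, (if j < p ∧ p < s then
        (c * δ * δ * (-q ^ 2) ^ (above J j + between (J.erase j) p s)) •
          (F j p * (x p * y j)) else 0) := by
    intro j hj
    have h1 : y s * x j = c • (x j * y s) + if j < s then -((c * δ) • (x s * y j)) else 0 := by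
      rcases lt_trichotomy j s with h | rfl | h
      · rw [if_pos h, hx.gt s j h]; module
      · exact absurd hj hs
      · rw [if_neg h.not_gt, hx.lt s j h, add_zero]
    have h2 : ∀ p, p ≠ j → y p * x j = c • (x j * y p) +
        if j < p then -((c * δ) • (x p * y j)) else 0 := by
      intro p hp
      rcases lt_or_gt_of_ne hp with h | h
      · rw [if_neg h.not_gt, hx.lt p j h, add_zero]
      · rw [if_pos h, hx.gt p j h]; module
    have hs' : s ∉ J.erase j := fun h => hs (Finset.mem_of_mem_erase h)
    have e1 : (∑ p ∈ J.erase j, (if j < p ∧ p < s then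
        (c * δ * δ * (-q ^ 2) ^ (above J j + between (J.erase j) p s)) •
          (F j p * (x p * y j)) else 0)) = ∑ p ∈ J.erase j with p < s, (if j < p then
        (c * δ * δ * (-q ^ 2) ^ (above J j + between (J.erase j) p s)) •
          (F j p * (x p * y j)) else 0) := by
      rw [Finset.sum_filter]
      refine Finset.sum_congr rfl fun p _ => ?_
      by_cases h3 : j < p <;> by_cases h4 : p < s <;> simp [h3, h4]
    rw [e1, add_assoc, ← Finset.sum_add_distrib, mul_smul_comm, ← mul_assoc, hf.notMem _ _ hs',
      one_smul, sub_mul, mul_assoc, h1, smul_mul_assoc, Finset.sum_mul, smul_sub, mul_add, smul_add,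
      sub_eq_add_neg]
    congr 1
    · congr 1
      · simp only [mul_smul_comm, smul_mul_assoc, mul_assoc]
        module
      · split_ifs
        · simp only [mul_smul_comm, mul_neg]
          module
        · simp
    · rw [Finset.smul_sum, Finset.smul_sum, ← Finset.sum_neg_distrib]
      refine Finset.sum_congr rfl fun p hp => ?_
      have hp2 := Finset.ne_of_mem_erase (Finset.mem_filter.mp hp).1
      rw [smul_mul_assoc, mul_assoc, h2 p hp2, hFs p j]
      split_ifs
      · simp only [mul_smul_comm, mul_neg, mul_add, pow_add, hF]
        module
      · simp only [mul_smul_comm, add_zero, pow_add, hF]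
        module
  -- the right hand side
  have hright : ∀ p ∈ J.filter (· < s),
      (-q ^ 2) ^ between J p s • (expand f x (insert s (J.erase p)) * y p) =
      (-q ^ 2) ^ above J p • (f (J.erase p) * (x s * y p)) +
      ∑ j ∈ J.erase p, (-q ^ 2) ^ (between J p s + above (insert s (J.erase p)) j) •
        (F p j * (x j * y p)) := by
    intro p hp
    obtain ⟨hp1, hp2⟩ := Finset.mem_filter.mp hp
    have hs' : s ∉ J.erase p := fun h => hs (Finset.mem_of_mem_erase h)
    have e1 : above (insert s (J.erase p)) s = above J s := by
      rw [above_insert hs', above_erase hp1 s]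
      simp [hp2.not_gt]
    unfold expand
    rw [Finset.sum_insert hs', Finset.erase_insert hs', add_mul, smul_add, e1,
      above_eq_of_notMem hp2 hs, Finset.sum_mul, Finset.smul_sum]
    congr 1
    · rw [smul_mul_assoc, smul_smul, ← pow_add, mul_assoc]
    · refine Finset.sum_congr rfl fun j hj => ?_
      rw [smul_mul_assoc, smul_smul, ← pow_add, mul_assoc, Finset.erase_insert_of_ne]
      rintro rfl
      exact hs' hj
  rw [Finset.sum_congr rfl hright, Finset.sum_add_distrib]
  unfold expand
  rw [Finset.mul_sum, Finset.sum_congr rfl hterm, Finset.sum_add_distrib, Finset.sum_add_distrib,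
    Finset.sum_add_distrib, ← Finset.sum_filter, smul_sub, Finset.sum_mul, Finset.smul_sum,
    smul_add, smul_add, sub_eq_add_neg, neg_add, add_assoc, add_assoc]
  congr 1
  have hswap1 : (∑ j ∈ J, ∑ p ∈ J.erase j with p < s,
        (-((c * δ * (-q ^ 2) ^ (above J j + between (J.erase j) p s)) •
          (F p j * (x j * y p))))) = ∑ p ∈ J with p < s, ∑ j ∈ J.erase p,
        (-((c * δ * (-q ^ 2) ^ (above J j + between (J.erase j) p s)) •
          (F p j * (x j * y p)))) := by
    apply Finset.sum_comm'
    intro j p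
    simp only [Finset.mem_filter, Finset.mem_erase]
    constructor
    · rintro ⟨h1, ⟨h2, h3⟩, h4⟩; exact ⟨⟨Ne.symm h2, h1⟩, h3, h4⟩
    · rintro ⟨⟨h2, h1⟩, h3, h4⟩; exact ⟨h1, ⟨Ne.symm h2, h3⟩, h4⟩
  have hswap2 : (∑ j ∈ J, ∑ p ∈ J.erase j, (if j < p ∧ p < s then
        (c * δ * δ * (-q ^ 2) ^ (above J j + between (J.erase j) p s)) •
          (F j p * (x p * y j)) else 0)) = ∑ p ∈ J with p < s, ∑ j ∈ J.erase p,
        (if p < j ∧ j < s then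
        (c * δ * δ * (-q ^ 2) ^ (above J p + between (J.erase p) j s)) •
          (F p j * (x j * y p)) else 0) := by
    rw [Finset.sum_filter]
    refine Finset.sum_congr rfl fun j _ => ?_
    split_ifs with h
    · rfl
    · refine Finset.sum_eq_zero fun p _ => if_neg ?_
      rintro ⟨h1, h2⟩
      exact h (h1.trans h2)
  rw [hswap1, hswap2, Finset.smul_sum, Finset.smul_sum, ← Finset.sum_neg_distrib]
  congr 1
  · refine Finset.sum_congr rfl fun p _ => ?_
    module
  · rw [← Finset.sum_add_distrib, Finset.smul_sum, Finset.smul_sum, ← Finset.sum_neg_distrib]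
    refine Finset.sum_congr rfl fun p hp => ?_
    obtain ⟨hp1, hp2⟩ := Finset.mem_filter.mp hp
    rw [← Finset.sum_add_distrib, Finset.smul_sum, Finset.smul_sum, ← Finset.sum_neg_distrib]
    refine Finset.sum_congr rfl fun j hj => ?_
    obtain ⟨hj1, hj2⟩ := Finset.mem_erase.mp hj
    have hs' : s ∉ J.erase p := fun h => hs (Finset.mem_of_mem_erase h)
    have hjs : j ≠ s := by rintro rfl; exact hs hj2
    have a1 := above_insert hs' j
    have a2 := above_erase hp1 j
    have a3 := between_erase hj2 p s
    have a4 := between_erase hp1 j s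
    have a5 := above_eq_of_notMem hp2 hs
    -- For `j < p` or `j > s` the exponents simply agree. For `p < j < s` the double correction
    -- contributes, and the identity needed is `1 + q² δ = q⁴`.
    rcases lt_or_gt_of_ne hj1 with h | h
    · have h' := h.trans hp2
      simp only [h, h', h.not_gt, false_and, if_true, if_false] at a1 a2 a3 ⊢
      have : above J j + between (J.erase j) p s =
          between J p s + above (insert s (J.erase p)) j := by omega
      rw [this]
      module
    · rcases lt_or_gt_of_ne hjs with h' | h'
      · have a6 := above_eq_of_notMem h' hs
        simp only [h, h', h.not_gt, false_and, and_self, if_true, if_false] at a1 a2 a3 a4 ⊢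
        set E := above J j + between (J.erase j) p s with hE
        have e1 : above J p + between (J.erase p) j s = E + 1 := by omega
        have e2 : between J p s + above (insert s (J.erase p)) j = E + 2 := by omega
        rw [e1, e2]
        match_scalars
        rw [hδ, pow_add, pow_add]
        field_simp
        ring
      · simp only [h, h'.not_gt, h.not_gt, and_false, if_false] at a1 a2 a3 ⊢
        have : above J j + between (J.erase j) p s =
            between J p s + above (insert s (J.erase p)) j := by omega
        rw [this]
        module

theorem MinorExchange.expand (hf : MinorExchange 1 f y) (hx : RowExchange c x y) :
    MinorExchange c (expand f x) y :=
  ⟨hf.expand_mem hx, hf.expand_notMem hx⟩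

end Abstract

/-! ### Repeated rows and the left-handed Laplace expansion -/

section Abstract

variable {ι : Type*} [LinearOrder ι] {B : Type*} [Ring B] [Algebra K B]
  {f : Finset ι → B} {x y : ι → B}

theorem minorExchange_base (y : ι → B) :
    MinorExchange 1 (fun J : Finset ι => if J = ∅ then 1 else 0) y where
  mem J s h := by
    have : J ≠ ∅ := Finset.ne_empty_of_mem h
    simp [this]
  notMem J s h := by
    rw [Finset.sum_eq_zero]
    · split_ifs <;> simp
    · intro p _
      rw [if_neg (Finset.insert_ne_empty _ _), zero_mul, smul_zero]

/-- A minor with its last row repeated vanishes: exchanging the columns of the two copies changes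
the exponent of `-q²` by one, and the row relation supplies the opposite of that factor. -/
theorem expand_expand_eq_zero (hx : ∀ j l, j < l → x j * x l = q ^ 2 • (x l * x j))
    (J : Finset ι) : expand (expand f x) x J = 0 := by
  set G : ι → ι → B := fun l j => ((-q ^ 2) ^ (above J l + above (J.erase l) j)) •
    (f ((J.erase l).erase j) * (x j * x l)) with hG
  have h1 : expand (expand f x) x J = ∑ l ∈ J, ∑ j ∈ J.erase l, G l j := by
    unfold expand
    refine Finset.sum_congr rfl fun l _ => ?_
    rw [Finset.sum_mul, Finset.smul_sum]
    refine Finset.sum_congr rfl fun j _ => ?_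
    rw [smul_mul_assoc, smul_smul, ← pow_add, mul_assoc]
  have h2 : ∀ l ∈ J, ∑ j ∈ J.erase l, G l j =
      ∑ j ∈ J.erase l, (if j < l then G l j else 0) +
        ∑ j ∈ J.erase l, if l < j then G l j else 0 := by
    intro l _
    rw [← Finset.sum_add_distrib]
    refine Finset.sum_congr rfl fun j hj => ?_
    rcases lt_or_gt_of_ne (Finset.ne_of_mem_erase hj) with h | h
    · simp [h, h.not_gt]
    · simp [h, h.not_gt]
  have h3 : ∑ l ∈ J, ∑ j ∈ J.erase l, (if l < j then G l j else 0) =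
      ∑ l ∈ J, ∑ j ∈ J.erase l, if j < l then G j l else 0 := by
    apply Finset.sum_comm'
    intro l j
    simp only [Finset.mem_erase]
    constructor
    · rintro ⟨h1, h2, h3⟩; exact ⟨⟨Ne.symm h2, h1⟩, h3⟩
    · rintro ⟨⟨h1, h2⟩, h3⟩; exact ⟨h2, Ne.symm h1, h3⟩
  rw [h1, Finset.sum_congr rfl h2, Finset.sum_add_distrib, h3, ← Finset.sum_add_distrib]
  refine Finset.sum_eq_zero fun l hl => ?_
  rw [← Finset.sum_add_distrib]
  refine Finset.sum_eq_zero fun j hj => ?_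
  obtain ⟨hne, hj⟩ := Finset.mem_erase.mp hj
  split_ifs with h
  · have e1 := above_erase hl j
    have e2 := above_erase hj l
    simp only [h, h.not_gt, if_true, if_false] at e1 e2
    simp only [hG]
    rw [Finset.erase_right_comm (a := j), hx j l h, ← e2.trans (add_zero _), e1,
      show above (J.erase l) j + 1 + above J l = above J l + above (J.erase l) j + 1 by omega,
      pow_succ]
    simp only [mul_smul_comm]
    module
  · simp

/-- For a column `s` to the right of `J`, the correction sum in the exchange relation is, up to a
factor, the tail of the vanishing expansion on `insert s J`. It equals `q⁻²` times `m J * x s`, so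
the relation collapses to a scalar. -/
theorem mul_eq_of_lt {m : Finset ι → B} (hm : MinorExchange (q ^ 2) m x)
    (h0 : ∀ J, expand m x J = 0) {J : Finset ι} {s : ι} (hs : ∀ p ∈ J, p < s) :
    x s * m J = (q⁻¹) ^ 2 • (m J * x s) := by
  have hq := q_ne_zero
  have hs' : s ∉ J := fun h => lt_irrefl _ (hs s h)
  have h1 := h0 (insert s J)
  have e0 : above J s = 0 := by
    unfold above
    rw [Finset.card_eq_zero, Finset.filter_eq_empty_iff]
    exact fun p hp => (hs p hp).not_gt
  unfold expand at h1
  rw [Finset.sum_insert hs', Finset.erase_insert hs', above_insert hs' s, e0] at h1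
  have h2 : ∑ p ∈ J, (-q ^ 2) ^ above (insert s J) p • (m ((insert s J).erase p) * x p) =
      (-q ^ 2) • ∑ p ∈ J with p < s,
        (-q ^ 2) ^ between J p s • (m (insert s (J.erase p)) * x p) := by
    rw [Finset.smul_sum, Finset.filter_true_of_mem hs]
    refine Finset.sum_congr rfl fun p hp => ?_
    rw [above_insert hs', if_pos (hs p hp), above_eq_of_notMem (hs p hp) hs', e0, add_zero,
      smul_smul, pow_succ', Finset.erase_insert_of_ne]
    rintro rfl
    exact hs' hp
  rw [h2] at h1
  simp only [lt_irrefl, if_false, add_zero, pow_zero, one_smul] at h1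
  set S := ∑ p ∈ J with p < s, (-q ^ 2) ^ between J p s • (m (insert s (J.erase p)) * x p)
  have h3 : S = (q⁻¹) ^ 2 • (m J * x s) := by
    rw [eq_neg_of_add_eq_zero_left h1]
    match_scalars
    field_simp
  rw [hm.notMem J s hs']
  change q ^ 2 • (_ - (q ^ 2 - (q⁻¹) ^ 2) • S) = _
  rw [h3]
  match_scalars
  field_simp
  ring

/-- Counting the larger elements enumerates `S` from its maximum downwards, by `0, …, |S| - 1`. -/
theorem sum_above (S : Finset ι) {M : Type*} [AddCommMonoid M] (g : ℕ → M) :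
    ∑ j ∈ S, g (above S j) = ∑ a ∈ Finset.range S.card, g a := by
  induction S using Finset.induction_on_min with
  | empty => simp
  | insert a S ha ih =>
    have ha' : a ∉ S := fun h => lt_irrefl _ (ha a h)
    have e : above (insert a S) a = S.card := by
      rw [above_insert ha', if_neg (lt_irrefl a), add_zero, above, Finset.filter_true_of_mem ha]
    rw [Finset.sum_insert ha', e, Finset.card_insert_of_notMem ha', Finset.sum_range_succ, ← ih,
      add_comm]
    congr 1
    refine Finset.sum_congr rfl fun j hj => ?_
    rw [above_insert ha', if_neg (ha j hj).not_gt, add_zero]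

/-- Expansion along the last row, with the entries of this row on the left. -/
theorem expand_eq (hf : MinorExchange 1 f x) (J : Finset ι) :
    ∑ j ∈ J, ((-q ^ 2)⁻¹) ^ above J j • (x j * f (J.erase j)) = expand f x J := by
  have hq := q_ne_zero
  have h1 : ∀ j ∈ J, ((-q ^ 2)⁻¹) ^ above J j • (x j * f (J.erase j)) =
      ((-q ^ 2)⁻¹) ^ above J j • (f (J.erase j) * x j) -
        ∑ p ∈ J with p < j, ((q ^ 2 - (q⁻¹) ^ 2) * (((-q ^ 2)⁻¹) ^ above J j *
          (-q ^ 2) ^ between J p j)) • (f (J.erase p) * x p) := by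
    intro j hj
    have e : (J.erase j).filter (· < j) = J.filter (· < j) := by
      ext p
      simp only [Finset.mem_filter, Finset.mem_erase]
      constructor
      · rintro ⟨⟨-, h1⟩, h2⟩; exact ⟨h1, h2⟩
      · rintro ⟨h1, h2⟩; exact ⟨⟨h2.ne, h1⟩, h2⟩
    rw [hf.notMem _ _ (Finset.notMem_erase j J), one_smul, smul_sub, e, Finset.smul_sum,
      Finset.smul_sum]
    congr 1
    refine Finset.sum_congr rfl fun p hp => ?_
    obtain ⟨hp1, hp2⟩ := Finset.mem_filter.mp hp
    have e2 : insert j ((J.erase j).erase p) = J.erase p := by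
      rw [Finset.erase_right_comm, Finset.insert_erase]
      exact Finset.mem_erase.mpr ⟨hp2.ne', hj⟩
    have e3 : between J p j = between (J.erase j) p j := by
      simpa using between_erase hj p j
    rw [e2, e3]
    module
  rw [Finset.sum_congr rfl h1, Finset.sum_sub_distrib]
  have h2 : ∑ j ∈ J, ∑ p ∈ J with p < j, ((q ^ 2 - (q⁻¹) ^ 2) * (((-q ^ 2)⁻¹) ^ above J j *
      (-q ^ 2) ^ between J p j)) • (f (J.erase p) * x p) =
      ∑ p ∈ J, (∑ j ∈ J with p < j, (q ^ 2 - (q⁻¹) ^ 2) * (((-q ^ 2)⁻¹) ^ above J j *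
      (-q ^ 2) ^ between J p j)) • (f (J.erase p) * x p) := by
    simp only [Finset.sum_smul]
    apply Finset.sum_comm'
    intro j p
    simp only [Finset.mem_filter]
    tauto
  rw [h2, ← Finset.sum_sub_distrib]
  unfold expand
  refine Finset.sum_congr rfl fun p hp => ?_
  rw [← sub_smul]
  congr 1
  set S := J.filter fun j => p < j with hS
  have h3 : ∀ j ∈ S, (q ^ 2 - (q⁻¹) ^ 2) * (((-q ^ 2)⁻¹) ^ above J j *
      (-q ^ 2) ^ between J p j) = (q ^ 2 - (q⁻¹) ^ 2) * (((-q ^ 2)⁻¹) ^ above S j *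
      (-q ^ 2) ^ (S.card - 1 - above S j)) := by
    intro j hj
    obtain ⟨hj1, hj2⟩ := Finset.mem_filter.mp hj
    have e1 := above_eq_of_mem hj2 hj1
    have e2 : above J p = S.card := rfl
    have e3 : above S j = above J j := by
      unfold above
      rw [hS, Finset.filter_filter]
      congr 1
      ext l
      simp only [Finset.mem_filter]
      constructor
      · rintro ⟨a, b, c⟩; exact ⟨a, c⟩
      · rintro ⟨a, c⟩; exact ⟨a, hj2.trans c, c⟩
    have e4 : between J p j = S.card - 1 - above S j := by omega
    rw [e3, e4, e3]
  rw [Finset.sum_congr rfl h3, sum_above S fun a => (q ^ 2 - (q⁻¹) ^ 2) * (((-q ^ 2)⁻¹) ^ a *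
      (-q ^ 2) ^ (S.card - 1 - a)), ← Finset.mul_sum]
  -- The corrections form a geometric sum with ratio terms `(-q²)⁻¹` and `-q²`, whose difference is
  -- exactly `q² - q⁻²`. It telescopes, leaving `(-q²) ^ |S|`.
  have h4 := (Commute.all ((-q ^ 2)⁻¹) (-q ^ 2)).geom_sum₂_mul S.card
  have h5 : (-q ^ 2)⁻¹ - -q ^ 2 = q ^ 2 - (q⁻¹) ^ 2 := by
    rw [inv_neg, inv_pow]; ring
  rw [h5] at h4
  rw [mul_comm, h4]
  change ((-q ^ 2)⁻¹) ^ S.card - _ = (-q ^ 2) ^ S.card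
  ring

end Abstract

/-! ### Quantum minors on the first rows -/

/-- The entries of the `k`-th row, extended by zero. -/
def zrow {n : ℕ} (k : ℕ) (j : Fin n) : O n := if h : k < n then Z ⟨k, h⟩ j else 0

theorem zrow_row {n : ℕ} (k : ℕ) (j l : Fin n) (h : j < l) :
    zrow k j * zrow k l = q ^ 2 • (zrow k l * zrow k j) := by
  unfold zrow
  split_ifs
  · exact Z_row _ _ _ h
  · simp

theorem rowExchange_zrow {n k r : ℕ} (hkr : k < r) :
    RowExchange (1 : K) (zrow (n := n) k) (zrow r) := by
  have hq := q_ne_zero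
  unfold zrow
  by_cases hr : r < n
  · have hk : k < n := hkr.trans hr
    have hlt : (⟨k, hk⟩ : Fin n) < ⟨r, hr⟩ := hkr
    simp only [hr, hk, dif_pos]
    constructor
    · intro s j h
      rw [one_smul]
      exact Z_anti _ _ _ _ hlt h
    · intro s
      rw [Z_col _ _ s hlt, smul_smul, one_mul, ← mul_pow, inv_mul_cancel₀ hq, one_pow, one_smul]
    · intro s j h
      rw [one_smul, Z_diag _ _ _ _ hlt h, add_sub_cancel_right]
  · simp only [hr, dif_neg, not_false_eq_true]
    constructor <;> simp

/-- A row also exchanges with itself in the abstract sense, with scalar `q²`. The expansion lemmas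
then cover entries of the last row of a minor without a separate argument. -/
theorem rowExchange_zrow_self {n : ℕ} (k : ℕ) :
    RowExchange (q ^ 2) (zrow (n := n) k) (zrow k) where
  lt s j h := zrow_row k s j h
  same s := by
    have hq := q_ne_zero
    rw [← mul_pow, mul_inv_cancel₀ hq, one_pow, one_smul]
  gt s j h := by
    have hq := q_ne_zero
    rw [zrow_row k j s h]
    match_scalars
    field_simp
    ring

/-- The quantum minor on the first `k` rows and on the columns in `J`. -/
def minor {n : ℕ} : ℕ → Finset (Fin n) → O n
  | 0 => fun J => if J = ∅ then 1 else 0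
  | k + 1 => expand (minor k) (zrow k)

theorem minorExchange_minor {n : ℕ} (k r : ℕ) (h : k ≤ r) :
    MinorExchange (1 : K) (minor (n := n) k) (zrow r) := by
  induction k with
  | zero => exact minorExchange_base _
  | succ k ih => exact (ih (by omega)).expand (rowExchange_zrow h)

theorem minorExchange_minor_last {n : ℕ} (k : ℕ) :
    MinorExchange (q ^ 2) (minor (n := n) (k + 1)) (zrow k) :=
  (minorExchange_minor k k le_rfl).expand (rowExchange_zrow_self k)

theorem zrow_mul_minor_of_lt {n : ℕ} (k : ℕ) {J : Finset (Fin n)} {s : Fin n}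
    (hs : ∀ p ∈ J, p < s) :
    zrow k s * minor (k + 1) J = (q⁻¹) ^ 2 • (minor (k + 1) J * zrow k s) :=
  mul_eq_of_lt (minorExchange_minor_last k) (fun J => expand_expand_eq_zero (zrow_row k) J) hs

theorem bar_zrow {n : ℕ} (k : ℕ) (j : Fin n) : bar (zrow k j) = zrow k j := by
  unfold zrow
  split_ifs
  · exact bar_Z _ _
  · exact bar_zero n

/-- Bar turns the expansion with entries on the right into the one with entries on the left and
inverse coefficients; `expand_eq` identifies the two. -/
theorem bar_minor {n : ℕ} (k : ℕ) (J : Finset (Fin n)) : bar (minor k J) = minor k J := by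
  induction k generalizing J with
  | zero =>
    unfold minor
    split_ifs
    · simp [bar]
    · exact bar_zero n
  | succ k ih =>
    have h := expand_eq (minorExchange_minor (n := n) k k le_rfl) J
    change _ = minor (k + 1) J at h
    rw [← h]
    conv_lhs => rw [h]
    change bar (expand _ _ _) = _
    unfold expand
    rw [bar_sum]
    refine Finset.sum_congr rfl fun j _ => ?_
    rw [bar_smul, bar_mul, bar_zrow, ih]
    congr 1
    rw [map_pow, map_neg, map_pow, barK_q, inv_neg, inv_pow]

/-- The number of inversions of a function. -/
def inversions {k n : ℕ} (f : Fin k → Fin n) : ℕ :=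
  (Finset.univ.filter fun p : Fin k × Fin k => p.1 < p.2 ∧ f p.2 < f p.1).card

theorem inversions_snoc {k n : ℕ} (f : Fin k → Fin n) (j : Fin n) (hf : Function.Injective f) :
    inversions (Fin.snoc (α := fun _ => Fin n) f j) =
      inversions f + above (Finset.univ.image f) j := by
  have h1 : above (Finset.univ.image f) j = (Finset.univ.filter fun i => j < f i).card := by
    unfold above
    rw [Finset.filter_image, Finset.card_image_of_injective _ hf]
  rw [h1]
  unfold inversions
  simp only [Finset.card_filter, Fintype.sum_prod_type, Fin.sum_univ_castSucc, Fin.snoc_castSucc,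
    Fin.snoc_last, Fin.castSucc_lt_castSucc_iff, Fin.castSucc_lt_last, true_and,
    Finset.sum_add_distrib, not_lt_of_gt (Fin.castSucc_lt_last _), false_and, if_false,
    Finset.sum_const_zero, lt_irrefl, add_zero]

/-- Splitting off the column used by the last row turns the recursive definition into the
permutation formula; the exponent `above J j` counts the inversions that this row adds. -/
theorem minor_eq_sum {n : ℕ} (k : ℕ) (J : Finset (Fin n)) :
    minor k J = ∑ f : Fin k → Fin n, if Function.Injective f ∧ Finset.univ.image f = J then
      (-q ^ 2) ^ inversions f • (List.ofFn fun i => zrow i (f i)).prod else 0 := by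
  induction k generalizing J with
  | zero =>
    rw [Fintype.sum_unique]
    have h1 : Function.Injective (default : Fin 0 → Fin n) := fun i => i.elim0
    simp [minor, h1, inversions, eq_comm]
  | succ k ih =>
    rw [← (Fin.snocEquiv fun _ => Fin n).sum_comp, Fintype.sum_prod_type]
    change expand (minor k) (zrow k) J = _
    unfold expand
    rw [← Finset.sum_subset (Finset.subset_univ J)]
    · refine Finset.sum_congr rfl fun j hj => ?_
      rw [ih, Finset.sum_mul, Finset.smul_sum]
      refine Finset.sum_congr rfl fun f _ => ?_
      change _ = if Function.Injective (Fin.snoc (α := fun _ => Fin n) f j) ∧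
        Finset.univ.image (Fin.snoc (α := fun _ => Fin n) f j) = J then
        (-q ^ 2) ^ inversions (Fin.snoc (α := fun _ => Fin n) f j) •
          (List.ofFn fun i => zrow i (Fin.snoc (α := fun _ => Fin n) f j i)).prod else 0
      have hiff : (Function.Injective (Fin.snoc (α := fun _ => Fin n) f j) ∧
          Finset.univ.image (Fin.snoc (α := fun _ => Fin n) f j) = J) ↔
          (Function.Injective f ∧ Finset.univ.image f = J.erase j) := by
        have himg : Finset.univ.image (Fin.snoc (α := fun _ => Fin n) f j) =
            insert j (Finset.univ.image f) := by
          ext l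
          simp only [Finset.mem_image, Finset.mem_univ, true_and, Finset.mem_insert]
          constructor
          · rintro ⟨i, rfl⟩
            induction i using Fin.lastCases with
            | last => left; simp
            | cast i => right; exact ⟨i, by simp⟩
          · rintro (rfl | ⟨i, rfl⟩)
            · exact ⟨Fin.last k, by simp⟩
            · exact ⟨i.castSucc, by simp⟩
        have hinj : Function.Injective (Fin.snoc (α := fun _ => Fin n) f j) ↔
            Function.Injective f ∧ j ∉ Finset.univ.image f := by
          rw [Fin.snoc_injective_iff]
          simp
        rw [himg, hinj]
        constructor
        · rintro ⟨⟨h1, h2⟩, rfl⟩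
          exact ⟨h1, (Finset.erase_insert h2).symm⟩
        · rintro ⟨h1, h2⟩
          rw [h2]
          exact ⟨⟨h1, Finset.notMem_erase j J⟩, Finset.insert_erase hj⟩
      by_cases h : Function.Injective f ∧ Finset.univ.image f = J.erase j
      · rw [if_pos h, if_pos (hiff.mpr h), inversions_snoc f j h.1, h.2, List.ofFn_succ',
          List.concat_eq_append, List.prod_append]
        have e := above_erase hj j
        rw [if_neg (lt_irrefl j), add_zero] at e
        simp only [Fin.snoc_castSucc, Fin.snoc_last, List.prod_singleton, Fin.val_castSucc,
          Fin.val_last]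
        rw [smul_mul_assoc, smul_smul, ← pow_add, e, add_comm]
      · rw [if_neg h, if_neg (fun h' => h (hiff.mp h')), zero_mul, smul_zero]
    · intro j _ hj
      refine Finset.sum_eq_zero fun f _ => if_neg ?_
      rintro ⟨-, h⟩
      apply hj
      rw [← h]
      exact Finset.mem_image.mpr ⟨Fin.last k, Finset.mem_univ _, by simp [Fin.snocEquiv]⟩

theorem detq_eq_minor (n : ℕ) : detq n = minor n Finset.univ := by
  rw [minor_eq_sum, ← Finset.sum_filter]
  unfold detq
  refine Finset.sum_bij (fun σ _ => (σ : Fin n → Fin n)) ?_ ?_ ?_ ?_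
  · intro σ _
    simp only [Finset.mem_filter, Finset.mem_univ, true_and]
    exact ⟨σ.injective, Finset.image_univ_of_surjective σ.surjective⟩
  · intro σ _ τ _ h
    exact DFunLike.coe_injective h
  · intro f hf
    have hf := (Finset.mem_filter.mp hf).2.1
    exact ⟨Equiv.ofBijective f (Finite.injective_iff_bijective.mp hf), Finset.mem_univ _, rfl⟩
  · intro σ _
    have h : (fun i : Fin n => zrow (n := n) i (σ i)) = fun i => Z i (σ i) := by
      funext i
      simp [zrow]
    rw [h]
    rfl

theorem bar_detq (n : ℕ) : bar (detq n) = detq n := by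
  rw [detq_eq_minor, bar_minor]

/-! ### Products of the entries of a row -/

section RowProducts

variable {B : Type*} [Ring B]

/-- The ordered product of powers of the entries of a row. -/
def rowProd {m : ℕ} (y : Fin m → B) (a : Fin m → ℕ) : B := (List.ofFn fun j => y j ^ a j).prod

theorem rowProd_succ {m : ℕ} (y : Fin (m + 1) → B) (a : Fin (m + 1) → ℕ) :
    rowProd y a = y 0 ^ a 0 * rowProd (fun j => y j.succ) (fun j => a j.succ) := by
  simp [rowProd, List.ofFn_succ]

variable [Algebra K B]

theorem mul_pow_of_mul_eq_smul {x y : B} {c : K} (h : x * y = c • (y * x)) (k : ℕ) :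
    x * y ^ k = c ^ k • (y ^ k * x) := by
  induction k with
  | zero => simp
  | succ k ih =>
    rw [pow_succ, ← mul_assoc, ih, smul_mul_assoc, mul_assoc, h, mul_smul_comm, smul_smul,
      mul_assoc, pow_succ]

theorem pow_mul_of_mul_eq_smul {x y : B} {c : K} (h : x * y = c • (y * x)) (k : ℕ) :
    x ^ k * y = c ^ k • (y * x ^ k) := by
  induction k with
  | zero => simp
  | succ k ih =>
    rw [pow_succ, mul_assoc, h, mul_smul_comm, ← mul_assoc, ih, smul_mul_assoc, smul_smul,
      mul_assoc, pow_succ, mul_comm (c ^ k)]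

theorem rowProd_mul {m : ℕ} {y : Fin m → B} {F : B} {c : Fin m → K}
    (h : ∀ s, y s * F = c s • (F * y s)) (a : Fin m → ℕ) :
    rowProd y a * F = (∏ s, c s ^ a s) • (F * rowProd y a) := by
  induction m with
  | zero => simp [rowProd]
  | succ m ih =>
    rw [rowProd_succ, mul_assoc, ih (fun s => h s.succ), mul_smul_comm, ← mul_assoc,
      pow_mul_of_mul_eq_smul (h 0), Fin.prod_univ_succ, smul_mul_assoc, smul_smul, mul_assoc,
      mul_comm (c 0 ^ a 0)]

theorem mul_rowProd {m : ℕ} {y : Fin m → B}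
    (hy : ∀ j l, j < l → y j * y l = q ^ 2 • (y l * y j)) (a : Fin m → ℕ) (i : Fin m) :
    y i * rowProd y a = (q⁻¹) ^ (2 * ∑ l, if l < i then a l else 0) •
      rowProd y (a + Pi.single i 1) := by
  induction m with
  | zero => exact i.elim0
  | succ m ih =>
    rw [rowProd_succ, rowProd_succ]
    induction i using Fin.cases with
    | zero =>
      have h1 : (fun j : Fin m => (a + Pi.single 0 1 : Fin (m + 1) → ℕ) j.succ) = fun j => a j.succ := by
        funext j
        simp
      rw [h1]
      simp only [Fin.not_lt_zero, if_false, Finset.sum_const_zero, mul_zero, pow_zero, one_smul,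
        Pi.add_apply, Pi.single_eq_same]
      rw [← mul_assoc, pow_succ']
    | succ i =>
      have h1 : (fun j : Fin m => (a + Pi.single i.succ 1 : Fin (m + 1) → ℕ) j.succ) =
          (fun j => a j.succ) + Pi.single i 1 := by
        funext j
        simp [Pi.single_apply]
      have h2 : y i.succ * y 0 = (q⁻¹) ^ 2 • (y 0 * y i.succ) := by
        rw [hy 0 i.succ (Fin.succ_pos i), smul_smul, ← mul_pow, inv_mul_cancel₀ q_ne_zero,
          one_pow, one_smul]
      rw [h1, ← mul_assoc, mul_pow_of_mul_eq_smul h2, smul_mul_assoc, mul_assoc,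
        ih (fun j l h => hy _ _ (Fin.succ_lt_succ_iff.mpr h)) (fun j => a j.succ) i,
        mul_smul_comm, smul_smul, Fin.sum_univ_succ, ← pow_mul, ← pow_add]
      simp [Fin.succ_lt_succ_iff, mul_add]

theorem esymmTwo_add_single {m : ℕ} (a : Fin m → ℕ) (i : Fin m) :
    esymmTwo (a + Pi.single i 1) + a i = esymmTwo a + ∑ l, a l := by
  have h1 := two_mul_esymmTwo (a + Pi.single i 1)
  have h2 := two_mul_esymmTwo a
  have h3 : (∑ l, (((a + Pi.single i 1 : Fin m → ℕ) l : ℕ) : ℤ)) = (∑ l, (a l : ℤ)) + 1 := by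
    simp [Finset.sum_add_distrib, Pi.single_apply]
  have h4 : (∑ l, (((a + Pi.single i 1 : Fin m → ℕ) l : ℕ) : ℤ) ^ 2) =
      (∑ l, (a l : ℤ) ^ 2) + 2 * a i + 1 := by
    have : ∀ l, (((a + Pi.single i 1 : Fin m → ℕ) l : ℕ) : ℤ) ^ 2 =
        (a l : ℤ) ^ 2 + if l = i then 2 * (a l : ℤ) + 1 else 0 := by
      intro l
      by_cases h : l = i
      · subst h
        simp
        ring
      · simp [h]
    simp only [this, Finset.sum_add_distrib, Finset.sum_ite_eq', Finset.mem_univ, if_true]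
    ring
  rw [h3, h4] at h1
  zify
  linarith

/-- The product of powers of the entries of a row in the order of decreasing columns. -/
def rowDesc {m : ℕ} (y : Fin m → B) (a : Fin m → ℕ) : B :=
  (q⁻¹) ^ (2 * esymmTwo a) • rowProd y a

theorem rowDesc_zero {m : ℕ} (y : Fin m → B) : rowDesc y 0 = 1 := by
  have h := two_mul_esymmTwo (0 : Fin m → ℕ)
  have h' : esymmTwo (0 : Fin m → ℕ) = 0 := by
    simp at h
    exact_mod_cast h
  simp [rowDesc, h', rowProd]

/-- In the decreasing order `y i` only has to pass entries of larger columns, each giving `q²`. The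
coefficient is thus a nonnegative power of `q`, which keeps the lattice arguments over `ℤ[q]`. -/
theorem mul_rowDesc {m : ℕ} {y : Fin m → B}
    (hy : ∀ j l, j < l → y j * y l = q ^ 2 • (y l * y j)) (a : Fin m → ℕ) (i : Fin m) :
    y i * rowDesc y a = q ^ (2 * ∑ l, if i < l then a l else 0) •
      rowDesc y (a + Pi.single i 1) := by
  have h1 := esymmTwo_add_single a i
  have h2 : ∑ l, a l = (∑ l, if l < i then a l else 0) + a i + ∑ l, if i < l then a l else 0 := by
    have : ∀ l, a l = (if l < i then a l else 0) + (if l = i then a l else 0) +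
        if i < l then a l else 0 := by
      intro l
      rcases lt_trichotomy l i with h | h | h
      · simp [h, h.ne, h.not_gt]
      · simp [h]
      · simp [h, h.ne', h.not_gt]
    rw [Finset.sum_congr rfl fun l _ => this l, Finset.sum_add_distrib, Finset.sum_add_distrib]
    simp
  have h3 : esymmTwo (a + Pi.single i 1) = esymmTwo a + (∑ l, if l < i then a l else 0) +
      ∑ l, if i < l then a l else 0 := by omega
  unfold rowDesc
  rw [mul_smul_comm, mul_rowProd hy, smul_smul, smul_smul, h3]
  congr 1
  have hq := q_ne_zero
  rw [← pow_add, ← zpow_natCast, ← zpow_natCast, ← zpow_natCast, inv_zpow', inv_zpow',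
    ← zpow_add₀ hq]
  congr 1
  push_cast
  ring

theorem rowDesc_mul {m : ℕ} {y : Fin m → B} {F : B} {c : Fin m → K}
    (h : ∀ s, y s * F = c s • (F * y s)) (a : Fin m → ℕ) :
    rowDesc y a * F = (∏ s, c s ^ a s) • (F * rowDesc y a) := by
  unfold rowDesc
  rw [smul_mul_assoc, rowProd_mul h, mul_smul_comm, smul_comm]

/-- The indicator function of a finite set. -/
def ind {m : ℕ} (J : Finset (Fin m)) (j : Fin m) : ℕ := if j ∈ J then 1 else 0

theorem ind_erase {m : ℕ} {J : Finset (Fin m)} {j : Fin m} (h : j ∈ J) :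
    ind (J.erase j) + Pi.single j 1 = ind J := by
  funext l
  by_cases hl : l = j
  · subst hl; simp [ind, h]
  · simp [ind, hl]

theorem ind_insert {m : ℕ} {J : Finset (Fin m)} {j : Fin m} (h : j ∉ J) :
    ind (insert j J) = ind J + Pi.single j 1 := by
  funext l
  by_cases hl : l = j
  · subst hl; simp [ind, h]
  · simp [ind, hl]

theorem smul_mem_of_mem_Zq {M : Submodule Zq B} {c : K} (hc : c ∈ Zq) {x : B} (hx : x ∈ M) :
    c • x ∈ M := M.smul_mem ⟨c, hc⟩ hx

theorem linearMap_mem_of_mem_span {C : Type*} [Ring C] [Algebra K C] {s : Set B}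
    {M : Submodule Zq C} (T : B →ₗ[K] C) (h : ∀ y ∈ s, T y ∈ M) {x : B}
    (hx : x ∈ Submodule.span Zq s) : T x ∈ M := by
  induction hx using Submodule.span_induction with
  | mem x hx => exact h x hx
  | zero => rw [map_zero]; exact M.zero_mem
  | add x y _ _ hx hy => rw [map_add]; exact M.add_mem hx hy
  | smul c x _ hx =>
    have : T (c • x) = (c : K) • T x := T.map_smul (c : K) x
    rw [this]
    exact smul_mem_of_mem_Zq c.2 hx

theorem neg_q_sq_pow_mem (k : ℕ) : (-q ^ 2) ^ k ∈ Zq :=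
  pow_mem (neg_mem (pow_mem q_mem_Zq 2)) k

/-- The `ℤ[q]`-span of the products `f J * D(a)` of given size and weight. -/
def minorRowSpan {m : ℕ} (f : Finset (Fin m) → B) (y : Fin m → B) (r : ℕ) (b : Fin m → ℕ) :
    Submodule Zq B :=
  Submodule.span Zq {x | ∃ J a, J.card = r ∧ a + ind J = b ∧ x = f J * rowDesc y a}

/-- With scalar `q²` the exchange coefficients are `1`, `q²` and `q⁴ - 1` times powers of `-q²`, all
in `ℤ[q]`. -/
theorem mul_mem_minorRowSpan {m : ℕ} {f : Finset (Fin m) → B} {y : Fin m → B}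
    (hy : ∀ j l, j < l → y j * y l = q ^ 2 • (y l * y j))
    (hf : MinorExchange (q ^ 2) f y) {r : ℕ} {b : Fin m → ℕ} (i : Fin m) {x : B}
    (hx : x ∈ minorRowSpan f y r b) : y i * x ∈ minorRowSpan f y r (b + Pi.single i 1) := by
  have hq := q_ne_zero
  have key : ∀ (J : Finset (Fin m)) (a : Fin m → ℕ) (p : Fin m), J.card = r →
      a + ind J + Pi.single p 1 = b + Pi.single i 1 →
      f J * (y p * rowDesc y a) ∈ minorRowSpan f y r (b + Pi.single i 1) := by
    intro J a p hJ h
    rw [mul_rowDesc hy, mul_smul_comm]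
    refine smul_mem_of_mem_Zq (pow_mem q_mem_Zq _) (Submodule.subset_span ⟨J, _, hJ, ?_, rfl⟩)
    rw [← h]
    abel
  refine linearMap_mem_of_mem_span (LinearMap.mulLeft K (y i)) ?_ hx
  rintro _ ⟨J, a, hJ, h, rfl⟩
  rw [LinearMap.mulLeft_apply, ← mul_assoc]
  by_cases hi : i ∈ J
  · rw [hf.mem J i hi, ← mul_pow, mul_inv_cancel₀ hq, one_pow, one_smul, mul_assoc]
    exact key J a i hJ (by rw [h])
  · have e : q ^ 2 * (q ^ 2 - (q⁻¹) ^ 2) = q ^ 4 - 1 := by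
      field_simp
    rw [hf.notMem J i hi, smul_sub, smul_smul, e, sub_mul, smul_mul_assoc, smul_mul_assoc,
      Finset.sum_mul, mul_assoc]
    refine sub_mem (smul_mem_of_mem_Zq (pow_mem q_mem_Zq _) (key J a i hJ (by rw [h])))
      (smul_mem_of_mem_Zq (sub_mem (pow_mem q_mem_Zq _) (one_mem _)) (sum_mem fun p hp => ?_))
    have hp := (Finset.mem_filter.mp hp).1
    have hi' : i ∉ J.erase p := fun h => hi (Finset.mem_of_mem_erase h)
    rw [smul_mul_assoc, mul_assoc]
    refine smul_mem_of_mem_Zq (neg_q_sq_pow_mem _) (key _ a p ?_ ?_)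
    · rw [Finset.card_insert_of_notMem hi', Finset.card_erase_of_mem hp, hJ]
      have := Finset.card_pos.mpr ⟨p, hp⟩
      omega
    · rw [ind_insert hi', ← h, ← ind_erase hp]
      abel

theorem rowDesc_mul_mem_minorRowSpan {m : ℕ} {f : Finset (Fin m) → B} {y : Fin m → B}
    (hy : ∀ j l, j < l → y j * y l = q ^ 2 • (y l * y j))
    (hf : MinorExchange (q ^ 2) f y) (a : Fin m → ℕ) (J : Finset (Fin m)) :
    rowDesc y a * f J ∈ minorRowSpan f y J.card (a + ind J) := by
  obtain ⟨N, hN⟩ : ∃ N, ∑ j, a j = N := ⟨_, rfl⟩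
  induction N generalizing a with
  | zero =>
    have ha : a = 0 := by
      funext j
      exact Finset.sum_eq_zero_iff.mp hN j (Finset.mem_univ j)
    subst ha
    refine Submodule.subset_span ⟨J, 0, rfl, rfl, ?_⟩
    rw [rowDesc_zero, one_mul, mul_one]
  | succ N ih =>
    have hne : (Finset.univ.filter fun j => a j ≠ 0).Nonempty := by
      rw [Finset.nonempty_iff_ne_empty]
      intro h
      rw [Finset.filter_eq_empty_iff] at h
      rw [Finset.sum_eq_zero fun j hj => not_not.mp (h hj)] at hN
      omega
    -- The largest column present is the leftmost factor of `rowDesc`, so it splits off with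
    -- coefficient 1.
    obtain ⟨i, hi, hmax⟩ := Finset.exists_max_image _ id hne
    have hi := (Finset.mem_filter.mp hi).2
    obtain ⟨a', rfl⟩ : ∃ a' : Fin m → ℕ, a = a' + Pi.single i 1 := by
      refine ⟨fun l => a l - (Pi.single i 1 : Fin m → ℕ) l, ?_⟩
      funext l
      rw [Pi.add_apply]
      by_cases hl : l = i
      · subst hl
        rw [Pi.single_eq_same]
        omega
      · simp [hl]
    have h0 : ∑ l, (if i < l then a' l else 0) = 0 := by
      refine Finset.sum_eq_zero fun l _ => ?_
      split_ifs with h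
      · by_contra h1
        refine absurd (hmax l (Finset.mem_filter.mpr ⟨Finset.mem_univ _, ?_⟩)) (not_le.mpr h)
        simp [h1]
      · rfl
    have h1 := mul_rowDesc hy a' i
    rw [h0, mul_zero, pow_zero, one_smul] at h1
    rw [← h1, mul_assoc, add_right_comm]
    refine mul_mem_minorRowSpan hy hf i (ih a' ?_)
    simp only [Pi.add_apply, Finset.sum_add_distrib, Finset.sum_pi_single', Finset.mem_univ,
      if_true] at hN
    omega

end RowProducts

/-! ### Multiplying row monomials by minors inside the lattice -/

section Tower

variable {B : Type*} [Ring B] [Algebra K B] {n : ℕ}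

/-- The sums of the columns of the first `k` rows. -/
def colSum (k : ℕ) (A : ℕ → Fin n → ℕ) (j : Fin n) : ℕ := ∑ i ∈ Finset.range k, A i j

theorem colSum_zero (A : ℕ → Fin n → ℕ) : colSum 0 A = 0 := by
  funext j
  simp [colSum]

theorem colSum_succ (k : ℕ) (A : ℕ → Fin n → ℕ) : colSum (k + 1) A = colSum k A + A k := by
  funext j
  simp [colSum, Finset.sum_range_succ]

theorem colSum_congr {k : ℕ} {A A' : ℕ → Fin n → ℕ} (h : ∀ i < k, A i = A' i) :
    colSum k A = colSum k A' := by
  funext j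
  exact Finset.sum_congr rfl fun i hi => by rw [h i (Finset.mem_range.mp hi)]

/-- The normalized monomial in the first `k` rows. -/
def rowsZN (Y : ℕ → Fin n → B) : ℕ → (ℕ → Fin n → ℕ) → B
  | 0, _ => 1
  | k + 1, A => q ^ ((esymmTwo (A k) : ℤ) - ∑ j, (colSum k A j : ℤ) * A k j) •
      (rowsZN Y k A * rowDesc (Y k) (A k))

theorem rowsZN_congr (Y : ℕ → Fin n → B) {k : ℕ} {A A' : ℕ → Fin n → ℕ}
    (h : ∀ i < k, A i = A' i) : rowsZN Y k A = rowsZN Y k A' := by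
  induction k with
  | zero => rfl
  | succ k ih =>
    have h' : ∀ i < k, A i = A' i := fun i hi => h i (by omega)
    simp only [rowsZN, ih h', colSum_congr h', h k (Nat.lt_succ_self k)]

theorem rowsZN_update (Y : ℕ → Fin n → B) (k : ℕ) (A : ℕ → Fin n → ℕ) (a : Fin n → ℕ) :
    rowsZN Y (k + 1) (Function.update A k a) =
      q ^ ((esymmTwo a : ℤ) - ∑ j, (colSum k A j : ℤ) * a j) •
        (rowsZN Y k A * rowDesc (Y k) a) := by
  have h : ∀ i < k, Function.update A k a i = A i := fun i hi =>
    Function.update_of_ne hi.ne _ _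
  simp only [rowsZN, rowsZN_congr Y h, colSum_congr h, Function.update_self]

/-- The `ℤ[q]`-span of the normalized monomials in the first `k` rows with column sums `c`. -/
def rowsLattice (Y : ℕ → Fin n → B) (k : ℕ) (c : Fin n → ℕ) : Submodule Zq B :=
  Submodule.span Zq {x | ∃ A, colSum k A = c ∧ x = rowsZN Y k A}

/-- A sequence of rows `Y` with the minors `f k` on the first `k` rows. -/
structure MinorTower (Y : ℕ → Fin n → B) (f : ℕ → Finset (Fin n) → B) : Prop where
  zero (J : Finset (Fin n)) : f 0 J = if J = ∅ then 1 else 0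
  succ (k : ℕ) (J : Finset (Fin n)) : f (k + 1) J = expand (f k) (Y k) J
  row (k : ℕ) (j l : Fin n) (h : j < l) : Y k j * Y k l = q ^ 2 • (Y k l * Y k j)
  exchange (k : ℕ) : MinorExchange (q ^ 2) (f (k + 1)) (Y k)
  exchange_of_lt (k : ℕ) (J : Finset (Fin n)) (s : Fin n) (hs : ∀ p ∈ J, p < s) :
    Y k s * f (k + 1) J = (q⁻¹) ^ 2 • (f (k + 1) J * Y k s)

/-- The weight `∑ (1 - ind J j) * colSum j` in the induction is chosen so that this balance is
exact: the step from `k` to `k + 1` rows leaves precisely the normalizing exponent of the new row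
`a'` over column sums `c + ind S`. -/
theorem exchange_exponent {c a a' : Fin n → ℕ} {S J : Finset (Fin n)}
    (hJ : J.card = S.card + 1) (h : a' + ind S = a + ind J) :
    (∑ j, (1 - ind J j : ℤ) * (c j + a j)) + ((esymmTwo a : ℤ) - ∑ j, (c j : ℤ) * a j) -
      ∑ j, (1 - ind S j : ℤ) * c j =
    (esymmTwo a' : ℤ) - ∑ j, ((c + ind S : Fin n → ℕ) j : ℤ) * a' j := by
  have h1 := two_mul_esymmTwo a
  have h2 := two_mul_esymmTwo a'
  have hcard : ∀ S : Finset (Fin n), ∑ j, (ind S j : ℤ) = S.card := by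
    intro S
    simp [ind]
  have hpt : ∀ j, (a' j : ℤ) = a j + ind J j - ind S j := by
    intro j
    have := congrFun h j
    simp only [Pi.add_apply] at this
    omega
  have hsum : ∑ j, (a' j : ℤ) = (∑ j, (a j : ℤ)) + 1 := by
    simp only [hpt, Finset.sum_add_distrib, Finset.sum_sub_distrib, hcard]
    rw [hJ]
    push_cast
    ring
  have hone : ∑ j, ((ind J j : ℤ) - ind S j) = 1 := by
    rw [Finset.sum_sub_distrib, hcard, hcard, hJ]
    push_cast
    ring
  have hind : ∀ (S : Finset (Fin n)) j, (ind S j : ℤ) ^ 2 = ind S j := by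
    intro S j
    unfold ind
    split_ifs <;> simp
  -- After doubling, the identity holds column by column, using that indicators are idempotent; the
  -- global terms enter only through `∑ a' = ∑ a + 1`.
  have key : ∑ j, (2 * ((1 - ind J j : ℤ) * (c j + a j)) - 2 * ((c j : ℤ) * a j) -
      2 * ((1 - ind S j : ℤ) * c j) - (a j : ℤ) ^ 2 - 2 * a j - ((ind J j : ℤ) - ind S j) +
      (a' j : ℤ) ^ 2 + 2 * (((c + ind S : Fin n → ℕ) j : ℤ) * a' j)) = 0 := by
    refine Finset.sum_eq_zero fun j _ => ?_
    rw [hpt]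
    have e1 := hind J j
    have e2 := hind S j
    simp only [Pi.add_apply, Nat.cast_add]
    linear_combination e1 - e2
  simp only [Finset.sum_add_distrib, Finset.sum_sub_distrib, ← Finset.mul_sum] at key
  rw [Finset.sum_sub_distrib] at hone
  rw [hsum] at h2
  refine mul_left_cancel₀ (two_ne_zero (α := ℤ)) ?_
  linear_combination key + h1 - h2 + hone

/-- Right multiplication by a row monomial, up to a power of `q`. -/
def mulRow (E : ℤ) (v : B) : B →ₗ[K] B := q ^ E • LinearMap.mulRight K v

theorem mulRow_apply (E : ℤ) (v x : B) : mulRow E v x = q ^ E • (x * v) := rfl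

variable {Y : ℕ → Fin n → B} {f : ℕ → Finset (Fin n) → B}

theorem mulRow_rowsZN {k : ℕ} {c a a' : Fin n → ℕ} {S J : Finset (Fin n)}
    (hJ : J.card = S.card + 1) (h : a' + ind S = a + ind J) {A : ℕ → Fin n → ℕ}
    (hA : colSum k A = c + ind S) :
    mulRow ((∑ j, (1 - ind J j : ℤ) * (c j + a j)) +
      ((esymmTwo a : ℤ) - ∑ j, (c j : ℤ) * a j) - ∑ j, (1 - ind S j : ℤ) * c j)
      (rowDesc (Y k) a') (rowsZN Y k A) = rowsZN Y (k + 1) (Function.update A k a') := by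
  rw [mulRow_apply, rowsZN_update, exchange_exponent hJ h, hA]

theorem mulRow_mem {k : ℕ} {c a a' : Fin n → ℕ} {S J : Finset (Fin n)}
    (hJ : J.card = S.card + 1) (h : a' + ind S = a + ind J) {x : B}
    (hx : x ∈ rowsLattice Y k (c + ind S)) :
    mulRow ((∑ j, (1 - ind J j : ℤ) * (c j + a j)) +
      ((esymmTwo a : ℤ) - ∑ j, (c j : ℤ) * a j) - ∑ j, (1 - ind S j : ℤ) * c j)
      (rowDesc (Y k) a') x ∈ rowsLattice Y (k + 1) (c + a + ind J) := by
  refine linearMap_mem_of_mem_span _ ?_ hx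
  rintro _ ⟨A, hA, rfl⟩
  rw [mulRow_rowsZN hJ h hA]
  refine Submodule.subset_span ⟨_, ?_, rfl⟩
  rw [colSum_succ, Function.update_self,
    colSum_congr (fun i hi => Function.update_of_ne (ne_of_lt hi) _ _), hA, add_assoc,
    add_comm (ind S), h, add_assoc]

theorem mulRow_minor {k : ℕ} {c a : Fin n → ℕ} (a' : Fin n → ℕ) (S J : Finset (Fin n)) (x : B) :
    mulRow ((∑ j, (1 - ind J j : ℤ) * (c j + a j)) +
      ((esymmTwo a : ℤ) - ∑ j, (c j : ℤ) * a j) - ∑ j, (1 - ind S j : ℤ) * c j)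
      (rowDesc (Y k) a') (q ^ (∑ j, (1 - ind S j : ℤ) * c j) • (x * f k S)) =
    q ^ ((∑ j, (1 - ind J j : ℤ) * (c j + a j)) +
      ((esymmTwo a : ℤ) - ∑ j, (c j : ℤ) * a j)) • (x * (f k S * rowDesc (Y k) a')) := by
  rw [mulRow_apply, smul_mul_assoc, smul_smul, ← zpow_add₀ q_ne_zero, sub_add_cancel, mul_assoc]

theorem MinorTower.mul_rowDesc (hf : MinorTower Y f) (k : ℕ) (J : Finset (Fin n))
    (a : Fin n → ℕ) :
    f (k + 1) J * rowDesc (Y k) a = ∑ i ∈ J, ((-q ^ 2) ^ above J i *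
      q ^ (2 * ∑ l, if i < l then a l else 0)) •
        (f k (J.erase i) * rowDesc (Y k) (a + Pi.single i 1)) := by
  rw [hf.succ, expand, Finset.sum_mul]
  refine Finset.sum_congr rfl fun i _ => ?_
  rw [smul_mul_assoc, mul_assoc, QuantumMatrix.mul_rowDesc (hf.row k), mul_smul_comm, smul_smul]

theorem rowsZN_succ_mul (k : ℕ) (A : ℕ → Fin n → ℕ) (J : Finset (Fin n)) (x : B) :
    q ^ (∑ j, (1 - ind J j : ℤ) * colSum (k + 1) A j) • (rowsZN Y (k + 1) A * x) =
    q ^ ((∑ j, (1 - ind J j : ℤ) * (colSum k A j + A k j)) +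
      ((esymmTwo (A k) : ℤ) - ∑ j, (colSum k A j : ℤ) * A k j)) •
      (rowsZN Y k A * (rowDesc (Y k) (A k) * x)) := by
  rw [rowsZN, smul_mul_assoc, smul_smul, ← zpow_add₀ q_ne_zero, mul_assoc, colSum_succ]
  simp only [Pi.add_apply, Nat.cast_add]

/-- Induction on rows: the last row monomial is moved to the right of the minor, the resulting
minors are expanded along that row, and the smaller minors are absorbed by the rows above. All
coefficients met on the way lie in `ℤ[q]`. -/
theorem MinorTower.rowsZN_mul_mem (hf : MinorTower Y f) (k : ℕ) (A : ℕ → Fin n → ℕ)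
    (J : Finset (Fin n)) (hJ : J.card = k) :
    q ^ (∑ j, (1 - ind J j : ℤ) * colSum k A j) • (rowsZN Y k A * f k J) ∈
      rowsLattice Y k (colSum k A + ind J) := by
  induction k generalizing J with
  | zero =>
    obtain rfl := Finset.card_eq_zero.mp hJ
    have h : ∀ j : Fin n, colSum 0 A j = 0 := fun j => by rw [colSum_zero]; rfl
    simp only [h, Nat.cast_zero, mul_zero, Finset.sum_const_zero, zpow_zero, one_smul]
    rw [hf.zero, if_pos rfl, mul_one]
    refine Submodule.subset_span ⟨A, ?_, rfl⟩
    funext j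
    simp [ind]
  | succ k ih =>
    rw [rowsZN_succ_mul, colSum_succ]
    set E := (∑ j, (1 - ind J j : ℤ) * (colSum k A j + A k j)) +
      ((esymmTwo (A k) : ℤ) - ∑ j, (colSum k A j : ℤ) * A k j) with hE
    refine linearMap_mem_of_mem_span (q ^ E • LinearMap.mulLeft K (rowsZN Y k A)) ?_
      (rowDesc_mul_mem_minorRowSpan (hf.row k) (hf.exchange k) (A k) J)
    rintro _ ⟨J', a', hJ', ha', rfl⟩
    rw [hf.mul_rowDesc, LinearMap.smul_apply, LinearMap.mulLeft_apply, Finset.mul_sum,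
      Finset.smul_sum]
    refine sum_mem fun i hi => ?_
    rw [mul_smul_comm, smul_comm]
    refine smul_mem_of_mem_Zq (mul_mem (neg_q_sq_pow_mem _) (pow_mem q_mem_Zq _)) ?_
    have hcard : (J'.erase i).card = k := by
      rw [Finset.card_erase_of_mem hi, hJ', hJ]
      rfl
    rw [hE, ← mulRow_minor]
    refine mulRow_mem (by rw [hJ, hcard]) ?_ (ih _ hcard)
    rw [← ha', ← ind_erase hi]
    abel

/-- The first `k` columns. -/
def firstCols (n k : ℕ) : Finset (Fin n) := Finset.univ.filter fun j => (j : ℕ) < k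

theorem card_firstCols {k : ℕ} (hk : k ≤ n) : (firstCols n k).card = k := by
  unfold firstCols
  rw [Fin.card_filter_val_lt, min_eq_right hk]

/-- Addition of the identity matrix. -/
def addOne (A : ℕ → Fin n → ℕ) (i : ℕ) : Fin n → ℕ := fun j => A i j + if (j : ℕ) = i then 1 else 0

theorem colSum_addOne (k : ℕ) (A : ℕ → Fin n → ℕ) :
    colSum k (addOne A) = colSum k A + ind (firstCols n k) := by
  funext j
  simp [colSum, addOne, ind, firstCols, Finset.sum_add_distrib]

/-- On the first `k` columns the expansion has a single term not divisible by `q`, the one using the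
diagonal entry of the last row. Inductively this term contributes the monomial of `A` plus the
identity; integrality of the others is `rowsZN_mul_mem`. -/
theorem MinorTower.rowsZN_mul_sub_mem (hf : MinorTower Y f) (k : ℕ) (hk : k ≤ n)
    (A : ℕ → Fin n → ℕ) :
    q⁻¹ • (q ^ (∑ j, (1 - ind (firstCols n k) j : ℤ) * colSum k A j) •
      (rowsZN Y k A * f k (firstCols n k)) - rowsZN Y k (addOne A)) ∈
      rowsLattice Y k (colSum k A + ind (firstCols n k)) := by
  have hq := q_ne_zero
  induction k with
  | zero =>
    have h : ∀ j : Fin n, colSum 0 A j = 0 := fun j => by rw [colSum_zero]; rfl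
    have h2 : firstCols n 0 = ∅ := by simp [firstCols]
    simp only [h, Nat.cast_zero, mul_zero, Finset.sum_const_zero, zpow_zero, one_smul]
    rw [hf.zero, if_pos h2, mul_one]
    simp [rowsZN]
  | succ k ih =>
    set J := firstCols n (k + 1) with hJ
    set e : Fin n := ⟨k, hk⟩ with he
    have hcardJ : J.card = k + 1 := card_firstCols hk
    have heJ : e ∈ J := by simp [hJ, he, firstCols]
    have herase : J.erase e = firstCols n k := by
      ext j
      simp only [hJ, he, firstCols, Finset.mem_erase, Finset.mem_filter, Finset.mem_univ,
        true_and, ne_eq, Fin.ext_iff]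
      omega
    have hle : ∀ j ∈ J, j ≤ e := by
      intro j hj
      simp only [hJ, firstCols, Finset.mem_filter] at hj
      exact Nat.lt_succ_iff.mp hj.2
    have hnot : ∀ j, j ∉ J → e < j := by
      intro j hj
      simp only [hJ, firstCols, Finset.mem_filter, Finset.mem_univ, true_and, not_lt] at hj
      exact hj
    set a := A k with ha
    set E := (∑ j, (1 - ind J j : ℤ) * (colSum k A j + a j)) +
      ((esymmTwo a : ℤ) - ∑ j, (colSum k A j : ℤ) * a j) with hE
    -- For this initial set of columns no corrections arise: entries in columns of `J` commute with
    -- the minor, and entries to its right `q⁻²`-commute. The scalar cancels the power of `q` that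
    -- these right-hand columns produce below.
    have hcomm : rowDesc (Y k) a * f (k + 1) J =
        ((q⁻¹) ^ (2 * ∑ l, if e < l then a l else 0)) • (f (k + 1) J * rowDesc (Y k) a) := by
      rw [rowDesc_mul (c := fun s => if e < s then (q⁻¹) ^ 2 else 1)]
      · congr 1
        rw [pow_mul, ← Finset.prod_pow_eq_pow_sum]
        refine Finset.prod_congr rfl fun s _ => ?_
        split_ifs <;> simp
      · intro s
        split_ifs with h
        · exact hf.exchange_of_lt k J s fun p hp => (hle p hp).trans_lt h
        · have hs : s ∈ J := by
            by_contra h'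
            exact h (hnot s h')
          rw [(hf.exchange k).mem J s hs, ← mul_pow, mul_inv_cancel₀ hq, one_pow]
    set U : Fin n → B := fun i => q ^ E • (rowsZN Y k A *
      (f k (J.erase i) * rowDesc (Y k) (a + Pi.single i 1))) with hU
    have hsum : q ^ E • (rowsZN Y k A * (rowDesc (Y k) a * f (k + 1) J)) =
        ∑ i ∈ J, ((-q ^ 2) ^ above J i *
          q ^ (2 * ∑ l, if i < l ∧ l ≤ e then a l else 0)) • U i := by
      rw [hcomm, hf.mul_rowDesc, Finset.smul_sum, Finset.mul_sum, Finset.smul_sum]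
      refine Finset.sum_congr rfl fun i hi => ?_
      have hsplit : ∑ l, (if i < l then a l else 0) = (∑ l, if i < l ∧ l ≤ e then a l else 0) +
          ∑ l, if e < l then a l else 0 := by
        rw [← Finset.sum_add_distrib]
        refine Finset.sum_congr rfl fun l _ => ?_
        rcases le_or_gt l e with h | h
        · simp [h, h.not_gt]
        · simp [h.not_ge, h, (hle i hi).trans_lt h]
      simp only [hU]
      rw [smul_smul, mul_smul_comm, smul_comm, hsplit, mul_add, pow_add]
      congr 1
      rw [mul_comm, mul_assoc, mul_assoc, ← mul_pow, mul_inv_cancel₀ hq, one_pow, mul_one]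
    have hUmem : ∀ i ∈ J, U i ∈ rowsLattice Y (k + 1) (colSum k A + a + ind J) := by
      intro i hi
      have hcard : (J.erase i).card = k := by
        rw [Finset.card_erase_of_mem hi, hcardJ]
        rfl
      simp only [hU]
      rw [hE, ← mulRow_minor]
      refine mulRow_mem (by rw [hcardJ, hcard]) ?_ (hf.rowsZN_mul_mem k A _ hcard)
      rw [← ind_erase hi]
      abel
    have hlead : q⁻¹ • (U e - rowsZN Y (k + 1) (addOne A)) ∈
        rowsLattice Y (k + 1) (colSum k A + a + ind J) := by
      have hcard : J.card = (firstCols n k).card + 1 := by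
        rw [hcardJ, card_firstCols (by omega)]
      have hw : a + Pi.single e 1 + ind (firstCols n k) = a + ind J := by
        rw [← herase, ← ind_erase heJ]
        abel
      have h1 := mulRow_rowsZN (Y := Y) (c := colSum k A) hcard hw (colSum_addOne k A)
      have h2 := mulRow_mem (Y := Y) (c := colSum k A) hcard hw (ih (by omega))
      have h3 : Function.update (addOne A) k (a + Pi.single e 1) = addOne A := by
        rw [Function.update_eq_self_iff]
        funext j
        simp [addOne, ha, Pi.single_apply, he, Fin.ext_iff]
      rw [map_smul, map_sub, h1, mulRow_minor, h3] at h2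
      simpa only [hU, herase] using h2
    have hκ : ((-q ^ 2) ^ above J e * q ^ (2 * ∑ l, if e < l ∧ l ≤ e then a l else 0)) = 1 := by
      have h1 : above J e = 0 := by
        unfold above
        rw [Finset.card_eq_zero, Finset.filter_eq_empty_iff]
        exact fun j hj => (hle j hj).not_gt
      have h2 : (∑ l, if e < l ∧ l ≤ e then a l else 0) = 0 :=
        Finset.sum_eq_zero fun l _ => if_neg fun h => h.1.not_ge h.2
      rw [h1, h2]
      simp
    rw [rowsZN_succ_mul, ← hE, hsum, ← Finset.add_sum_erase J _ heJ, hκ, one_smul, colSum_succ,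
      add_sub_right_comm, smul_add]
    refine add_mem hlead ?_
    rw [Finset.smul_sum]
    refine sum_mem fun i hi => ?_
    obtain ⟨hi1, hi2⟩ := Finset.mem_erase.mp hi
    -- Every column other than the last one `e` has `e` above it, so its coefficient contains a
    -- factor `q²` and stays in `ℤ[q]` after division by `q`.
    have hpos : 0 < above J i :=
      Finset.card_pos.mpr ⟨e, Finset.mem_filter.mpr ⟨heJ, lt_of_le_of_ne (hle i hi2) hi1⟩⟩
    obtain ⟨r, hr⟩ := Nat.exists_eq_succ_of_ne_zero hpos.ne'
    have hc : q⁻¹ * ((-q ^ 2) ^ above J i *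
        q ^ (2 * ∑ l, if i < l ∧ l ≤ e then a l else 0)) = -q * ((-q ^ 2) ^ r *
        q ^ (2 * ∑ l, if i < l ∧ l ≤ e then a l else 0)) := by
      rw [hr, pow_succ]
      field_simp
    rw [smul_smul, hc]
    exact smul_mem_of_mem_Zq (mul_mem (neg_mem q_mem_Zq)
      (mul_mem (neg_q_sq_pow_mem _) (pow_mem q_mem_Zq _))) (hUmem i hi2)

end Tower

/-! ### Normalized monomials times the quantum determinant -/

theorem minorTower_zrow (n : ℕ) : MinorTower (zrow (n := n)) minor where
  zero _ := rfl
  succ _ _ := rfl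
  row := zrow_row
  exchange := minorExchange_minor_last
  exchange_of_lt k _ _ := zrow_mul_minor_of_lt k

theorem esymmTwo_castSucc {k : ℕ} (g : Fin (k + 1) → ℕ) :
    esymmTwo g = esymmTwo (fun i : Fin k => g i.castSucc) +
      (∑ i : Fin k, g i.castSucc) * g (Fin.last k) := by
  have h1 := two_mul_esymmTwo g
  have h2 := two_mul_esymmTwo fun i : Fin k => g i.castSucc
  rw [Fin.sum_univ_castSucc, Fin.sum_univ_castSucc] at h1
  zify
  linarith

theorem rowsZN_eq {n : ℕ} (k : ℕ) (A : ℕ → Fin n → ℕ) :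
    rowsZN zrow k A = (q⁻¹) ^ ((∑ i : Fin k, esymmTwo (A i)) +
      ∑ j, esymmTwo fun i : Fin k => A i j) •
        (List.ofFn fun i : Fin k => rowProd (zrow i) (A i)).prod := by
  have hq := q_ne_zero
  induction k with
  | zero =>
    have h : ∀ g : Fin 0 → ℕ, esymmTwo g = 0 := fun g => by
      have := two_mul_esymmTwo g
      simpa using this
    simp [rowsZN, h]
  | succ k ih =>
    have h : ∀ j, colSum k A j = ∑ i : Fin k, A i j := fun j => (Fin.sum_univ_eq_sum_range _ k).symm
    rw [rowsZN, ih, List.ofFn_succ', List.concat_eq_append, List.prod_append, List.prod_singleton,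
      Fin.sum_univ_castSucc]
    simp only [esymmTwo_castSucc, Finset.sum_add_distrib, Fin.val_castSucc, Fin.val_last, h]
    rw [rowDesc, smul_mul_smul_comm, smul_smul]
    congr 1
    rw [← zpow_natCast, ← zpow_natCast, ← zpow_natCast, inv_zpow', inv_zpow', inv_zpow',
      ← zpow_add₀ hq, ← zpow_add₀ hq]
    congr 1
    push_cast
    ring

/-- The square matrix formed by the first `n` rows. -/
def topRows {n : ℕ} (A : ℕ → Fin n → ℕ) : Mat n := Matrix.of fun i j => A i j

theorem rowsZN_eq_ZN {n : ℕ} (A : ℕ → Fin n → ℕ) : rowsZN zrow n A = ZN (topRows A) := by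
  rw [rowsZN_eq]
  have h : normExp (topRows A) = (∑ i : Fin n, esymmTwo (A i)) +
      ∑ j, esymmTwo fun i : Fin n => A i j := rfl
  unfold ZN
  rw [h]
  unfold monomial rowProd
  simp [zrow, topRows]

/-- The case of all `n` rows and columns of the tower: the weight exponent is then zero. -/
theorem ZN_mul_detq_sub_mem {n : ℕ} (A : Mat n) :
    ZN A * detq n - ZN (A + 1) ∈ qLattice Set.univ := by
  set A' : ℕ → Fin n → ℕ := fun i j => if h : i < n then A ⟨i, h⟩ j else 0 with hA
  have h1 := (minorTower_zrow n).rowsZN_mul_sub_mem n le_rfl A'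
  have h2 : firstCols n n = Finset.univ := by
    ext j
    simp [firstCols]
  have h3 : ∀ j : Fin n, (1 - ind Finset.univ j : ℤ) = 0 := fun j => by simp [ind]
  have h4 : topRows A' = A := by
    funext i j
    simp [topRows, hA]
  have h5 : topRows (addOne A') = (A + 1 : Mat n) := by
    funext i j
    simp [topRows, hA, addOne, Matrix.one_apply, Fin.ext_iff, eq_comm]
  simp only [h2, h3, zero_mul, Finset.sum_const_zero, zpow_zero, one_smul] at h1
  rw [rowsZN_eq_ZN, rowsZN_eq_ZN, h4, h5, ← detq_eq_minor] at h1
  have h6 := linearMap_mem_of_mem_span (M := qLattice Set.univ)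
    (q • LinearMap.id : O n →ₗ[K] O n) ?_ h1
  · rwa [LinearMap.smul_apply, LinearMap.id_apply, smul_smul, mul_inv_cancel₀ q_ne_zero,
      one_smul] at h6
  · rintro _ ⟨C, -, rfl⟩
    exact Submodule.subset_span ⟨_, Set.mem_univ _, by rw [rowsZN_eq_ZN]; rfl⟩

/-! ### The anti-automorphism reversing rows and columns -/

/-- Reversal of both indices. -/
def rot {n : ℕ} (u : Fin n × Fin n) : Fin n × Fin n := (u.1.rev, u.2.rev)

/-- The anti-automorphism `Z_{ij} ↦ Z_{n+1-i,n+1-j}` as a homomorphism to the opposite algebra. -/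
def flipHom (n : ℕ) : O n →ₐ[K] (O n)ᵐᵒᵖ :=
  RingQuot.liftAlgHom K ⟨FreeAlgebra.lift K fun p : Fin n × Fin n =>
    MulOpposite.op (Z p.1.rev p.2.rev), by
    intro x y h
    cases h with
    | row i j k h =>
      simp only [gen, map_mul, map_smul, FreeAlgebra.lift_ι_apply, ← MulOpposite.op_mul,
        ← MulOpposite.op_smul]
      rw [Z_row _ _ _ (Fin.rev_lt_rev.mpr h)]
    | col i k j h =>
      simp only [gen, map_mul, map_smul, FreeAlgebra.lift_ι_apply, ← MulOpposite.op_mul,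
        ← MulOpposite.op_smul]
      rw [Z_col _ _ _ (Fin.rev_lt_rev.mpr h)]
    | anti i j s t h h' =>
      simp only [gen, map_mul, FreeAlgebra.lift_ι_apply, ← MulOpposite.op_mul]
      rw [Z_anti _ _ _ _ (Fin.rev_lt_rev.mpr h) (Fin.rev_lt_rev.mpr h')]
    | diag i j s t h h' =>
      simp only [gen, map_mul, map_add, map_smul, FreeAlgebra.lift_ι_apply,
        ← MulOpposite.op_mul, ← MulOpposite.op_smul, ← MulOpposite.op_add]
      rw [Z_diag _ _ _ _ (Fin.rev_lt_rev.mpr h) (Fin.rev_lt_rev.mpr h')]⟩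

/-- The anti-automorphism `Z_{ij} ↦ Z_{n+1-i,n+1-j}`. -/
def flip (n : ℕ) : O n →ₗ[K] O n :=
  (MulOpposite.opLinearEquiv K).symm.toLinearMap ∘ₗ (flipHom n).toLinearMap

theorem flip_mul {n : ℕ} (x y : O n) : flip n (x * y) = flip n y * flip n x := by
  simp [flip]

theorem flip_one (n : ℕ) : flip n 1 = 1 := by
  simp [flip]

theorem flip_Z {n : ℕ} (i j : Fin n) : flip n (Z i j) = Z i.rev j.rev := by
  simp [flip, flipHom, Z, gen]

theorem flip_wordProd {n : ℕ} (w : List (Fin n × Fin n)) :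
    flip n (wordProd w) = wordProd (w.reverse.map rot) := by
  induction w with
  | nil => exact flip_one n
  | cons u w ih =>
    rw [List.reverse_cons, List.map_append, wordProd_append, ← ih]
    simp [wordProd, flip_mul, flip_Z, rot]

theorem wordExp_map {m n : ℕ} {g : Fin m × Fin m → Fin n × Fin n} {c : ℤ}
    (h : ∀ u v, kappa (g u) (g v) = c * kappa u v) (w : List (Fin m × Fin m)) :
    wordExp (w.map g) = c * wordExp w := by
  induction w with
  | nil => simp [wordExp]
  | cons u w ih =>
    rw [List.map_cons, wordExp, wordExp, ih, mul_add, ← List.sum_map_mul_left, List.map_map]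
    simp [Function.comp_def, h]

theorem code_rot_lt {n : ℕ} {u v : Fin n × Fin n} :
    code (rot u).1 (rot u).2 < code (rot v).1 (rot v).2 ↔ code v.1 v.2 < code u.1 u.2 := by
  simp only [code_lt_iff, rot, Fin.rev_lt_rev, Fin.rev_inj]
  tauto

theorem kappa_rot {n : ℕ} (u v : Fin n × Fin n) : kappa (rot u) (rot v) = -1 * kappa u v := by
  unfold kappa
  simp only [code_rot_lt]
  simp only [rot, Fin.rev_inj]
  split_ifs <;> simp

theorem flip_wordNorm {n : ℕ} (w : List (Fin n × Fin n)) :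
    flip n (wordNorm w) = wordNorm (w.reverse.map rot) := by
  unfold wordNorm
  rw [map_smul, flip_wordProd, wordExp_map kappa_rot, wordExp_reverse]
  simp

/-- Rotation of a matrix. -/
def rotMat {n : ℕ} (A : Mat n) : Mat n := Matrix.of fun i j => A i.rev j.rev

theorem rotMat_rotMat {n : ℕ} (A : Mat n) : rotMat (rotMat A) = A := by
  ext i j
  simp [rotMat]

theorem rotMat_add_one {n : ℕ} (A : Mat n) : rotMat (A + 1) = rotMat A + 1 := by
  ext i j
  simp [rotMat, Matrix.one_apply]

theorem rot_injective {n : ℕ} : Function.Injective (rot (n := n)) := by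
  intro u v h
  simpa [rot, Prod.ext_iff] using h

/-- Reversing the word and reversing all positions both invert the lexicographic order, so a sorted
word becomes a sorted word. -/
theorem flip_ZN {n : ℕ} (A : Mat n) : flip n (ZN A) = ZN (rotMat A) := by
  rw [← wordNorm_sortedWord, flip_wordNorm, wordNorm_of_sorted]
  · congr 1
    ext i j
    rw [content, show (i, j) = rot (i.rev, j.rev) by simp [rot],
      List.count_map_of_injective _ _ rot_injective, List.count_reverse]
    exact congrFun (congrFun (content_sortedWord A) i.rev) j.rev
  · unfold WordSorted
    rw [List.pairwise_map, List.pairwise_reverse]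
    refine (wordSorted_sortedWord A).imp fun {u v} h => ?_
    rw [← not_lt] at h ⊢
    rwa [code_rot_lt]

theorem reverse_ofFn {α : Type*} {n : ℕ} (f : Fin n → α) :
    (List.ofFn f).reverse = List.ofFn fun i => f i.rev := by
  apply List.ext_getElem
  · simp
  · intro i h1 h2
    simp only [List.getElem_reverse, List.getElem_ofFn, List.length_ofFn]
    congr 1
    ext
    simp [Fin.val_rev]
    omega

theorem detq_eq_sum_wordProd (n : ℕ) : detq n = ∑ σ : Equiv.Perm (Fin n),
    (-q ^ 2) ^ len σ • wordProd (List.ofFn fun k => (k, σ k)) := by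
  simp [detq, wordProd, List.map_ofFn, Function.comp_def]

theorem len_conj_rev {n : ℕ} (σ : Equiv.Perm (Fin n)) :
    len (Fin.revPerm * σ * Fin.revPerm) = len σ := by
  unfold len
  refine Finset.card_bij' (fun p _ => (p.2.rev, p.1.rev)) (fun p _ => (p.2.rev, p.1.rev))
    ?_ ?_ ?_ ?_
  · simp
  · simp
  · simp
  · simp

theorem flip_detq (n : ℕ) : flip n (detq n) = detq n := by
  rw [detq_eq_sum_wordProd, map_sum]
  refine Finset.sum_nbij' (fun σ => Fin.revPerm * σ * Fin.revPerm)
    (fun σ => Fin.revPerm * σ * Fin.revPerm) ?_ ?_ ?_ ?_ ?_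
  · simp
  · simp
  · intro σ _
    ext k
    simp
  · intro σ _
    ext k
    simp
  · intro σ _
    rw [map_smul, flip_wordProd, len_conj_rev, reverse_ofFn, List.map_ofFn]
    congr 3
    funext k
    simp [rot]

theorem flip_mem_qLattice {n : ℕ} {x : O n} (hx : x ∈ qLattice (Set.univ : Set (Mat n))) :
    flip n x ∈ qLattice (Set.univ : Set (Mat n)) := by
  refine linearMap_mem_of_mem_span _ ?_ hx
  rintro _ ⟨A, -, rfl⟩
  exact Submodule.subset_span ⟨rotMat A, Set.mem_univ _, by rw [map_smul, flip_ZN]⟩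

theorem detq_mul_ZN_sub_mem {n : ℕ} (A : Mat n) :
    detq n * ZN A - ZN (A + 1) ∈ qLattice Set.univ := by
  have h := flip_mem_qLattice (ZN_mul_detq_sub_mem (rotMat A))
  rwa [map_sub, flip_mul, flip_ZN, flip_ZN, flip_detq, rotMat_rotMat, rotMat_add_one,
    rotMat_rotMat] at h

/-! ### Multiplication by the quantum determinant -/

/-- A linear map sending each `Z(B)` to some `Z(g B)` modulo `q L^*` preserves `q L^*`, so `Z(A)`
may be replaced by `b(A)`. -/
theorem smul_ZN_add_mem {n : ℕ} {T : O n →ₗ[K] O n} {g : Mat n → Mat n}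
    (hT : ∀ A, T (ZN A) - ZN (g A) ∈ qLattice Set.univ) (A : Mat n) :
    T (dualCanonical A) - ZN (g A) ∈ qLattice Set.univ := by
  have h : T (dualCanonical A - ZN A) ∈ qLattice (Set.univ : Set (Mat n)) := by
    refine linearMap_mem_of_mem_span T ?_ (dualCanonical_sub_mem A)
    rintro _ ⟨B, -, rfl⟩
    have h1 := smul_mem_qLattice q_mem_Zq (hT B)
    have h2 := add_mem h1 (Submodule.subset_span ⟨g B, Set.mem_univ _, rfl⟩)
    rw [O_smul_sub, sub_add_cancel] at h2
    have h3 : T (q • ZN B) = q • T (ZN B) := T.map_smul q (ZN B)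
    rw [h3]
    exact h2
  have h3 := add_mem h (hT A)
  rwa [map_sub, sub_add_sub_cancel] at h3

/-- Bar exchanges the left and right products, which agree modulo `q L^*`. Their difference is
negated by bar and hence zero, which makes the product bar-invariant. -/
theorem dualCanonical_mul_detq_eq {n : ℕ} (A : Mat n) :
    dualCanonical A * detq n = dualCanonical (A + 1) ∧
      detq n * dualCanonical A = dualCanonical (A + 1) := by
  have h1 : dualCanonical A * detq n - ZN (A + 1) ∈ qLattice (Set.univ : Set (Mat n)) :=
    smul_ZN_add_mem (T := LinearMap.mulRight K (detq n)) ZN_mul_detq_sub_mem A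
  have h2 : detq n * dualCanonical A - ZN (A + 1) ∈ qLattice (Set.univ : Set (Mat n)) :=
    smul_ZN_add_mem (T := LinearMap.mulLeft K (detq n)) detq_mul_ZN_sub_mem A
  have hbar : bar (dualCanonical A * detq n) = detq n * dualCanonical A := by
    rw [bar_mul, bar_detq, bar_dualCanonical]
  have hbar' : bar (detq n * dualCanonical A) = dualCanonical A * detq n := by
    rw [bar_mul, bar_detq, bar_dualCanonical]
  have hcomm : dualCanonical A * detq n = detq n * dualCanonical A := by
    rw [← sub_eq_zero]
    apply eq_zero_of_mem_qLattice (S := Set.univ)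
    · have := sub_mem h1 h2
      rwa [sub_sub_sub_cancel_right] at this
    · right
      rw [bar_sub, hbar, hbar', neg_sub]
  have h3 : dualCanonical A * detq n = dualCanonical (A + 1) :=
    eq_dualCanonical (hbar.trans hcomm.symm) h1
  exact ⟨h3, hcomm.symm.trans h3⟩

/-! ### Principal submatrices -/

/-- The homomorphism `Z_{ij} ↦ Z_{e(i)e(j)}` attached to an increasing map `e`. -/
def emb {m n : ℕ} (e : Fin m ↪o Fin n) : O m →ₐ[K] O n :=
  RingQuot.liftAlgHom K ⟨FreeAlgebra.lift K fun p : Fin m × Fin m => Z (e p.1) (e p.2), by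
    intro x y h
    cases h with
    | row i j k h =>
      simp only [gen, map_mul, map_smul, FreeAlgebra.lift_ι_apply]
      exact Z_row _ _ _ (e.lt_iff_lt.mpr h)
    | col i k j h =>
      simp only [gen, map_mul, map_smul, FreeAlgebra.lift_ι_apply]
      exact Z_col _ _ _ (e.lt_iff_lt.mpr h)
    | anti i j s t h h' =>
      simp only [gen, map_mul, FreeAlgebra.lift_ι_apply]
      exact Z_anti _ _ _ _ (e.lt_iff_lt.mpr h) (e.lt_iff_lt.mpr h')
    | diag i j s t h h' =>
      simp only [gen, map_mul, map_add, map_smul, FreeAlgebra.lift_ι_apply]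
      exact Z_diag _ _ _ _ (e.lt_iff_lt.mpr h) (e.lt_iff_lt.mpr h')⟩

section Embedding

variable {m n : ℕ} (e : Fin m ↪o Fin n)

theorem emb_Z (i j : Fin m) : emb e (Z i j) = Z (e i) (e j) := by
  simp [emb, Z, gen]

theorem bar_algebraMap (n : ℕ) (c : K) : bar (algebraMap K (O n) c) = algebraMap K (O n) (barK c) := by
  have h : bar (1 : O n) = 1 := by simp [bar]
  rw [Algebra.algebraMap_eq_smul_one, bar_smul, h, Algebra.algebraMap_eq_smul_one]

theorem bar_emb (x : O m) : bar (emb e x) = emb e (bar x) := by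
  obtain ⟨x, rfl⟩ := RingQuot.mkAlgHom_surjective K (Rel m) x
  induction x using FreeAlgebra.induction with
  | grade0 c => rw [AlgHom.commutes, AlgHom.commutes, bar_algebraMap, bar_algebraMap,
      AlgHom.commutes]
  | grade1 p =>
    change bar (emb e (Z p.1 p.2)) = emb e (bar (Z p.1 p.2))
    rw [emb_Z, bar_Z, bar_Z, emb_Z]
  | mul x y hx hy => rw [map_mul, map_mul, bar_mul, bar_mul, map_mul, hx, hy]
  | add x y hx hy => rw [map_add, map_add, bar_add, bar_add, map_add, hx, hy]

/-- The image of a letter. -/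
def embLetter (u : Fin m × Fin m) : Fin n × Fin n := (e u.1, e u.2)

theorem embLetter_injective : Function.Injective (embLetter e) := by
  intro u v h
  simpa [embLetter, Prod.ext_iff] using h

theorem code_embLetter_lt (u v : Fin m × Fin m) :
    code (embLetter e u).1 (embLetter e u).2 < code (embLetter e v).1 (embLetter e v).2 ↔
      code u.1 u.2 < code v.1 v.2 := by
  simp [code_lt_iff, embLetter]

theorem kappa_embLetter (u v : Fin m × Fin m) :
    kappa (embLetter e u) (embLetter e v) = 1 * kappa u v := by
  unfold kappa
  simp only [code_embLetter_lt]
  simp [embLetter]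

theorem emb_wordNorm (w : List (Fin m × Fin m)) :
    emb e (wordNorm w) = wordNorm (w.map (embLetter e)) := by
  unfold wordNorm wordProd
  rw [map_smul, wordExp_map (kappa_embLetter e), one_mul, map_list_prod, List.map_map,
    List.map_map]
  congr 3
  funext u
  exact emb_Z e _ _

/-- Extension of a matrix by zero. -/
def extMat (A : Mat m) : Mat n := content ((sortedWord A).map (embLetter e))

theorem emb_ZN (A : Mat m) : emb e (ZN A) = ZN (extMat e A) := by
  rw [← wordNorm_sortedWord, emb_wordNorm, wordNorm_of_sorted]
  · rfl
  · unfold WordSorted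
    rw [List.pairwise_map]
    refine (wordSorted_sortedWord A).imp fun {u v} h => ?_
    rw [← not_lt] at h ⊢
    rwa [code_embLetter_lt]

theorem extMat_apply (A : Mat m) (i j : Fin m) : extMat e A (e i) (e j) = A i j := by
  unfold extMat content
  rw [show (e i, e j) = embLetter e (i, j) from rfl,
    List.count_map_of_injective _ _ (embLetter_injective e)]
  exact congrFun (congrFun (content_sortedWord A) i) j

theorem extMat_eq_zero (A : Mat m) {i j : Fin n} (h : ¬ (i ∈ Set.range e ∧ j ∈ Set.range e)) :
    extMat e A i j = 0 := by
  refine List.count_eq_zero.mpr fun hmem => h ?_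
  obtain ⟨u, -, hu⟩ := List.mem_map.mp hmem
  exact ⟨⟨u.1, congrArg Prod.fst hu⟩, ⟨u.2, congrArg Prod.snd hu⟩⟩

theorem extMat_diagonal {a : Fin n → ℕ} (ha : ∀ j, j ∉ Set.range e → a j = 0) :
    extMat e (Matrix.diagonal fun i => a (e i)) = Matrix.diagonal a := by
  ext i j
  by_cases h : i ∈ Set.range e ∧ j ∈ Set.range e
  · obtain ⟨⟨i, rfl⟩, ⟨j, rfl⟩⟩ := h
    rw [extMat_apply]
    simp [Matrix.diagonal_apply]
  · rw [extMat_eq_zero e _ h, Matrix.diagonal_apply]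
    split_ifs with hij
    · subst hij
      rw [ha]
      exact fun hi => h ⟨hi, hi⟩
    · rfl

/-- The image is bar-invariant with the right leading term modulo `q L^*`, which already
characterizes it. -/
theorem emb_dualCanonical (A : Mat m) :
    emb e (dualCanonical A) = dualCanonical (extMat e A) := by
  apply eq_dualCanonical
  · rw [bar_emb, bar_dualCanonical]
  · rw [← emb_ZN, ← map_sub]
    refine linearMap_mem_of_mem_span (emb e).toLinearMap ?_ (dualCanonical_sub_mem A)
    rintro _ ⟨B, -, rfl⟩
    refine Submodule.subset_span ⟨extMat e B, Set.mem_univ _, ?_⟩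
    change q • ZN (extMat e B) = _
    rw [← emb_ZN]
    exact ((emb e).toLinearMap.map_smul q (ZN B)).symm

end Embedding

theorem emb_detq {n : ℕ} (I : Finset (Fin n)) :
    emb (I.orderEmbOfFin rfl) (detq I.card) = principalMinor I := by
  unfold detq principalMinor
  rw [map_sum]
  refine Finset.sum_congr rfl fun σ _ => ?_
  rw [map_smul, map_list_prod, List.map_ofFn]
  congr 3
  funext k
  exact emb_Z _ _ _

theorem principalMinor_mul_dualCanonical {n : ℕ} (I : Finset (Fin n)) {a : Fin n → ℕ}
    (ha : ∀ j, j ∉ I → a j = 0) :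
    principalMinor I * dualCanonical (Matrix.diagonal a) =
      dualCanonical (Matrix.diagonal (a + ind I)) := by
  have hr : ∀ j, j ∈ Set.range (I.orderEmbOfFin rfl) ↔ j ∈ I := by
    intro j
    rw [Finset.range_orderEmbOfFin]
    rfl
  rw [← extMat_diagonal (I.orderEmbOfFin rfl) (a := a) fun j hj => ha j (by rwa [hr] at hj),
    ← extMat_diagonal (I.orderEmbOfFin rfl) (a := a + ind I), ← emb_dualCanonical,
    ← emb_dualCanonical, ← emb_detq, ← map_mul, (dualCanonical_mul_detq_eq _).2]
  · congr 2
    rw [← Matrix.diagonal_one, Matrix.diagonal_add]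
    congr 1
    funext i
    simp [ind]
  · intro j hj
    rw [hr] at hj
    simp [ind, hj, ha j hj]

theorem principalMinor_pow_mul_dualCanonical {n : ℕ} (I : Finset (Fin n)) {a : Fin n → ℕ}
    (ha : ∀ j, j ∉ I → a j = 0) (d : ℕ) :
    principalMinor I ^ d * dualCanonical (Matrix.diagonal a) =
      dualCanonical (Matrix.diagonal (a + d • ind I)) := by
  induction d with
  | zero => simp
  | succ d ih =>
    rw [pow_succ', mul_assoc, ih, principalMinor_mul_dualCanonical, succ_nsmul, add_assoc]
    intro j hj
    simp [ha j hj, ind, hj]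

theorem dualCanonical_zero (n : ℕ) : dualCanonical (0 : Mat n) = 1 := by
  have h : ZN (0 : Mat n) = 1 := by
    have h1 : normExp (0 : Mat n) = 0 := by simp [normExp]
    have h2 : ∀ i j, (0 : Mat n) i j = 0 := fun _ _ => rfl
    simp [ZN, h1, monomial, List.ofFn_const]
  refine (eq_dualCanonical ?_ ?_).symm
  · simp [bar]
  · rw [h, sub_self]
    exact zero_mem _

/-- The entries of a sequence diminished by its entry before position `i`, along `τ`. -/
def tailDiag {n : ℕ} (a : Fin n → ℕ) (τ : Equiv.Perm (Fin n)) (i : ℕ) (s : Fin n) : ℕ :=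
  if i ≤ τ.symm s then
    a s - if h : 0 < i ∧ i ≤ n then a (τ ⟨i - 1, by omega⟩) else 0
  else 0

/-- Downward induction on `i`. The factors from `i + 1` on give a diagonal supported in the smaller
index set, so the next minor multiplies from the left and raises all entries of its larger index set
by the current increment. -/
theorem prod_drop_eq {n : ℕ} (a : Fin n → ℕ) (τ : Equiv.Perm (Fin n)) (ha : Monotone (a ∘ τ))
    (i : ℕ) (hi : i ≤ n) :
    ((List.ofFn fun i => principalMinor ((Finset.Ici i).map τ.toEmbedding) ^
      step (a ∘ τ) i).drop i).prod = dualCanonical (Matrix.diagonal (tailDiag a τ i)) := by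
  induction hi using Nat.decreasingInduction with
  | self =>
    rw [List.drop_of_length_le (by simp), List.prod_nil, ← dualCanonical_zero]
    congr 1
    rw [eq_comm, Matrix.diagonal_eq_zero]
    funext s
    simp [tailDiag]
  | of_succ i hi ih =>
    rw [List.drop_eq_getElem_cons (by simpa using hi), List.prod_cons, ih, List.getElem_ofFn,
      principalMinor_pow_mul_dualCanonical]
    · congr 2
      funext s
      have hmem : s ∈ (Finset.Ici (⟨i, hi⟩ : Fin n)).map τ.toEmbedding ↔ i ≤ τ.symm s := by
        rw [Finset.mem_map_equiv, Finset.mem_Ici, Fin.le_def]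
      have hle : ∀ h : i ≤ τ.symm s, a (τ ⟨i, hi⟩) ≤ a s := by
        intro h
        have := ha (show (⟨i, hi⟩ : Fin n) ≤ τ.symm s from h)
        simpa using this
      have hprev : (if (i : ℕ) = 0 then 0 else a (τ ⟨i - 1, by omega⟩)) ≤ a (τ ⟨i, hi⟩) := by
        split_ifs
        · exact Nat.zero_le _
        · exact ha (show (⟨i - 1, by omega⟩ : Fin n) ≤ ⟨i, hi⟩ from Nat.sub_le _ _)
      have hprev' : (if h : 0 < i ∧ i ≤ n then a (τ ⟨i - 1, by omega⟩) else 0) =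
          if (i : ℕ) = 0 then 0 else a (τ ⟨i - 1, by omega⟩) := by
        rcases Nat.eq_zero_or_pos i with h | h
        · simp [h]
        · simp [h, h.ne', hi.le]
      have hstep : step (a ∘ τ) ⟨i, hi⟩ =
          a (τ ⟨i, hi⟩) - if (i : ℕ) = 0 then 0 else a (τ ⟨i - 1, by omega⟩) := rfl
      simp only [Pi.add_apply, Pi.smul_apply, smul_eq_mul, ind, hmem, hstep, tailDiag, hprev']
      set p := if (i : ℕ) = 0 then 0 else a (τ ⟨i - 1, by omega⟩)
      rw [dif_pos ⟨Nat.succ_pos i, hi⟩]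
      simp only [Nat.add_sub_cancel]
      by_cases h1 : i + 1 ≤ (τ.symm s : ℕ)
      · have h2 : i ≤ (τ.symm s : ℕ) := by omega
        have := hle h2
        rw [if_pos h1, if_pos h2, if_pos h2]
        omega
      · rw [if_neg h1]
        by_cases h2 : i ≤ (τ.symm s : ℕ)
        -- The index `τ i` enters the support here; its entry is the increment alone.
        · have h3 : τ.symm s = ⟨i, hi⟩ := Fin.ext (by simp only; omega)
          have h4 : s = τ ⟨i, hi⟩ := by rw [← h3, Equiv.apply_symm_apply]
          rw [if_pos h2, if_pos h2, h4]
          omega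
        · rw [if_neg h2, if_neg h2]
          omega
    · intro s hs
      rw [Finset.mem_map_equiv, Finset.mem_Ici, Fin.le_def] at hs
      simp only at hs
      rw [tailDiag, if_neg (by omega)]

theorem dualCanonical_diagonal {n : ℕ} (a : Fin n → ℕ) (τ : Equiv.Perm (Fin n))
    (ha : Monotone (a ∘ τ)) :
    dualCanonical (Matrix.diagonal a) =
      (List.ofFn fun i => principalMinor ((Finset.Ici i).map τ.toEmbedding) ^
        step (a ∘ τ) i).prod := by
  have h := prod_drop_eq a τ ha 0 (Nat.zero_le n)
  rw [List.drop_zero] at h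
  rw [h]
  congr 2

end

end QuantumMatrix

/-! ### The proposition -/

theorem proposition3p6 (n : ℕ) :
    (∃! b : QuantumMatrix.Mat n → QuantumMatrix.O n, QuantumMatrix.IsDualCanonicalBasis b) ∧
    ∀ b : QuantumMatrix.Mat n → QuantumMatrix.O n, QuantumMatrix.IsDualCanonicalBasis b →
      (∀ x ∈ Set.range b, x * QuantumMatrix.detq n ∈ Set.range b ∧
        QuantumMatrix.detq n * x ∈ Set.range b) ∧
      (∀ A, b A * QuantumMatrix.detq n = b (A + 1)) ∧
      (∀ a : Fin n → ℕ, Monotone a →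
        b (Matrix.diagonal a) =
          (List.ofFn fun i => QuantumMatrix.cornerDet i ^ QuantumMatrix.step a i).prod) ∧
      (∀ (a : Fin n → ℕ) (τ : Equiv.Perm (Fin n)), Monotone (a ∘ τ) →
        b (Matrix.diagonal a) =
          (List.ofFn fun i => QuantumMatrix.principalMinor ((Finset.Ici i).map τ.toEmbedding) ^
            QuantumMatrix.step (a ∘ τ) i).prod) := by
  refine ⟨⟨_, QuantumMatrix.isDualCanonicalBasis_dualCanonical n,
    fun b hb => hb.eq_dualCanonical⟩, fun b hb => ?_⟩
  rw [hb.eq_dualCanonical]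
  refine ⟨?_, fun A => (QuantumMatrix.dualCanonical_mul_detq_eq A).1, fun a ha => ?_,
    fun a τ ha => QuantumMatrix.dualCanonical_diagonal a τ ha⟩
  · rintro _ ⟨A, rfl⟩
    exact ⟨⟨A + 1, (QuantumMatrix.dualCanonical_mul_detq_eq A).1.symm⟩,
      ⟨A + 1, (QuantumMatrix.dualCanonical_mul_detq_eq A).2.symm⟩⟩
  -- The corner determinants are the principal minors for the identity permutation.
  · rw [QuantumMatrix.dualCanonical_diagonal a (Equiv.refl _) ha]
    congr 2
    funext i
    have h : (Finset.Ici i).map (Equiv.refl (Fin n)).toEmbedding = Finset.Ici i := by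
      ext j
      simp
    rw [h]
    rfl
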